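/- Let $\mathfrak M_2\subset\mathfrak M_1$ be von Neumann algebras on a complex Hilbert space $\mathcal H$, and let $\Omega\in\mathcal H$ be a unit vector that is cyclic and separating for both. For $j=1,2$ let $S_j$ be the closure of the antilinear operator $a\Omega\mapsto a^*\Omega$ ($a\in\mathfrak M_j$), let $\Delta_j=S_j^*S_j$ be the modular operator, $\log\Delta_j=\int_{\mathbb R}k\,E_j(dk)$ its spectral decomposition, and $\sigma_1^t(a)=\Delta_1^{it}a\Delta_1^{-it}$ the modular flow of $\mathfrak M_1$. Let $E_1^-$ be the spectral projection of $\log\Delta_1$ for the negative half-line and $H_-=-E_1^-\log\Delta_1\ge 0$. Expectation values are understood as quadratic forms, $\langle\psi,f(\log\Delta_j)\psi\rangle=\int f(k)\,\langle\psi,E_j(dk)\psi\rangle$. Let $\tau>0$ and let $U\in\mathfrak M_2$ be a unitary such that $\sigma_1^t(U)\in\mathfrak M_2$ for all $|t|\le\tau$. 1. For every real $n>1$ there are constants $C,\tau_0>0$, depending only on $n$, such that if $\tau\ge\tau_0$ and $\langle U\Omega,(1+H_-)^nU\Omega\rangle<\infty$, then $\langle U\Omega,\log\Delta_1U\Omega\rangle$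 and $\langle U\Omega,\log\Delta_2U\Omega\rangle$ are finite and $$|\langle U\Omega,\log\Delta_1U\Omega\rangle-\langle U\Omega,\log\Delta_2U\Omega\rangle|\le C\,\tau^{1-n}\,\langle U\Omega,(1+H_-)^nU\Omega\rangle .$$ 2. For every $0<\alpha\le1$ there are constants $C,\tau_0>0$, depending only on $\alpha$, such that if $\tau\ge\tau_0$ and $\langle U\Omega,\exp(H_-^\alpha)U\Omega\rangle<\infty$, then $\langle U\Omega,\log\Delta_1U\Omega\rangle$ and $\langle U\Omega,\log\Delta_2U\Omega\rangle$ are finite and $$|\langle U\Omega,\log\Delta_1U\Omega\rangle-\langle U\Omega,\log\Delta_2U\Omega\rangle|\le C\,\tau^{1-\alpha}e^{-(\pi\tau)^\alpha}\,\langle U\Omega,\exp(H_-^\alpha)U\Omega\rangle .$$ -/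

import Mathlib

open scoped ComplexInnerProductSpace ComplexConjugate CompactlySupported

universe u

namespace Modular

noncomputable section

section Spectral

variable {H : Type u} [NormedAddCommGroup H] [InnerProductSpace ℂ H] [CompleteSpace H]

open Classical in
/-- The resolvent `(1 + A)⁻¹` of a positive self-adjoint, possibly unbounded, operator `A`: the
bounded everywhere defined operator `T` such that `T x` is in the domain of `A` and
`T x + A (T x) = x` for all `x`. (The value is `0` for operators `A` for which `1 + A` has no
bounded inverse; positive self-adjoint operators are not of this kind.) -/
def resolvent (A : H →ₗ.[ℂ] H) : H →L[ℂ] H :=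
  if h : ∃ T : H →L[ℂ] H, ∀ x, (T x, x - T x) ∈ A.graph then h.choose else 0

/-- For a bounded self-adjoint operator `T` and a vector `ψ`, the positive linear functional
`f ↦ ⟨ψ, f(T) ψ⟩` on compactly supported continuous functions (`cfc` is the continuous
functional calculus). -/
def vectorFunctional (T : H →L[ℂ] H) (ψ : H) : C_c(ℝ, ℝ) →ₚ[ℝ] ℝ :=
  PositiveLinearMap.mk₀
    { toFun := fun f => (⟪ψ, cfc (fun x => f x) T ψ⟫).re
      map_add' := fun f g => by
        have h : cfc (fun x => (f + g) x) T = cfc (fun x => f x) T + cfc (fun x => g x) T :=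
          cfc_add T (fun x => f x) (fun x => g x)
            (hf := f.continuous.continuousOn) (hg := g.continuous.continuousOn)
        rw [h]
        simp
      map_smul' := fun c f => by
        have h : cfc (fun x => (c • f) x) T = c • cfc (fun x => f x) T :=
          cfc_smul c (fun x => f x) (hf := f.continuous.continuousOn)
        rw [h]
        simp [inner_smul_right_eq_smul] }
    (fun f hf => by
      have hs : Continuous fun x => Real.sqrt (f x) := Real.continuous_sqrt.comp f.continuous
      have h1 : cfc (fun x => f x) T
          = cfc (fun x => Real.sqrt (f x)) T * cfc (fun x => Real.sqrt (f x)) T := by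
        rw [← cfc_mul (fun x => Real.sqrt (f x)) (fun x => Real.sqrt (f x)) T
          (hf := hs.continuousOn) (hg := hs.continuousOn)]
        congr 1
        funext x
        exact (Real.mul_self_sqrt (hf x)).symm
      have h2 : IsSelfAdjoint (cfc (fun x => Real.sqrt (f x)) T) := cfc_predicate _ T
      have h3 : ⟪ψ, cfc (fun x => f x) T ψ⟫
          = ⟪cfc (fun x => Real.sqrt (f x)) T ψ, cfc (fun x => Real.sqrt (f x)) T ψ⟫ := by
        rw [h1, mul_apply_eq_comp]
        conv_rhs => rw [← ContinuousLinearMap.adjoint_inner_right]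
        rw [← ContinuousLinearMap.star_eq_adjoint, h2.star_eq]
      change 0 ≤ (⟪ψ, cfc (fun x => f x) T ψ⟫).re
      rw [h3]
      exact inner_self_nonneg (𝕜 := ℂ))

/-- The spectral measure `B ↦ ⟨ψ, E_T(B) ψ⟩` of a bounded self-adjoint operator `T` at `ψ`: the
Borel measure on `ℝ` with `∫ f dμ = ⟨ψ, f(T) ψ⟩`. -/
def boundedSpectralMeasure (T : H →L[ℂ] H) (ψ : H) : MeasureTheory.Measure ℝ :=
  RealRMK.rieszMeasure (vectorFunctional T ψ)

/-- The spectral measure `B ↦ ⟨ψ, E_A(B) ψ⟩` of a positive self-adjoint, possibly unbounded,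
operator `A` at `ψ`. Since `A = T⁻¹ - 1` with `T = (1 + A)⁻¹` bounded and injective, it is the image
of the spectral measure of `T` under `s ↦ s⁻¹ - 1` (the point `s = 0` has measure zero). -/
def spectralMeasure (A : H →ₗ.[ℂ] H) (ψ : H) : MeasureTheory.Measure ℝ :=
  (boundedSpectralMeasure (resolvent A) ψ).map (fun s => s⁻¹ - 1)

end Spectral

section Tomita

variable {H : Type u} [NormedAddCommGroup H] [InnerProductSpace ℂ H] [CompleteSpace H]

/-- `Ω` is cyclic (`MΩ` is dense) and separating (`aΩ = 0` implies `a = 0` for `a ∈ M`). -/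
def IsCyclicSeparating (M : VonNeumannAlgebra H) (Ω : H) : Prop :=
  Dense {x : H | ∃ a ∈ M, a Ω = x} ∧ ∀ a ∈ M, a Ω = 0 → a = 0

/-- The graph of the Tomita operator `S`, i.e. of the closure of the antilinear operator
`aΩ ↦ a*Ω`, `a ∈ M`. -/
def tomitaGraph (M : VonNeumannAlgebra H) (Ω : H) : Set (H × H) :=
  closure {p : H × H | ∃ a ∈ M, p = (a Ω, (star a) Ω)}

theorem tomitaGraph_add {M : VonNeumannAlgebra H} {Ω : H} {p q : H × H}
    (hp : p ∈ tomitaGraph M Ω) (hq : q ∈ tomitaGraph M Ω) : p + q ∈ tomitaGraph M Ω := by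
  refine map_mem_closure₂ continuous_add hp hq ?_
  rintro _ ⟨a, ha, rfl⟩ _ ⟨b, hb, rfl⟩
  exact ⟨a + b, add_mem ha hb, by simp⟩

theorem tomitaGraph_smul {M : VonNeumannAlgebra H} {Ω : H} (c : ℂ) {p : H × H}
    (hp : p ∈ tomitaGraph M Ω) : (c • p.1, conj c • p.2) ∈ tomitaGraph M Ω := by
  have hc : Continuous fun p : H × H => (c • p.1, conj c • p.2) := by fun_prop
  refine map_mem_closure (f := fun p : H × H => (c • p.1, conj c • p.2)) hc hp ?_
  rintro _ ⟨a, ha, rfl⟩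
  exact ⟨c • a, M.toStarSubalgebra.smul_mem ha c, by simp⟩

theorem tomitaGraph_zero (M : VonNeumannAlgebra H) (Ω : H) : (0 : H × H) ∈ tomitaGraph M Ω :=
  subset_closure ⟨0, zero_mem M, by simp [Prod.ext_iff]⟩

/-- The graph of `S* S`: `ξ` is in the domain of `S* S` with `S* S ξ = η` iff `ξ` is in the
domain of `S` and `⟨S ζ, S ξ⟩ = ⟨η, ζ⟩` for all `ζ` in the domain of `S` (`S` is antilinear). -/
def modularGraph (M : VonNeumannAlgebra H) (Ω : H) : Submodule ℂ (H × H) where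
  carrier := {p | ∃ y, (p.1, y) ∈ tomitaGraph M Ω ∧
    ∀ q ∈ tomitaGraph M Ω, ⟪q.2, y⟫ = ⟪p.2, q.1⟫}
  add_mem' := by
    rintro p p' ⟨y, hy, h⟩ ⟨y', hy', h'⟩
    exact ⟨y + y', tomitaGraph_add hy hy', fun q hq => by
      simp [h q hq, h' q hq]⟩
  zero_mem' := ⟨0, tomitaGraph_zero M Ω, fun q _ => by simp⟩
  smul_mem' := by
    rintro c p ⟨y, hy, h⟩
    exact ⟨conj c • y, tomitaGraph_smul c hy, fun q hq => by
      simp [h q hq, mul_comm]⟩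

/-- The modular operator `Δ = S* S` of `(M, Ω)`; equivalently `S = J Δ^{1/2}` is the polar
decomposition of `S`. -/
def modularOperator (M : VonNeumannAlgebra H) (Ω : H) : H →ₗ.[ℂ] H :=
  (modularGraph M Ω).toLinearPMap

theorem modularGraph_functional {M : VonNeumannAlgebra H} {Ω : H} (h : IsCyclicSeparating M Ω)
    (p : H × H) (hp : p ∈ modularGraph M Ω) (h0 : p.1 = 0) : p.2 = 0 := by
  obtain ⟨y, hy, hq⟩ := hp
  have hy0 : y = 0 := by
    have := hq _ hy
    simpa [h0] using this
  have h1 : ∀ x ∈ {x : H | ∃ a ∈ M, a Ω = x}, ⟪p.2, x⟫ = 0 := by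
    rintro _ ⟨a, ha, rfl⟩
    have := hq (a Ω, (star a) Ω) (subset_closure ⟨a, ha, rfl⟩)
    simpa [hy0] using this.symm
  have h2 : ∀ x : H, ⟪p.2, x⟫ = 0 := fun x =>
    h.1.induction (P := fun x => ⟪p.2, x⟫ = 0) h1
      (isClosed_eq (by fun_prop) continuous_const) x
  exact inner_self_eq_zero.1 (h2 p.2)

theorem exists_graph (M : VonNeumannAlgebra H) (Ω : H) (x : H) :
    ∃ ξ y, (ξ, y) ∈ tomitaGraph M Ω ∧ ∀ q ∈ tomitaGraph M Ω, ⟪q.2, y⟫ = ⟪x - ξ, q.1⟫ := by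
  let _ : InnerProductSpace ℝ H := InnerProductSpace.rclikeToReal ℂ H
  let K : Submodule ℝ (WithLp 2 (H × H)) :=
    { carrier := {p | (p.fst, p.snd) ∈ tomitaGraph M Ω}
      add_mem' := fun hp hq => tomitaGraph_add hp hq
      zero_mem' := tomitaGraph_zero M Ω
      smul_mem' := fun c p hp => by
        have := tomitaGraph_smul (c : ℂ) hp
        simpa using this }
  have hK : IsClosed (K : Set (WithLp 2 (H × H))) :=
    isClosed_closure.preimage (f := fun p : WithLp 2 (H × H) => (p.fst, p.snd)) (by fun_prop)
  have : CompleteSpace K := hK.completeSpace_coe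
  let v : WithLp 2 (H × H) := WithLp.toLp 2 (x, 0)
  refine ⟨(K.starProjection v).fst, (K.starProjection v).snd, K.starProjection_apply_mem v, ?_⟩
  have key : ∀ q ∈ tomitaGraph M Ω,
      (⟪q.2, (K.starProjection v).snd⟫).re = (⟪x - (K.starProjection v).fst, q.1⟫).re := by
    intro q hq
    have h1 := K.starProjection_inner_eq_zero v (WithLp.toLp 2 q) hq
    rw [WithLp.prod_inner_apply] at h1
    have h2 : (⟪x - (K.starProjection v).fst, q.1⟫).re
      + (⟪0 - (K.starProjection v).snd, q.2⟫).re = 0 := h1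
    have h3 : (⟪(K.starProjection v).snd, q.2⟫).re = (⟪q.2, (K.starProjection v).snd⟫).re :=
      inner_re_symm (𝕜 := ℂ) _ _
    rw [zero_sub, inner_neg_left, Complex.neg_re, h3] at h2
    linarith
  intro q hq
  apply Complex.ext (key q hq)
  have := key _ (tomitaGraph_smul (-Complex.I) hq)
  simpa [inner_smul_left, inner_smul_right, inner_sub_left] using this

/-- `1 + Δ` has a bounded everywhere defined inverse. -/
theorem exists_resolvent {M : VonNeumannAlgebra H} {Ω : H} (h : IsCyclicSeparating M Ω) :
    ∃ T : H →L[ℂ] H, ∀ x, (T x, x - T x) ∈ (modularOperator M Ω).graph := by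
  have hg : (modularOperator M Ω).graph = modularGraph M Ω :=
    Submodule.toLinearPMap_graph_eq _ (fun p hp h0 => modularGraph_functional h p hp h0)
  rw [hg]
  have hpos : ∀ {p : H × H}, p ∈ modularGraph M Ω → 0 ≤ (⟪p.2, p.1⟫).re := by
    rintro p ⟨y, hy, hq⟩
    rw [← hq _ hy]
    exact inner_self_nonneg (𝕜 := ℂ)
  have hex : ∀ x, ∃ ξ, (ξ, x - ξ) ∈ modularGraph M Ω := fun x => by
    obtain ⟨ξ, y, h1, h2⟩ := exists_graph M Ω x
    exact ⟨ξ, y, h1, h2⟩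
  choose T hT using hex
  have huniq : ∀ x ξ, (ξ, x - ξ) ∈ modularGraph M Ω → ξ = T x := fun x ξ hξ => by
    have h1 := hpos (Submodule.sub_mem _ hξ (hT x))
    have h2 : (((ξ, x - ξ) - (T x, x - T x) : H × H)).2 = -(ξ - T x) := by simp
    rw [h2, inner_neg_left, Complex.neg_re] at h1
    have h3 : (⟪ξ - T x, ξ - T x⟫).re = ‖ξ - T x‖ ^ 2 := inner_self_eq_norm_sq (𝕜 := ℂ) _
    have h4 : ‖ξ - T x‖ ^ 2 ≤ 0 := by
      rw [← h3]
      exact neg_nonneg.1 h1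
    exact sub_eq_zero.1 (norm_eq_zero.1 (pow_eq_zero_iff (two_ne_zero) |>.1
      (le_antisymm h4 (sq_nonneg _))))
  let T' : H →ₗ[ℂ] H :=
    { toFun := T
      map_add' := fun x y => by
        refine (huniq _ _ ?_).symm
        have := Submodule.add_mem _ (hT x) (hT y)
        convert this using 1
        simp only [Prod.mk_add_mk, Prod.mk.injEq, true_and]
        abel
      map_smul' := fun c x => by
        refine (huniq _ _ ?_).symm
        have := Submodule.smul_mem _ c (hT x)
        simpa [smul_sub] using this }
  refine ⟨T'.mkContinuous 1 fun x => ?_, hT⟩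
  change ‖T x‖ ≤ 1 * ‖x‖
  have h1 := hpos (hT x)
  have h2 : (⟪x - T x, T x⟫).re = (⟪x, T x⟫).re - ‖T x‖ ^ 2 := by
    rw [inner_sub_left, Complex.sub_re]
    congr 1
    exact inner_self_eq_norm_sq (𝕜 := ℂ) _
  have h3 : (⟪x, T x⟫).re ≤ ‖x‖ * ‖T x‖ := re_inner_le_norm (𝕜 := ℂ) _ _
  simp only [h2] at h1
  by_contra! hc
  nlinarith [norm_nonneg x, norm_nonneg (T x)]

/-- The spectral measure `⟨ψ, E(dk) ψ⟩` of the modular Hamiltonian `log Δ = ∫ k E(dk)` at `ψ`: the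
image of that of `Δ` under `log` (for cyclic and separating `Ω`, `Δ` is injective, so that `0` has
measure zero). -/
def modularMeasure (M : VonNeumannAlgebra H) (Ω ψ : H) : MeasureTheory.Measure ℝ :=
  (spectralMeasure (modularOperator M Ω) ψ).map Real.log

/-- The quadratic form `⟨ψ, f(log Δ) ψ⟩ = ∫ f(k) ⟨ψ, E(dk) ψ⟩`. -/
def modularExpectation (M : VonNeumannAlgebra H) (Ω : H) (f : ℝ → ℝ) (ψ : H) : ℝ :=
  ∫ k, f k ∂(modularMeasure M Ω ψ)

/-- `⟨ψ, f(log Δ) ψ⟩` is finite: `ψ` is in the form domain of `f(log Δ)`,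
i.e. `∫ |f(k)| ⟨ψ, E(dk) ψ⟩ < ∞`. -/
def HasModularExpectation (M : VonNeumannAlgebra H) (Ω : H) (f : ℝ → ℝ) (ψ : H) : Prop :=
  MeasureTheory.Integrable f (modularMeasure M Ω ψ)

open Classical in
/-- The unitary `Δ^{it} = ∫ e^{itk} E(dk)`: the bounded operator whose quadratic form is
`⟨ψ, Δ^{it} ψ⟩ = ∫ e^{itk} ⟨ψ, E(dk) ψ⟩` for all `ψ`. -/
def modularUnitary (M : VonNeumannAlgebra H) (Ω : H) (t : ℝ) : H →L[ℂ] H :=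
  if h : ∃ B : H →L[ℂ] H, ∀ ψ : H,
        ⟪ψ, B ψ⟫ = ∫ k : ℝ, Complex.exp ((t * k : ℝ) * Complex.I) ∂(modularMeasure M Ω ψ)
    then h.choose else 0

/-- The modular flow `σ^t(a) = Δ^{it} a Δ^{-it}`. -/
def modularFlow (M : VonNeumannAlgebra H) (Ω : H) (t : ℝ) (a : H →L[ℂ] H) : H →L[ℂ] H :=
  modularUnitary M Ω t * a * modularUnitary M Ω (-t)

end Tomita

end

end Modular

/-!
Write `ψ = U Ω`, let `S_j` be the Tomita operators of `M_j` and `Δ_j` the modular operators, and let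
`μ_j` be the spectral measure of `log Δ_j` at `ψ`. As `S₂` is a restriction of `S₁`, the forms
`l ‖χ‖² + ‖S χ‖²` of `l + Δ₁` and `l + Δ₂` agree on the domain of `S₂`. Since
`⟨ψ, (l + Δ)⁻¹ ψ⟩` is the maximum of `2 Re ⟨ψ, χ⟩ - l ‖χ‖² - ‖S χ‖²` (`le_integral_inv_add_exp`),
the difference `D(l) = ⟨ψ, (l + Δ₁)⁻¹ ψ⟩ - ⟨ψ, (l + Δ₂)⁻¹ ψ⟩` is nonnegative, and every `χ` in the
domain of `S₂` bounds it from above.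

The hypothesis on the modular flow supplies trial vectors: `Δ₁^{it} ψ = σ₁^t(U) Ω` belongs to `M₂ Ω`
for `|t| ≤ τ`, and so does `G(log Δ₁) ψ` for a trigonometric polynomial `G` with frequencies at most
`τ`. Because `‖S₁ χ‖² = ⟨χ, Δ₁ χ⟩` (`exp_modularMeasure`), this gives
`D(l) ≤ ∫ (l + eᵏ) |(l + eᵏ)⁻¹ - G(k)|² dμ₁(k)` (`integral_inv_add_exp_sub_le`), which persists for
bounded pointwise limits of such `G`.

With `l = eʳ`, the function to be approximated is `e⁻ʳ / (1 + e^{k-r})`. The partial fractions of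
the Fermi function, `1 / (1 + eˣ) = 1/2 - ∑ⱼ 2 x / (x² + aⱼ²)` with `aⱼ = (2 j + 1) π`, and
`x / (x² + a²) = ∫₀^∞ e^{-a t} sin (t x) dt` show that cutting off the integrals at `t = τ` costs an
error of order `e^{-πτ}`, uniformly in `x` (`abs_fermi_sub_fermiApprox_le`). The choice `G = l⁻¹`
gives `D(l) ≤ l⁻²`, better for `l > e^{πτ}`, and `G = 0` gives the bound used for `l < e^{-πτ}`.

Integration over `l`, with `log x = ∫₀^∞ ((1 + l)⁻¹ - (l + x)⁻¹) dl`, yields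
`0 ≤ ⟨log Δ₂⟩ - ⟨log Δ₁⟩ ≤ ∫ log (1 + e^{-πτ-k}) dμ₁(k) + O(e^{-πτ})`
(`abs_integral_sub_integral_le`), and it remains to compare `log (1 + e^{-πτ-k})` with the two weights
(`log_one_add_exp_le_rpow`, `log_one_add_exp_le_exp_rpow`).
-/

namespace Modular

open MeasureTheory Filter Topology Set
open scoped BoundedContinuousFunction

/-! ### Spectral measures of operators between 0 and 1 -/

section SpectralMeasure

variable {H : Type u} [NormedAddCommGroup H] [InnerProductSpace ℂ H] [CompleteSpace H]

theorem spectrum_subset_Icc {T : H →L[ℂ] H} (h0 : 0 ≤ T) (h1 : T ≤ 1) :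
    spectrum ℝ T ⊆ Icc 0 1 := by
  have hs : IsSelfAdjoint T := .of_nonneg h0
  intro x hx
  exact ⟨spectrum_nonneg_of_nonneg h0 hx, (CFC.le_one_iff T hs).1 h1 x hx⟩

theorem integral_boundedSpectralMeasure_compactlySupported (T : H →L[ℂ] H) (ψ : H) (f : C_c(ℝ, ℝ)) :
    ∫ s, f s ∂(boundedSpectralMeasure T ψ) = (⟪ψ, cfc (fun x => f x) T ψ⟫).re :=
  RealRMK.integral_rieszMeasure _ f

/-- The spectral measure gives no mass to an open interval that misses the spectrum: a tent
function on the interval vanishes on the spectrum, so its integral is zero. -/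
theorem boundedSpectralMeasure_Ioo {T : H →L[ℂ] H} (ψ : H) {a b : ℝ}
    (hab : ∀ x ∈ spectrum ℝ T, x ∉ Ioo a b) : boundedSpectralMeasure T ψ (Ioo a b) = 0 := by
  let g : ℝ → ℝ := fun x => max 0 (min (x - a) (b - x))
  have hgc : Continuous g := by fun_prop
  have hgs : HasCompactSupport g := by
    refine HasCompactSupport.intro (isCompact_Icc (a := a) (b := b)) fun x hx => ?_
    simp only [mem_Icc, not_and_or, not_le] at hx
    refine max_eq_left ?_
    rcases hx with hx | hx
    · exact (min_le_left _ _).trans (by linarith)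
    · exact (min_le_right _ _).trans (by linarith)
  let f : C_c(ℝ, ℝ) := ⟨⟨g, hgc⟩, hgs⟩
  have h1 := integral_boundedSpectralMeasure_compactlySupported T ψ f
  have h2 : cfc (fun x => f x) T = cfc (fun _ => (0 : ℝ)) T := by
    refine cfc_congr fun x hx => ?_
    have := hab x hx
    simp only [mem_Ioo, not_and_or, not_lt] at this
    refine max_eq_left ?_
    rcases this with hx | hx
    · exact (min_le_left _ _).trans (by linarith)
    · exact (min_le_right _ _).trans (by linarith)
  rw [h2] at h1
  simp only [cfc_const_zero, zero_apply, inner_zero_right, Complex.zero_re] at h1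
  have : IsFiniteMeasureOnCompacts (boundedSpectralMeasure T ψ) := by
    unfold boundedSpectralMeasure; infer_instance
  have h3 : Integrable g (boundedSpectralMeasure T ψ) := hgc.integrable_of_hasCompactSupport hgs
  have h4 := (integral_eq_zero_iff_of_nonneg (fun x => le_max_left _ _) h3).1 h1
  refine measure_mono_null ?_ h4
  intro x hx
  have : 0 < g x := lt_max_of_lt_right (lt_min (by linarith [hx.1]) (by linarith [hx.2]))
  exact this.ne'

theorem boundedSpectralMeasure_compl_Icc {T : H →L[ℂ] H} (h0 : 0 ≤ T) (h1 : T ≤ 1) (ψ : H) :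
    boundedSpectralMeasure T ψ (Icc 0 1)ᶜ = 0 := by
  have hs := spectrum_subset_Icc h0 h1
  have : (Icc (0 : ℝ) 1)ᶜ ⊆ ⋃ n : ℕ, (Ioo (-(n : ℝ)) 0 ∪ Ioo 1 (n : ℝ)) := by
    intro x hx
    obtain ⟨n, hn⟩ := exists_nat_gt |x|
    rw [abs_lt] at hn
    simp only [mem_compl_iff, mem_Icc, not_and_or, not_le] at hx
    refine mem_iUnion.2 ⟨n, ?_⟩
    rcases hx with hx | hx
    · exact Or.inl ⟨hn.1, hx⟩
    · exact Or.inr ⟨hx, hn.2⟩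
  refine measure_mono_null this (measure_iUnion_null fun n => measure_union_null ?_ ?_)
  · exact boundedSpectralMeasure_Ioo ψ fun x hx hx' => absurd (hs hx).1 (not_le.2 hx'.2)
  · exact boundedSpectralMeasure_Ioo ψ fun x hx hx' => absurd (hs hx).2 (not_le.2 hx'.1)

theorem boundedSpectralMeasure_mem_Icc {T : H →L[ℂ] H} (h0 : 0 ≤ T) (h1 : T ≤ 1) (ψ : H) :
    ∀ᵐ s ∂(boundedSpectralMeasure T ψ), s ∈ Icc (0 : ℝ) 1 :=
  boundedSpectralMeasure_compl_Icc h0 h1 ψ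

theorem isFiniteMeasure_boundedSpectralMeasure {T : H →L[ℂ] H} (h0 : 0 ≤ T) (h1 : T ≤ 1) (ψ : H) :
    IsFiniteMeasure (boundedSpectralMeasure T ψ) := by
  have : IsFiniteMeasureOnCompacts (boundedSpectralMeasure T ψ) := by
    unfold boundedSpectralMeasure; infer_instance
  constructor
  rw [← measure_add_measure_compl (measurableSet_Icc (a := (0 : ℝ)) (b := 1)),
    boundedSpectralMeasure_compl_Icc h0 h1, add_zero]
  exact isCompact_Icc.measure_lt_top

theorem integral_boundedSpectralMeasure_real {T : H →L[ℂ] H} (h0 : 0 ≤ T) (h1 : T ≤ 1) (ψ : H)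
    {f : ℝ → ℝ} (hf : ContinuousOn f (Icc 0 1)) :
    ∫ s, f s ∂(boundedSpectralMeasure T ψ) = (⟪ψ, cfc f T ψ⟫).re := by
  let e : ℝ → ℝ := IccExtend (zero_le_one' ℝ) ((Icc (0 : ℝ) 1).domRestrict f)
  have he : Continuous e := hf.domRestrict.Icc_extend'
  let g : ℝ → ℝ := fun x => e x * max 0 (min 1 (2 - |x|))
  have hgc : Continuous g := by fun_prop
  have hgs : HasCompactSupport g := by
    refine HasCompactSupport.intro (isCompact_Icc (a := -2) (b := 2)) fun x hx => ?_
    have : 2 < |x| := by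
      by_contra hc
      exact hx (abs_le.1 (not_lt.1 hc))
    have h3 : min 1 (2 - |x|) ≤ 0 := (min_le_right _ _).trans (by linarith)
    simp [g, max_eq_left h3]
  have hg : ∀ x ∈ Icc (0 : ℝ) 1, g x = f x := by
    intro x hx
    have h2 : |x| ≤ 1 := abs_le.2 ⟨by linarith [hx.1], hx.2⟩
    have h3 : min 1 (2 - |x|) = 1 := min_eq_left (by linarith)
    have h4 : e x = f x := by
      simp only [e]
      rw [IccExtend_of_mem _ _ hx]
      rfl
    simp [g, h3, h4]
  have h2 := integral_boundedSpectralMeasure_compactlySupported T ψ ⟨⟨g, hgc⟩, hgs⟩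
  have h3 : cfc g T = cfc f T := cfc_congr fun x hx => hg x (spectrum_subset_Icc h0 h1 hx)
  have h4 : ∫ s, f s ∂(boundedSpectralMeasure T ψ) = ∫ s, g s ∂(boundedSpectralMeasure T ψ) := by
    refine integral_congr_ae ?_
    filter_upwards [boundedSpectralMeasure_mem_Icc h0 h1 ψ] with s hs using (hg s hs).symm
  rw [h4, ← h3]
  exact h2

/-- A function that is continuous on `[0, 1]` is integrable for the spectral measure of an
operator `0 ≤ T ≤ 1`. -/
theorem integrable_boundedSpectralMeasure {E : Type*} [NormedAddCommGroup E]
    {T : H →L[ℂ] H} (h0 : 0 ≤ T) (h1 : T ≤ 1) (ψ : H)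
    {f : ℝ → E} (hf : ContinuousOn f (Icc 0 1)) : Integrable f (boundedSpectralMeasure T ψ) := by
  have : IsFiniteMeasureOnCompacts (boundedSpectralMeasure T ψ) := by
    unfold boundedSpectralMeasure; infer_instance
  have h2 : IntegrableOn f (Icc 0 1) (boundedSpectralMeasure T ψ) :=
    hf.integrableOn_compact isCompact_Icc
  rwa [IntegrableOn, Measure.restrict_eq_self_of_ae_mem (boundedSpectralMeasure_mem_Icc h0 h1 ψ)]
    at h2

/-- The continuous functional calculus `f(T)` of a self-adjoint operator for complex-valued
functions of a real variable. -/
noncomputable def ccfc (f : ℝ → ℂ) (T : H →L[ℂ] H) : H →L[ℂ] H := cfc (fun z : ℂ => f z.re) T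

theorem continuousOn_spectrum {T : H →L[ℂ] H} (h0 : 0 ≤ T) (h1 : T ≤ 1)
    {f : ℝ → ℂ} (hf : ContinuousOn f (Icc 0 1)) :
    ContinuousOn (fun z : ℂ => f z.re) (spectrum ℂ T) := by
  have hs : IsSelfAdjoint T := .of_nonneg h0
  refine hf.comp Complex.continuous_re.continuousOn fun z hz => ?_
  refine spectrum_subset_Icc h0 h1 ?_
  have h2 := hs.spectrumRestricts.image
  rw [← h2]
  exact ⟨z, hz, rfl⟩

variable {T : H →L[ℂ] H}

theorem ccfc_ofReal (h0 : 0 ≤ T) (f : ℝ → ℝ) : ccfc (fun s => (f s : ℂ)) T = cfc f T :=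
  (cfc_real_eq_complex f (.of_nonneg h0)).symm

theorem ccfc_mul (h0 : 0 ≤ T) (h1 : T ≤ 1) {f g : ℝ → ℂ} (hf : ContinuousOn f (Icc 0 1))
    (hg : ContinuousOn g (Icc 0 1)) : ccfc (fun s => f s * g s) T = ccfc f T * ccfc g T :=
  cfc_mul _ _ T (continuousOn_spectrum h0 h1 hf) (continuousOn_spectrum h0 h1 hg)

theorem ccfc_add (h0 : 0 ≤ T) (h1 : T ≤ 1) {f g : ℝ → ℂ} (hf : ContinuousOn f (Icc 0 1))
    (hg : ContinuousOn g (Icc 0 1)) : ccfc (fun s => f s + g s) T = ccfc f T + ccfc g T :=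
  cfc_add (a := T) _ _ (continuousOn_spectrum h0 h1 hf) (continuousOn_spectrum h0 h1 hg)

theorem ccfc_sub (h0 : 0 ≤ T) (h1 : T ≤ 1) {f g : ℝ → ℂ} (hf : ContinuousOn f (Icc 0 1))
    (hg : ContinuousOn g (Icc 0 1)) : ccfc (fun s => f s - g s) T = ccfc f T - ccfc g T :=
  cfc_sub (a := T) _ _ (continuousOn_spectrum h0 h1 hf) (continuousOn_spectrum h0 h1 hg)

theorem ccfc_smul (h0 : 0 ≤ T) (h1 : T ≤ 1) (c : ℂ) {f : ℝ → ℂ} (hf : ContinuousOn f (Icc 0 1)) :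
    ccfc (fun s => c * f s) T = c • ccfc f T :=
  cfc_const_mul (a := T) _ _ (continuousOn_spectrum h0 h1 hf)

theorem ccfc_star (f : ℝ → ℂ) : ccfc (fun s => conj (f s)) T = star (ccfc f T) :=
  cfc_star (a := T) _

theorem ccfc_one (h0 : 0 ≤ T) : ccfc (fun _ => 1) T = 1 := by
  have hs : IsSelfAdjoint T := .of_nonneg h0
  exact cfc_const_one ℂ T hs.isStarNormal

theorem ccfc_id (h0 : 0 ≤ T) : ccfc (fun s => (s : ℂ)) T = T := by
  have hs : IsSelfAdjoint T := .of_nonneg h0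
  rw [ccfc_ofReal h0 (fun s => s), cfc_id' ℝ T]

theorem ccfc_congr (h0 : 0 ≤ T) (h1 : T ≤ 1) {f g : ℝ → ℂ} (h : EqOn f g (Icc 0 1)) :
    ccfc f T = ccfc g T := by
  have hs : IsSelfAdjoint T := .of_nonneg h0
  refine cfc_congr fun z hz => h (spectrum_subset_Icc h0 h1 ?_)
  have h2 := hs.spectrumRestricts.image
  rw [← h2]
  exact ⟨z, hz, rfl⟩

theorem inner_cfc_im (T : H →L[ℂ] H) (f : ℝ → ℝ) (ψ : H) :
    (⟪ψ, cfc f T ψ⟫).im = 0 := by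
  have h2 : IsSelfAdjoint (cfc f T) := cfc_predicate _ T
  have h3 : conj ⟪ψ, cfc f T ψ⟫ = ⟪ψ, cfc f T ψ⟫ := by
    rw [inner_conj_symm, ← ContinuousLinearMap.adjoint_inner_right,
      ← ContinuousLinearMap.star_eq_adjoint, h2.star_eq]
  exact Complex.conj_eq_iff_im.1 h3

theorem inner_ccfc (h0 : 0 ≤ T) (h1 : T ≤ 1) {f : ℝ → ℂ} (hf : ContinuousOn f (Icc 0 1)) (ψ : H) :
    ⟪ψ, ccfc f T ψ⟫ = ∫ s, f s ∂(boundedSpectralMeasure T ψ) := by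
  have hre : ContinuousOn (fun s => (f s).re) (Icc 0 1) := Complex.continuous_re.comp_continuousOn hf
  have him : ContinuousOn (fun s => (f s).im) (Icc 0 1) := Complex.continuous_im.comp_continuousOn hf
  have hd : f = fun s => ((f s).re : ℂ) + Complex.I * ((f s).im : ℂ) := by
    funext s
    rw [mul_comm, Complex.re_add_im]
  have hor : ∀ {g : ℝ → ℝ}, ContinuousOn g (Icc 0 1) → ContinuousOn (fun s => (g s : ℂ)) (Icc 0 1) :=
    fun hg => Complex.continuous_ofReal.comp_continuousOn hg
  have hfi := integrable_boundedSpectralMeasure h0 h1 ψ hf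
  have h2 : ∀ {g : ℝ → ℝ}, ContinuousOn g (Icc 0 1) →
      ⟪ψ, cfc g T ψ⟫ = ((∫ s, g s ∂(boundedSpectralMeasure T ψ) : ℝ) : ℂ) := fun {g} hg => by
    rw [integral_boundedSpectralMeasure_real h0 h1 ψ hg]
    apply Complex.ext
    · simp
    · simp [inner_cfc_im T]
  conv_lhs => rw [hd]
  rw [ccfc_add (f := fun s => ((f s).re : ℂ)) (g := fun s => Complex.I * ((f s).im : ℂ)) h0 h1
    (hor hre) (continuousOn_const.mul (hor him)), ccfc_smul h0 h1 _ (hor him),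
    ccfc_ofReal h0, ccfc_ofReal h0]
  simp only [add_apply, smul_apply, inner_add_right, inner_smul_right]
  rw [h2 hre, h2 him, mul_comm]
  exact integral_re_add_im hfi

theorem inner_ccfc_ccfc (h0 : 0 ≤ T) (h1 : T ≤ 1) {f g : ℝ → ℂ} (hf : ContinuousOn f (Icc 0 1))
    (hg : ContinuousOn g (Icc 0 1)) (ψ : H) :
    ⟪ccfc f T ψ, ccfc g T ψ⟫ = ∫ s, conj (f s) * g s ∂(boundedSpectralMeasure T ψ) := by
  rw [← inner_ccfc (f := fun s => conj (f s) * g s) h0 h1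
      ((Complex.continuous_conj.comp_continuousOn hf).mul hg),
    ccfc_mul (f := fun s => conj (f s)) h0 h1 (Complex.continuous_conj.comp_continuousOn hf) hg, ccfc_star,
    ContinuousLinearMap.star_eq_adjoint, mul_apply_eq_comp,
    ContinuousLinearMap.adjoint_inner_right]

theorem norm_ccfc_sq (h0 : 0 ≤ T) (h1 : T ≤ 1) {f : ℝ → ℂ} (hf : ContinuousOn f (Icc 0 1)) (ψ : H) :
    ‖ccfc f T ψ‖ ^ 2 = ∫ s, ‖f s‖ ^ 2 ∂(boundedSpectralMeasure T ψ) := by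
  have h2 := inner_ccfc_ccfc h0 h1 hf hf ψ
  rw [inner_self_eq_norm_sq_to_K] at h2
  have h3 : ∀ s, conj (f s) * f s = ((‖f s‖ ^ 2 : ℝ) : ℂ) := fun s => by
    rw [Complex.conj_mul']; simp
  simp only [h3] at h2
  rw [integral_complex_ofReal] at h2
  exact Complex.ofReal_injective (by simpa using h2)

/-- If uniformly bounded continuous functions converge almost everywhere for the spectral measure
at `ψ`, then the vectors `fₙ(T) ψ` converge. -/
theorem exists_tendsto_ccfc (h0 : 0 ≤ T) (h1 : T ≤ 1) {f : ℕ → ℝ → ℂ} {g : ℝ → ℂ} {C : ℝ}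
    (hf : ∀ n, ContinuousOn (f n) (Icc 0 1)) (hC : ∀ n s, ‖f n s‖ ≤ C) (ψ : H)
    (hg : ∀ᵐ s ∂(boundedSpectralMeasure T ψ), Tendsto (fun n => f n s) atTop (𝓝 (g s))) :
    ∃ v, Tendsto (fun n => ccfc (f n) T ψ) atTop (𝓝 v) := by
  have := isFiniteMeasure_boundedSpectralMeasure h0 h1 ψ
  apply cauchySeq_tendsto_of_complete
  rw [cauchySeq_iff_tendsto_dist_atTop_0]
  have h2 : ∀ n : ℕ × ℕ, dist (ccfc (f n.1) T ψ) (ccfc (f n.2) T ψ)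
      = √(∫ s, ‖f n.1 s - f n.2 s‖ ^ 2 ∂(boundedSpectralMeasure T ψ)) := fun n => by
    rw [← norm_ccfc_sq (f := fun s => f n.1 s - f n.2 s) h0 h1 ((hf _).sub (hf _)), Real.sqrt_sq (norm_nonneg _),
      ccfc_sub h0 h1 (hf _) (hf _), dist_eq_norm]
    rfl
  simp only [h2]
  rw [← Real.sqrt_zero]
  refine (Real.continuous_sqrt.tendsto _).comp ?_
  rw [← integral_zero ℝ ℝ (μ := boundedSpectralMeasure T ψ)]
  refine tendsto_integral_filter_of_dominated_convergence (fun _ => (C + C) ^ 2) ?_ ?_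
    (integrable_const _) ?_
  · exact Eventually.of_forall fun n => (integrable_boundedSpectralMeasure h0 h1 ψ
      (((hf _).sub (hf _)).norm.pow 2)).aestronglyMeasurable
  · refine Eventually.of_forall fun n => Eventually.of_forall fun s => ?_
    rw [Real.norm_of_nonneg (by positivity)]
    gcongr
    exact (norm_sub_le _ _).trans (add_le_add (hC _ _) (hC _ _))
  · filter_upwards [hg] with s hs
    have h3 : Tendsto (fun n : ℕ × ℕ => f n.1 s - f n.2 s) atTop (𝓝 (g s - g s)) := by
      rw [← prod_atTop_atTop_eq]
      exact (hs.comp tendsto_fst).sub (hs.comp tendsto_snd)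
    simpa using (h3.norm.pow 2)

end SpectralMeasure

/-! ### Functions of the logarithm of a positive operator -/

section LogCalculus

/-- Two bounded operators on a complex Hilbert space with the same quadratic form agree. -/
theorem eq_of_forall_inner {H : Type*} [NormedAddCommGroup H] [InnerProductSpace ℂ H]
    {A B : H →L[ℂ] H} (h : ∀ ψ, ⟪ψ, A ψ⟫ = ⟪ψ, B ψ⟫) : A = B := by
  have h2 : (A : H →ₗ[ℂ] H) = (B : H →ₗ[ℂ] H) := by
    rw [← ext_inner_map]
    intro ψ
    rw [← inner_conj_symm, ← inner_conj_symm (B.toLinearMap ψ)]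
    exact congrArg conj (h ψ)
  ext ψ
  exact DFunLike.congr_fun h2 ψ

variable {H : Type u} [NormedAddCommGroup H] [InnerProductSpace ℂ H] [CompleteSpace H]

/-- A point that is not an eigenvalue of `T` has measure zero for all spectral measures. -/
theorem boundedSpectralMeasure_singleton {T : H →L[ℂ] H} (h0 : 0 ≤ T) (h1 : T ≤ 1) {a : ℝ}
    (ha : ∀ v, T v = (a : ℂ) • v → v = 0) (ψ : H) : boundedSpectralMeasure T ψ {a} = 0 := by
  have := isFiniteMeasure_boundedSpectralMeasure h0 h1 ψ
  let f : ℕ → ℝ → ℝ := fun n s => max 0 (1 - n * |s - a|)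
  have hfc : ∀ n, Continuous (f n) := fun n => by fun_prop
  have hf0 : ∀ n s, 0 ≤ f n s := fun n s => le_max_left _ _
  have hf1 : ∀ n s, f n s ≤ 1 := fun n s =>
    max_le zero_le_one (by have : 0 ≤ (n : ℝ) * |s - a| := by positivity
                           linarith)
  have hfa : ∀ n, f n a = 1 := fun n => by simp [f]
  have hfl : ∀ s, Tendsto (fun n => f n s) atTop (𝓝 (({a} : Set ℝ).indicator 1 s)) := by
    intro s
    by_cases hs : s = a
    · subst hs
      simp [hfa]
    · rw [indicator_of_notMem (by simpa using hs)]
      have h3 : 0 < |s - a| := abs_pos.2 (sub_ne_zero.2 hs)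
      have h4 : Tendsto (fun n : ℕ => (n : ℝ) * |s - a|) atTop atTop :=
        tendsto_natCast_atTop_atTop.atTop_mul_const h3
      refine tendsto_const_nhds.congr' ?_
      filter_upwards [h4.eventually_ge_atTop 1] with n hn
      exact (max_eq_left (by linarith)).symm
  have hcc : ∀ n, ContinuousOn (fun s => (f n s : ℂ)) (Icc 0 1) := fun n =>
    (Complex.continuous_ofReal.comp (hfc n)).continuousOn
  obtain ⟨v, hv⟩ := exists_tendsto_ccfc (f := fun n s => (f n s : ℂ))
    (g := fun s => ((({a} : Set ℝ).indicator 1 s : ℝ) : ℂ)) (C := 1) h0 h1 hcc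
    (fun n s => by
      rw [Complex.norm_real, Real.norm_of_nonneg (hf0 n s)]
      exact hf1 n s) ψ
    (Eventually.of_forall fun s => (Complex.continuous_ofReal.tendsto _).comp (hfl s))
  have hv0 : v = 0 := by
    apply ha
    have h3 : Tendsto (fun n => T (ccfc (fun s => (f n s : ℂ)) T ψ)
        - (a : ℂ) • ccfc (fun s => (f n s : ℂ)) T ψ) atTop (𝓝 (T v - (a : ℂ) • v)) :=
      ((T.continuous.tendsto _).comp hv).sub (hv.const_smul _)
    have h4 : ∀ n, T (ccfc (fun s => (f n s : ℂ)) T ψ) - (a : ℂ) • ccfc (fun s => (f n s : ℂ)) T ψ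
        = ccfc (fun s => (((s - a) * f n s : ℝ) : ℂ)) T ψ := fun n => by
      have e1 : (fun s => (((s - a) * f n s : ℝ) : ℂ))
          = fun s : ℝ => (s : ℂ) * (f n s : ℂ) - (a : ℂ) * (f n s : ℂ) := by
        funext s
        push_cast
        ring
      have hid : ContinuousOn (fun s : ℝ => (s : ℂ)) (Icc 0 1) :=
        Complex.continuous_ofReal.continuousOn
      rw [e1, ccfc_sub h0 h1 (f := fun s : ℝ => (s : ℂ) * (f n s : ℂ))
        (g := fun s => (a : ℂ) * (f n s : ℂ)) (hid.mul (hcc n)) (continuousOn_const.mul (hcc n)),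
        ccfc_mul h0 h1 hid (hcc n), ccfc_smul h0 h1 _ (hcc n), ccfc_id h0]
      rfl
    simp only [h4] at h3
    have h5 : Tendsto (fun n => ccfc (fun s => (((s - a) * f n s : ℝ) : ℂ)) T ψ) atTop (𝓝 0) := by
      rw [tendsto_zero_iff_norm_tendsto_zero]
      have h6 : ∀ n, ‖ccfc (fun s => (((s - a) * f n s : ℝ) : ℂ)) T ψ‖
          = √(∫ s, ‖(((s - a) * f n s : ℝ) : ℂ)‖ ^ 2 ∂(boundedSpectralMeasure T ψ)) := fun n => by
        rw [← norm_ccfc_sq (f := fun s => (((s - a) * f n s : ℝ) : ℂ)) h0 h1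
          (Complex.continuous_ofReal.comp (by fun_prop)).continuousOn, Real.sqrt_sq (norm_nonneg _)]
      simp only [h6]
      rw [← Real.sqrt_zero]
      refine (Real.continuous_sqrt.tendsto _).comp ?_
      rw [← integral_zero ℝ ℝ (μ := boundedSpectralMeasure T ψ)]
      refine tendsto_integral_of_dominated_convergence (fun s => ‖s - a‖ ^ 2) (fun n => ?_) ?_
        (fun n => Eventually.of_forall fun s => ?_) (Eventually.of_forall fun s => ?_)
      · exact Continuous.aestronglyMeasurable
          (((Complex.continuous_ofReal.comp (by fun_prop)).norm).pow 2)
      · exact integrable_boundedSpectralMeasure h0 h1 ψ (by fun_prop)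
      · rw [Real.norm_of_nonneg (by positivity), Complex.norm_real, norm_mul,
          Real.norm_of_nonneg (hf0 n s)]
        have := mul_le_mul_of_nonneg_left (hf1 n s) (norm_nonneg (s - a))
        rw [mul_one] at this
        exact pow_le_pow_left₀ (mul_nonneg (norm_nonneg _) (hf0 n s)) this 2
      · have h7 : Tendsto (fun n => (s - a) * f n s) atTop
            (𝓝 ((s - a) * (({a} : Set ℝ).indicator 1 s))) := (hfl s).const_mul _
        have h8 : (s - a) * (({a} : Set ℝ).indicator 1 s) = 0 := by
          by_cases hs : s = a
          · simp [hs]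
          · rw [indicator_of_notMem (by simpa using hs), mul_zero]
        rw [h8] at h7
        have h9 := ((Complex.continuous_ofReal.tendsto _).comp h7).norm.pow 2
        simpa using h9
    exact sub_eq_zero.1 (tendsto_nhds_unique h3 h5)
  have hn : Tendsto (fun n => ‖ccfc (fun s => (f n s : ℂ)) T ψ‖ ^ 2) atTop (𝓝 0) := by
    have := hv.norm.pow 2
    simpa [hv0] using this
  have hle : ∀ n, (boundedSpectralMeasure T ψ).real {a} ≤ ‖ccfc (fun s => (f n s : ℂ)) T ψ‖ ^ 2 := by
    intro n
    rw [norm_ccfc_sq (f := fun s => (f n s : ℂ)) h0 h1 (hcc n),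
      ← integral_indicator_one (measurableSet_singleton a)]
    refine integral_mono ((integrable_const (1 : ℝ)).indicator (measurableSet_singleton a))
      (integrable_boundedSpectralMeasure h0 h1 ψ ((hcc n).norm.pow 2)) fun s => ?_
    by_cases hs : s = a
    · subst hs
      simp [hfa]
    · simp only [indicator_of_notMem (show s ∉ ({a} : Set ℝ) by simpa using hs)]
      positivity
  have h := ge_of_tendsto' hn hle
  exact (measureReal_eq_zero_iff).1 (le_antisymm h measureReal_nonneg)

/-- `T` is of the form `(1 + A)⁻¹` for a positive self-adjoint operator `A` with trivial kernel. -/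
structure IsInjectiveResolvent (T : H →L[ℂ] H) : Prop where
  nonneg : 0 ≤ T
  le_one : T ≤ 1
  eq_zero_of_apply : ∀ v, T v = 0 → v = 0
  eq_zero_of_apply_eq : ∀ v, T v = v → v = 0

/-- If `T = (1 + A)⁻¹` then `logCoord(T) = log A`. -/
noncomputable def logCoord (s : ℝ) : ℝ := Real.log (s⁻¹ - 1)

theorem measurable_logCoord : Measurable logCoord := by
  unfold logCoord
  fun_prop

theorem exp_logCoord {s : ℝ} (hs : s ∈ Ioo (0 : ℝ) 1) : Real.exp (logCoord s) = s⁻¹ - 1 := by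
  refine Real.exp_log ?_
  have := (one_lt_inv₀ hs.1).2 hs.2
  linarith

/-- For `T = (1 + A)⁻¹`, the spectral measure of `log A` at `ψ`. -/
noncomputable def logMeasure (T : H →L[ℂ] H) (ψ : H) : Measure ℝ :=
  (boundedSpectralMeasure T ψ).map logCoord

variable {T : H →L[ℂ] H}

theorem IsInjectiveResolvent.mem_Ioo (hT : IsInjectiveResolvent T) (ψ : H) :
    ∀ᵐ s ∂(boundedSpectralMeasure T ψ), s ∈ Ioo (0 : ℝ) 1 := by
  have h2 : ∀ᵐ s ∂(boundedSpectralMeasure T ψ), s ∉ ({0} : Set ℝ) :=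
    measure_eq_zero_iff_ae_notMem.1 (boundedSpectralMeasure_singleton hT.nonneg hT.le_one
      (fun v hv => hT.eq_zero_of_apply v (by simpa using hv)) ψ)
  have h3 : ∀ᵐ s ∂(boundedSpectralMeasure T ψ), s ∉ ({1} : Set ℝ) :=
    measure_eq_zero_iff_ae_notMem.1 (boundedSpectralMeasure_singleton hT.nonneg hT.le_one
      (fun v hv => hT.eq_zero_of_apply_eq v (by simpa using hv)) ψ)
  filter_upwards [boundedSpectralMeasure_mem_Icc hT.nonneg hT.le_one ψ, h2, h3] with s h4 h5 h6
  exact ⟨lt_of_le_of_ne h4.1 (Ne.symm h5), lt_of_le_of_ne h4.2 h6⟩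

theorem IsInjectiveResolvent.isFiniteMeasure (hT : IsInjectiveResolvent T) (ψ : H) :
    IsFiniteMeasure (logMeasure T ψ) := by
  have := isFiniteMeasure_boundedSpectralMeasure hT.nonneg hT.le_one ψ
  unfold logMeasure
  infer_instance

/-- Cutoff functions that vanish outside `(0, 1)` and tend to `1` on `(0, 1)`. -/
noncomputable def cutoff (n : ℕ) (s : ℝ) : ℝ := min 1 (n * max 0 (s * (1 - s)))

theorem continuous_cutoff (n : ℕ) : Continuous (cutoff n) := by
  unfold cutoff
  fun_prop

theorem cutoff_nonneg (n : ℕ) (s : ℝ) : 0 ≤ cutoff n s := le_min zero_le_one (by positivity)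

theorem cutoff_le_one (n : ℕ) (s : ℝ) : cutoff n s ≤ 1 := min_le_left _ _

theorem cutoff_of_notMem {n : ℕ} {s : ℝ} (hs : s ∉ Ioo (0 : ℝ) 1) : cutoff n s = 0 := by
  have h : s * (1 - s) ≤ 0 := by
    simp only [mem_Ioo, not_and_or, not_lt] at hs
    rcases hs with hs | hs <;> nlinarith
  simp [cutoff, max_eq_left h]

theorem tendsto_cutoff {s : ℝ} (hs : s ∈ Ioo (0 : ℝ) 1) :
    Tendsto (fun n => cutoff n s) atTop (𝓝 1) := by
  have h2 : 0 < max 0 (s * (1 - s)) :=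
    lt_max_of_lt_right (mul_pos hs.1 (sub_pos.2 hs.2))
  refine tendsto_const_nhds.congr' ?_
  filter_upwards [(tendsto_natCast_atTop_atTop.atTop_mul_const h2).eventually_ge_atTop 1] with n hn
  exact (min_eq_left hn).symm

theorem continuousOn_logCoord : ContinuousOn logCoord (Ioo 0 1) := by
  refine ContinuousOn.log ((continuousOn_inv₀.mono fun s hs => hs.1.ne').sub continuousOn_const) ?_
  intro s hs
  have := (one_lt_inv₀ hs.1).2 hs.2
  linarith

theorem continuous_mul_cutoff (G : ℝ →ᵇ ℂ) (n : ℕ) :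
    Continuous fun s => G (logCoord s) * (cutoff n s : ℂ) := by
  rw [continuous_iff_continuousAt]
  intro s
  by_cases hs : s ∈ Ioo (0 : ℝ) 1
  · have h1 : ContinuousAt logCoord s := continuousOn_logCoord.continuousAt (isOpen_Ioo.mem_nhds hs)
    exact (G.continuous.continuousAt.comp h1).mul
      (Complex.continuous_ofReal.comp (continuous_cutoff n)).continuousAt
  · have h2 : Tendsto (fun s => ((cutoff n s : ℝ) : ℂ)) (𝓝 s) (𝓝 0) := by
      have := (Complex.continuous_ofReal.comp (continuous_cutoff n)).tendsto s
      simpa [Function.comp_def, cutoff_of_notMem hs] using this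
    have h3 : Tendsto (fun s => G (logCoord s) * (cutoff n s : ℂ)) (𝓝 s) (𝓝 0) := by
      refine squeeze_zero_norm (a := fun s => ‖G‖ * ‖(cutoff n s : ℂ)‖) (fun x => ?_)
        (by simpa using h2.norm.const_mul ‖G‖)
      rw [norm_mul]
      exact mul_le_mul_of_nonneg_right (G.norm_coe_le_norm _) (norm_nonneg _)
    simpa [ContinuousAt, cutoff_of_notMem hs] using h3

theorem norm_mul_cutoff_le (G : ℝ →ᵇ ℂ) (n : ℕ) (s : ℝ) :
    ‖G (logCoord s) * (cutoff n s : ℂ)‖ ≤ ‖G‖ := by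
  rw [norm_mul, Complex.norm_real, Real.norm_of_nonneg (cutoff_nonneg n s)]
  exact (mul_le_of_le_one_right (norm_nonneg _) (cutoff_le_one n s)).trans (G.norm_coe_le_norm _)

theorem tendsto_mul_cutoff (G : ℝ →ᵇ ℂ) {s : ℝ} (hs : s ∈ Ioo (0 : ℝ) 1) :
    Tendsto (fun n => G (logCoord s) * (cutoff n s : ℂ)) atTop (𝓝 (G (logCoord s))) := by
  have := ((Complex.continuous_ofReal.tendsto _).comp (tendsto_cutoff hs)).const_mul (G (logCoord s))
  simpa using this

/-- The operator `G(log A)`, for a bounded continuous function `G`: it has the quadratic form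
`ψ ↦ ∫ G dμ_ψ`, and the spectral measure at `G(log A) ψ` is `|G|²` times that at `ψ`. It is
obtained as a strong limit of the continuous functional calculus of `T`, because `G ∘ logCoord`
need not extend continuously to the end points of `[0, 1]`. -/
theorem IsInjectiveResolvent.exists_operator (hT : IsInjectiveResolvent T) (G : ℝ →ᵇ ℂ) :
    ∃ B : H →L[ℂ] H, (∀ ψ, ⟪ψ, B ψ⟫ = ∫ k, G k ∂(logMeasure T ψ)) ∧
      ∀ ψ, logMeasure T (B ψ)
        = (logMeasure T ψ).withDensity (fun k => ENNReal.ofReal (‖G k‖ ^ 2)) := by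
  have h0 := hT.nonneg
  have h1 := hT.le_one
  let f : ℕ → ℝ → ℂ := fun n s => G (logCoord s) * (cutoff n s : ℂ)
  have hfc : ∀ n, ContinuousOn (f n) (Icc 0 1) := fun n => (continuous_mul_cutoff G n).continuousOn
  have hlim : ∀ ψ, ∀ᵐ s ∂(boundedSpectralMeasure T ψ),
      Tendsto (fun n => f n s) atTop (𝓝 (G (logCoord s))) := fun ψ => by
    filter_upwards [hT.mem_Ioo ψ] with s hs using tendsto_mul_cutoff G hs
  have hex : ∀ ψ, ∃ v, Tendsto (fun n => ccfc (f n) T ψ) atTop (𝓝 v) := fun ψ =>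
    exists_tendsto_ccfc h0 h1 hfc (norm_mul_cutoff_le G) ψ (hlim ψ)
  choose B hB using hex
  let B' : H →L[ℂ] H := continuousLinearMapOfTendsto (fun n => ccfc (f n) T) (tendsto_pi_nhds.2 hB)
  have hB' : ∀ ψ, Tendsto (fun n => ccfc (f n) T ψ) atTop (𝓝 (B' ψ)) := hB
  have hGm : Measurable fun s => G (logCoord s) := G.continuous.measurable.comp measurable_logCoord
  refine ⟨B', fun ψ => ?_, fun ψ => ?_⟩
  · have := isFiniteMeasure_boundedSpectralMeasure h0 h1 ψ
    have h2 : Tendsto (fun n => ⟪ψ, ccfc (f n) T ψ⟫) atTop (𝓝 ⟪ψ, B' ψ⟫) :=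
      ((continuous_const.inner continuous_id).tendsto _).comp (hB' ψ)
    simp only [inner_ccfc h0 h1 (hfc _)] at h2
    have h3 : Tendsto (fun n => ∫ s, f n s ∂(boundedSpectralMeasure T ψ)) atTop
        (𝓝 (∫ s, G (logCoord s) ∂(boundedSpectralMeasure T ψ))) :=
      tendsto_integral_of_dominated_convergence (fun _ => ‖G‖)
        (fun n => (integrable_boundedSpectralMeasure h0 h1 ψ (hfc n)).aestronglyMeasurable)
        (integrable_const _) (fun n => Eventually.of_forall (norm_mul_cutoff_le G n)) (hlim ψ)
    rw [tendsto_nhds_unique h2 h3, logMeasure, integral_map measurable_logCoord.aemeasurable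
      G.continuous.aestronglyMeasurable]
  · have := isFiniteMeasure_boundedSpectralMeasure h0 h1 ψ
    have := isFiniteMeasure_boundedSpectralMeasure h0 h1 (B' ψ)
    have hd : Measurable fun s => ENNReal.ofReal (‖G (logCoord s)‖ ^ 2) :=
      (hGm.norm.pow_const 2).ennreal_ofReal
    have hbound : ∀ k, ‖G k‖ ^ 2 ≤ ‖G‖ ^ 2 := fun k =>
      pow_le_pow_left₀ (norm_nonneg _) (G.norm_coe_le_norm k) 2
    have hfin : IsFiniteMeasure ((boundedSpectralMeasure T ψ).withDensity
        (fun s => ENNReal.ofReal (‖G (logCoord s)‖ ^ 2))) := by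
      refine isFiniteMeasure_withDensity (ne_of_lt ?_)
      calc ∫⁻ s, ENNReal.ofReal (‖G (logCoord s)‖ ^ 2) ∂(boundedSpectralMeasure T ψ)
          ≤ ∫⁻ s, ENNReal.ofReal (‖G‖ ^ 2) ∂(boundedSpectralMeasure T ψ) :=
            lintegral_mono fun s => ENNReal.ofReal_le_ofReal (hbound _)
        _ < ⊤ := by
          rw [lintegral_const]
          exact ENNReal.mul_lt_top ENNReal.ofReal_lt_top (measure_lt_top _ _)
    have key : boundedSpectralMeasure T (B' ψ) = (boundedSpectralMeasure T ψ).withDensity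
        (fun s => ENNReal.ofReal (‖G (logCoord s)‖ ^ 2)) := by
      refine ext_of_forall_integral_eq_of_IsFiniteMeasure fun g => ?_
      let gc : ℝ → ℂ := fun s => (g s : ℂ)
      have hgc : ContinuousOn gc (Icc 0 1) :=
        (Complex.continuous_ofReal.comp g.continuous).continuousOn
      have h2 : Tendsto (fun n => ⟪ccfc (f n) T ψ, ccfc gc T (ccfc (f n) T ψ)⟫) atTop
          (𝓝 ⟪B' ψ, ccfc gc T (B' ψ)⟫) :=
        (hB' ψ).inner (((ccfc gc T).continuous.tendsto _).comp (hB' ψ))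
      have h3 : ∀ n, ⟪ccfc (f n) T ψ, ccfc gc T (ccfc (f n) T ψ)⟫
          = ((∫ s, g s * ‖f n s‖ ^ 2 ∂(boundedSpectralMeasure T ψ) : ℝ) : ℂ) := fun n => by
        have e1 : ccfc gc T (ccfc (f n) T ψ) = ccfc (fun s => gc s * f n s) T ψ := by
          rw [ccfc_mul h0 h1 hgc (hfc n)]
          rfl
        rw [e1, inner_ccfc_ccfc (g := fun s => gc s * f n s) h0 h1 (hfc n) (hgc.mul (hfc n)),
          ← integral_complex_ofReal]
        congr 1
        funext s
        simp only [gc]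
        rw [mul_left_comm, Complex.conj_mul']
        push_cast
        rfl
      simp only [h3] at h2
      rw [inner_ccfc h0 h1 hgc] at h2
      have h4 : Tendsto (fun n => ∫ s, g s * ‖f n s‖ ^ 2 ∂(boundedSpectralMeasure T ψ)) atTop
          (𝓝 (∫ s, g s * ‖G (logCoord s)‖ ^ 2 ∂(boundedSpectralMeasure T ψ))) := by
        refine tendsto_integral_of_dominated_convergence (fun _ => ‖g‖ * ‖G‖ ^ 2)
          (fun n => ?_) (integrable_const _) (fun n => Eventually.of_forall fun s => ?_) ?_
        · exact (g.continuous.mul ((continuous_mul_cutoff G n).norm.pow 2)).aestronglyMeasurable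
        · rw [norm_mul, norm_pow, norm_norm]
          exact mul_le_mul (g.norm_coe_le_norm s)
            (pow_le_pow_left₀ (norm_nonneg _) (norm_mul_cutoff_le G n s) 2) (by positivity)
            (norm_nonneg _)
        · filter_upwards [hlim ψ] with s hs using (hs.norm.pow 2).const_mul _
      have h5 := tendsto_nhds_unique h2 ((Complex.continuous_ofReal.tendsto _).comp h4)
      have h6 : ∫ s, gc s ∂(boundedSpectralMeasure T (B' ψ))
          = ((∫ s, g s ∂(boundedSpectralMeasure T (B' ψ)) : ℝ) : ℂ) := integral_complex_ofReal
      rw [h6] at h5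
      rw [Complex.ofReal_injective h5, integral_withDensity_eq_integral_toReal_smul hd
        (Eventually.of_forall fun s => ENNReal.ofReal_lt_top)]
      congr 1
      funext s
      rw [ENNReal.toReal_ofReal (by positivity), smul_eq_mul, mul_comm]
    ext b hb
    have hd' : Measurable fun k => ENNReal.ofReal (‖G k‖ ^ 2) :=
      (G.continuous.measurable.norm.pow_const 2).ennreal_ofReal
    rw [logMeasure, logMeasure, Measure.map_apply measurable_logCoord hb, key,
      withDensity_apply _ hb, withDensity_apply _ (measurable_logCoord hb),
      setLIntegral_map hb hd' measurable_logCoord]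

end LogCalculus

/-! ### Closability of the Tomita operator -/

section TomitaOperator

variable {H : Type u} [NormedAddCommGroup H] [InnerProductSpace ℂ H] [CompleteSpace H]

/-- A separating vector of `M` is cyclic for the commutant. -/
theorem eq_zero_of_orthogonal_commutant {M : VonNeumannAlgebra H} {Ω : H}
    (h : IsCyclicSeparating M Ω) {y : H} (hy : ∀ b ∈ M.commutant, ⟪b Ω, y⟫ = 0) : y = 0 := by
  -- `L` is the orthogonal complement of `M' Ω`; its projection belongs to `M` and annihilates `Ω`
  let L : Submodule ℂ H :=
    { carrier := {x | ∀ b ∈ M.commutant, ⟪b Ω, x⟫ = 0}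
      add_mem' := fun hx hx' b hb => by rw [inner_add_right, hx b hb, hx' b hb, add_zero]
      zero_mem' := fun b _ => inner_zero_right _
      smul_mem' := fun c x hx b hb => by rw [inner_smul_right, hx b hb, mul_zero] }
  have hL : IsClosed (L : Set H) := by
    have : (L : Set H) = ⋂ b ∈ M.commutant, {x | ⟪b Ω, x⟫ = 0} := by
      ext x
      simp [L]
    rw [this]
    exact isClosed_biInter fun b _ => isClosed_eq (by fun_prop) continuous_const
  have : CompleteSpace L := hL.completeSpace_coe
  have hP : L.starProjection ∈ M := by
    rw [VonNeumannAlgebra.IsStarProjection.mem_iff isStarProjection_starProjection]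
    intro b hb x hx
    have hx' : x ∈ L := by simpa using hx
    have : b x ∈ L := fun a ha => by
      have h2 := hx' (star b * a) (mul_mem (star_mem hb) ha)
      rwa [ContinuousLinearMap.star_eq_adjoint, mul_apply_eq_comp,
        ContinuousLinearMap.adjoint_inner_left] at h2
    simpa using this
  have hΩ : L.starProjection Ω = 0 := by
    rw [Submodule.starProjection_apply_eq_zero_iff, Submodule.mem_orthogonal']
    intro x hx
    simpa using hx 1 (one_mem _)
  have h0 := h.2 _ hP hΩ
  have h1 : L.starProjection y = y := Submodule.starProjection_eq_self_iff.2 hy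
  rw [← h1, h0, zero_apply]

theorem tomitaGraph_swap {M : VonNeumannAlgebra H} {Ω : H} {p : H × H}
    (hp : p ∈ tomitaGraph M Ω) : p.swap ∈ tomitaGraph M Ω := by
  refine map_mem_closure continuous_swap hp ?_
  rintro _ ⟨a, ha, rfl⟩
  exact ⟨star a, star_mem ha, by simp⟩

theorem tomitaGraph_sub {M : VonNeumannAlgebra H} {Ω : H} {p q : H × H}
    (hp : p ∈ tomitaGraph M Ω) (hq : q ∈ tomitaGraph M Ω) : p - q ∈ tomitaGraph M Ω := by
  have := tomitaGraph_add hp (tomitaGraph_smul (-1) hq)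
  convert this using 1
  ext <;> simp [sub_eq_add_neg]

theorem tomitaGraph_mono {M N : VonNeumannAlgebra H} (h : N ≤ M) (Ω : H) :
    tomitaGraph N Ω ⊆ tomitaGraph M Ω := by
  refine closure_mono ?_
  rintro _ ⟨a, ha, rfl⟩
  exact ⟨a, h ha, rfl⟩

theorem mem_tomitaGraph {M : VonNeumannAlgebra H} {a : H →L[ℂ] H} (ha : a ∈ M) (Ω : H) :
    (a Ω, (star a) Ω) ∈ tomitaGraph M Ω :=
  subset_closure ⟨a, ha, rfl⟩

/-- The Tomita operator is closable: its adjoint is defined on the dense subspace `M' Ω`. -/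
theorem tomitaGraph_snd_eq_zero {M : VonNeumannAlgebra H} {Ω : H} (h : IsCyclicSeparating M Ω)
    {p : H × H} (hp : p ∈ tomitaGraph M Ω) (h0 : p.1 = 0) : p.2 = 0 := by
  refine eq_zero_of_orthogonal_commutant h fun b hb => ?_
  have h1 : ∀ q ∈ tomitaGraph M Ω, ⟪b Ω, q.2⟫ = ⟪q.1, (star b) Ω⟫ := by
    intro q hq
    refine closure_minimal (t := {q : H × H | ⟪b Ω, q.2⟫ = ⟪q.1, (star b) Ω⟫}) ?_
      (isClosed_eq (by fun_prop) (by fun_prop)) hq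
    rintro _ ⟨a, ha, rfl⟩
    have hab := VonNeumannAlgebra.mem_commutant_iff.1 hb a ha
    change ⟪b Ω, (star a) Ω⟫ = ⟪a Ω, (star b) Ω⟫
    rw [ContinuousLinearMap.star_eq_adjoint, ContinuousLinearMap.star_eq_adjoint,
      ContinuousLinearMap.adjoint_inner_right, ContinuousLinearMap.adjoint_inner_right]
    exact congrArg (fun x => ⟪x, Ω⟫) (DFunLike.congr_fun hab Ω)
  rw [h1 p hp, h0, inner_zero_left]

theorem tomitaGraph_fst_eq_zero {M : VonNeumannAlgebra H} {Ω : H} (h : IsCyclicSeparating M Ω)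
    {p : H × H} (hp : p ∈ tomitaGraph M Ω) (h0 : p.2 = 0) : p.1 = 0 :=
  tomitaGraph_snd_eq_zero h (tomitaGraph_swap hp) h0

end TomitaOperator

/-! ### Resolvents of the modular operator -/

section Resolvent

variable {H : Type u} [NormedAddCommGroup H] [InnerProductSpace ℂ H] [CompleteSpace H]

/-- The resolvent `(1 + Δ)⁻¹` of the modular operator. -/
noncomputable def modularResolvent (M : VonNeumannAlgebra H) (Ω : H) : H →L[ℂ] H :=
  resolvent (modularOperator M Ω)

variable {M : VonNeumannAlgebra H} {Ω : H}

theorem modularResolvent_mem (h : IsCyclicSeparating M Ω) (x : H) :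
    (modularResolvent M Ω x, x - modularResolvent M Ω x) ∈ modularGraph M Ω := by
  have hg : (modularOperator M Ω).graph = modularGraph M Ω :=
    Submodule.toLinearPMap_graph_eq _ (fun p hp h0 => modularGraph_functional h p hp h0)
  have hex := exists_resolvent h
  have h2 : modularResolvent M Ω = hex.choose := dif_pos hex
  rw [← hg, h2]
  exact hex.choose_spec x

theorem modularGraph_re_inner_nonneg {p : H × H} (hp : p ∈ modularGraph M Ω) :
    0 ≤ (⟪p.2, p.1⟫).re := by
  obtain ⟨y, hy, hq⟩ := hp
  rw [← hq _ hy]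
  exact inner_self_nonneg (𝕜 := ℂ)

theorem modularResolvent_eq (h : IsCyclicSeparating M Ω) {ξ η : H}
    (hp : (ξ, η) ∈ modularGraph M Ω) : modularResolvent M Ω (ξ + η) = ξ := by
  have h1 := modularGraph_re_inner_nonneg
    (Submodule.sub_mem _ hp (modularResolvent_mem h (ξ + η)))
  set v := modularResolvent M Ω (ξ + η)
  have h2 : ((ξ, η) - (v, ξ + η - v) : H × H) = (ξ - v, -(ξ - v)) := by
    ext
    · simp
    · simp only [Prod.mk_sub_mk]
      abel
  rw [h2, inner_neg_left, Complex.neg_re] at h1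
  have h3 : (⟪ξ - v, ξ - v⟫).re = ‖ξ - v‖ ^ 2 := inner_self_eq_norm_sq (𝕜 := ℂ) _
  have h4 : ‖ξ - v‖ ^ 2 = 0 := le_antisymm (by linarith) (sq_nonneg _)
  exact (sub_eq_zero.1 (norm_eq_zero.1 (pow_eq_zero_iff two_ne_zero |>.1 h4))).symm

theorem inner_modularGraph_comm {p q : H × H} (hp : p ∈ modularGraph M Ω)
    (hq : q ∈ modularGraph M Ω) : ⟪p.2, q.1⟫ = ⟪p.1, q.2⟫ := by
  obtain ⟨y, hy, h1⟩ := hp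
  obtain ⟨z, hz, h2⟩ := hq
  rw [← h1 _ hz, ← inner_conj_symm p.1, ← h2 _ hy, inner_conj_symm]

theorem isInjectiveResolvent_modularResolvent (h : IsCyclicSeparating M Ω) :
    IsInjectiveResolvent (modularResolvent M Ω) := by
  have hm := modularResolvent_mem h
  set T := modularResolvent M Ω
  have hsymm : ∀ x x', ⟪T x, x'⟫ = ⟪x, T x'⟫ := fun x x' => by
    have h2 := inner_modularGraph_comm (hm x) (hm x')
    simp only [inner_sub_left, inner_sub_right] at h2
    exact (sub_left_injective h2).symm
  refine ⟨?_, ?_, fun v hv => ?_, fun v hv => ?_⟩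
  · rw [ContinuousLinearMap.nonneg_iff_isPositive]
    refine ⟨hsymm, fun x => ?_⟩
    change 0 ≤ (⟪T x, x⟫).re
    have h2 := modularGraph_re_inner_nonneg (hm x)
    have h3 : (⟪T x, T x⟫).re = ‖T x‖ ^ 2 := inner_self_eq_norm_sq (𝕜 := ℂ) _
    simp only at h2
    rw [inner_sub_left, Complex.sub_re, ← hsymm x x] at h2
    linarith [sq_nonneg ‖T x‖]
  · rw [ContinuousLinearMap.le_def]
    refine ⟨fun x x' => ?_, fun x => ?_⟩
    · change ⟪x - T x, x'⟫ = ⟪x, x' - T x'⟫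
      rw [inner_sub_left, inner_sub_right, hsymm]
    · change 0 ≤ (⟪x - T x, x⟫).re
      have h2 := modularGraph_re_inner_nonneg (hm x)
      have h3 : (⟪x - T x, x - T x⟫).re = ‖x - T x‖ ^ 2 := inner_self_eq_norm_sq (𝕜 := ℂ) _
      rw [inner_sub_right, Complex.sub_re] at h3
      simp only at h2
      linarith [sq_nonneg ‖x - T x‖]
  · have h2 := hm v
    rw [hv, sub_zero] at h2
    exact modularGraph_functional h _ h2 rfl
  · have h2 := hm v
    rw [hv, sub_self] at h2
    obtain ⟨y, hy, hq⟩ := h2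
    have h3 := hq _ hy
    simp only [inner_zero_left, inner_self_eq_zero] at h3
    exact tomitaGraph_fst_eq_zero h hy h3

theorem modularMeasure_eq (M : VonNeumannAlgebra H) (Ω ψ : H) :
    modularMeasure M Ω ψ = logMeasure (modularResolvent M Ω) ψ := by
  unfold modularMeasure spectralMeasure logMeasure
  rw [Measure.map_map Real.measurable_log (by fun_prop)]
  rfl

theorem isFiniteMeasure_modularMeasure (h : IsCyclicSeparating M Ω) (ψ : H) :
    IsFiniteMeasure (modularMeasure M Ω ψ) := by
  rw [modularMeasure_eq]
  exact (isInjectiveResolvent_modularResolvent h).isFiniteMeasure ψ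

/-- Integrals against the spectral measure of `log Δ` in terms of that of `(1 + Δ)⁻¹`, for
integrands that become continuous on `[0, 1]`. -/
theorem integral_modularMeasure (h : IsCyclicSeparating M Ω) (ψ : H) {F f : ℝ → ℝ}
    (hF : Measurable F) (hf : ContinuousOn f (Icc 0 1))
    (hFf : ∀ s ∈ Ioo (0 : ℝ) 1, F (logCoord s) = f s) :
    ((∫ k, F k ∂(modularMeasure M Ω ψ) : ℝ) : ℂ)
      = ⟪ψ, ccfc (fun s => (f s : ℂ)) (modularResolvent M Ω) ψ⟫ := by
  have hT := isInjectiveResolvent_modularResolvent h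
  rw [inner_ccfc (f := fun s => (f s : ℂ)) hT.nonneg hT.le_one
      (Complex.continuous_ofReal.comp_continuousOn hf),
    integral_complex_ofReal, modularMeasure_eq, logMeasure,
    integral_map measurable_logCoord.aemeasurable hF.aestronglyMeasurable]
  congr 1
  refine integral_congr_ae ?_
  filter_upwards [hT.mem_Ioo ψ] with s hs using hFf s hs

theorem integral_one_modularMeasure (h : IsCyclicSeparating M Ω) (ψ : H) :
    ∫ _, (1 : ℝ) ∂(modularMeasure M Ω ψ) = ‖ψ‖ ^ 2 := by
  have hT := isInjectiveResolvent_modularResolvent h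
  have h1 := integral_modularMeasure h ψ (F := fun _ => 1) (f := fun _ => 1) measurable_const
    continuousOn_const fun _ _ => rfl
  simp only [Complex.ofReal_one] at h1
  rw [ccfc_one hT.nonneg] at h1
  refine Complex.ofReal_injective (h1.trans ?_)
  change ⟪ψ, ψ⟫ = _
  rw [inner_self_eq_norm_sq_to_K]
  simp

/-- The function of `s` that represents `(l + Δ)⁻¹` as a function of `(1 + Δ)⁻¹`. -/
noncomputable def resolventSymbol (l s : ℝ) : ℝ := s / (l * s + (1 - s))

theorem resolventSymbol_denom_pos {l : ℝ} (hl : 0 < l) {s : ℝ} (hs : s ∈ Icc (0 : ℝ) 1) :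
    0 < l * s + (1 - s) := by
  rcases eq_or_lt_of_le hs.1 with h | h
  · simp [← h]
  · have := mul_pos hl h
    linarith [hs.2]

theorem continuousOn_resolventSymbol {l : ℝ} (hl : 0 < l) :
    ContinuousOn (resolventSymbol l) (Icc 0 1) :=
  ContinuousOn.div (by fun_prop) (by fun_prop) fun _ hs => (resolventSymbol_denom_pos hl hs).ne'

theorem resolventSymbol_eq {l : ℝ} {s : ℝ} (hs : s ∈ Ioo (0 : ℝ) 1) :
    (l + Real.exp (logCoord s))⁻¹ = resolventSymbol l s := by
  have := hs.1.ne'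
  rw [exp_logCoord hs, resolventSymbol,
    show l + (s⁻¹ - 1) = (l * s + (1 - s)) / s by field_simp, inv_div]

/-- The resolvent `(l + Δ)⁻¹`, for `l > 0`. -/
noncomputable def modularResolventAt (M : VonNeumannAlgebra H) (Ω : H) (l : ℝ) : H →L[ℂ] H :=
  ccfc (fun s => (resolventSymbol l s : ℂ)) (modularResolvent M Ω)

theorem modularResolventAt_mem (h : IsCyclicSeparating M Ω) {l : ℝ} (hl : 0 < l) (ψ : H) :
    (modularResolventAt M Ω l ψ, ψ - (l : ℂ) • modularResolventAt M Ω l ψ) ∈ modularGraph M Ω := by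
  have hT := isInjectiveResolvent_modularResolvent h
  let g : ℝ → ℝ := fun s => 1 / (l * s + (1 - s))
  have hg : ContinuousOn (fun s => (g s : ℂ)) (Icc 0 1) :=
    Complex.continuous_ofReal.comp_continuousOn (ContinuousOn.div (by fun_prop) (by fun_prop)
      fun _ hs => (resolventSymbol_denom_pos hl hs).ne')
  have hr : ContinuousOn (fun s => (resolventSymbol l s : ℂ)) (Icc 0 1) :=
    Complex.continuous_ofReal.comp_continuousOn (continuousOn_resolventSymbol hl)
  have hid : ContinuousOn (fun s : ℝ => (s : ℂ)) (Icc 0 1) := Complex.continuous_ofReal.continuousOn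
  set T := modularResolvent M Ω with hTdef
  have h1 : T (ccfc (fun s => (g s : ℂ)) T ψ) = modularResolventAt M Ω l ψ := by
    have e : modularResolventAt M Ω l = ccfc (fun s : ℝ => (s : ℂ) * (g s : ℂ)) T := by
      refine ccfc_congr hT.nonneg hT.le_one fun s _ => ?_
      simp only [resolventSymbol, g, ← Complex.ofReal_mul]
      rw [mul_one_div]
    rw [e, ccfc_mul hT.nonneg hT.le_one hid hg, ccfc_id hT.nonneg]
    rfl
  have h2 : ccfc (fun s => (g s : ℂ)) T = 1 - (l : ℂ) • modularResolventAt M Ω l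
      + modularResolventAt M Ω l := by
    unfold modularResolventAt
    rw [← hTdef, ← ccfc_one (T := T) hT.nonneg, ← ccfc_smul hT.nonneg hT.le_one _ hr,
      ← ccfc_sub (g := fun s => (l : ℂ) * (resolventSymbol l s : ℂ)) hT.nonneg hT.le_one
        continuousOn_const (continuousOn_const.mul hr),
      ← ccfc_add (f := fun s => 1 - (l : ℂ) * (resolventSymbol l s : ℂ)) hT.nonneg hT.le_one
        (continuousOn_const.sub (continuousOn_const.mul hr)) hr]
    refine ccfc_congr hT.nonneg hT.le_one fun s hs => ?_
    have h3 := (resolventSymbol_denom_pos hl hs).ne'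
    simp only [g, resolventSymbol]
    rw [← Complex.ofReal_one, ← Complex.ofReal_mul, ← Complex.ofReal_sub, ← Complex.ofReal_add]
    congr 1
    field_simp
    ring
  have h3 := modularResolvent_mem h (ccfc (fun s => (g s : ℂ)) T ψ)
  rw [← hTdef, h1, h2] at h3
  simpa using h3

theorem inner_modularResolventAt (h : IsCyclicSeparating M Ω) {l : ℝ} (hl : 0 < l) (ψ : H) :
    ⟪ψ, modularResolventAt M Ω l ψ⟫
      = ((∫ k, (l + Real.exp k)⁻¹ ∂(modularMeasure M Ω ψ) : ℝ) : ℂ) :=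
  (integral_modularMeasure h ψ (F := fun k => (l + Real.exp k)⁻¹) (by fun_prop)
    (continuousOn_resolventSymbol hl) fun _ hs => resolventSymbol_eq hs).symm

theorem inner_modularResolventAt_modularResolventAt (h : IsCyclicSeparating M Ω) {l m : ℝ}
    (hl : 0 < l) (hm : 0 < m) (ψ : H) :
    ⟪modularResolventAt M Ω l ψ, modularResolventAt M Ω m ψ⟫
      = ((∫ k, (l + Real.exp k)⁻¹ * (m + Real.exp k)⁻¹ ∂(modularMeasure M Ω ψ) : ℝ) : ℂ) := by
  have hT := isInjectiveResolvent_modularResolvent h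
  have hr : ∀ {l : ℝ}, 0 < l → ContinuousOn (fun s => (resolventSymbol l s : ℂ)) (Icc 0 1) :=
    fun hl => Complex.continuous_ofReal.comp_continuousOn (continuousOn_resolventSymbol hl)
  rw [integral_modularMeasure h ψ (F := fun k => (l + Real.exp k)⁻¹ * (m + Real.exp k)⁻¹)
    (by fun_prop) (f := fun s => resolventSymbol l s * resolventSymbol m s)
    ((continuousOn_resolventSymbol hl).mul (continuousOn_resolventSymbol hm))
    fun _ hs => by rw [resolventSymbol_eq hs, resolventSymbol_eq hs]]
  rw [modularResolventAt, modularResolventAt, inner_ccfc_ccfc hT.nonneg hT.le_one (hr hl) (hr hm),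
    ← inner_ccfc (f := fun s => conj (resolventSymbol l s : ℂ) * (resolventSymbol m s : ℂ))
      hT.nonneg hT.le_one ((Complex.continuous_conj.comp_continuousOn (hr hl)).mul (hr hm))]
  simp only [Complex.conj_ofReal, Complex.ofReal_mul]

end Resolvent

/-! ### The quadratic form of the modular operator -/

section QuadraticForm

variable {H : Type u} [NormedAddCommGroup H] [InnerProductSpace ℂ H] [CompleteSpace H]

theorem inv_add_exp_le {l : ℝ} (hl : 0 < l) (k : ℝ) : (l + Real.exp k)⁻¹ ≤ l⁻¹ :=
  inv_anti₀ hl (by linarith [Real.exp_pos k])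

theorem integrable_inv_add_exp {μ : Measure ℝ} [IsFiniteMeasure μ] {l : ℝ} (hl : 0 < l) :
    Integrable (fun k => (l + Real.exp k)⁻¹) μ := by
  refine Integrable.of_bound (by fun_prop) l⁻¹ (Eventually.of_forall fun k => ?_)
  rw [Real.norm_of_nonneg (by positivity)]
  exact inv_add_exp_le hl k

theorem integrable_inv_add_exp_mul {μ : Measure ℝ} [IsFiniteMeasure μ] {l m : ℝ} (hl : 0 < l)
    (hm : 0 < m) : Integrable (fun k => (l + Real.exp k)⁻¹ * (m + Real.exp k)⁻¹) μ := by
  refine Integrable.of_bound (by fun_prop) (l⁻¹ * m⁻¹) (Eventually.of_forall fun k => ?_)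
  rw [Real.norm_of_nonneg (by positivity)]
  exact mul_le_mul (inv_add_exp_le hl k) (inv_add_exp_le hm k) (by positivity) (by positivity)

/-- Smooth approximations `l / (l + eᵏ)` of `1`, with `l = n + 1`. -/
noncomputable def yosida (n : ℕ) (k : ℝ) : ℝ := ((n : ℝ) + 1) * ((n : ℝ) + 1 + Real.exp k)⁻¹

theorem yosida_nonneg (n : ℕ) (k : ℝ) : 0 ≤ yosida n k := by
  unfold yosida
  positivity

theorem yosida_le_one (n : ℕ) (k : ℝ) : yosida n k ≤ 1 := by
  unfold yosida
  have h : (0 : ℝ) < (n : ℝ) + 1 := by positivity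
  exact (mul_le_mul_of_nonneg_left (inv_add_exp_le h k) h.le).trans (mul_inv_cancel₀ h.ne').le

theorem exp_mul_yosida_le (n : ℕ) (k : ℝ) : Real.exp k * yosida n k ≤ (n : ℝ) + 1 := by
  unfold yosida
  have h : (0 : ℝ) < (n : ℝ) + 1 + Real.exp k := by positivity
  rw [mul_left_comm, ← div_eq_mul_inv]
  exact mul_le_of_le_one_right (by positivity) ((div_le_one h).2 (by linarith))

theorem measurable_yosida (n : ℕ) : Measurable (yosida n) := by
  unfold yosida
  fun_prop

theorem tendsto_yosida (k : ℝ) : Tendsto (fun n => yosida n k) atTop (𝓝 1) := by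
  have h1 : ∀ n, yosida n k = 1 - Real.exp k * ((n : ℝ) + 1 + Real.exp k)⁻¹ := fun n => by
    have h : (0 : ℝ) < (n : ℝ) + 1 + Real.exp k := by positivity
    unfold yosida
    field_simp
    ring
  have h2 : Tendsto (fun n : ℕ => ((n : ℝ) + 1 + Real.exp k)⁻¹) atTop (𝓝 0) :=
    tendsto_inv_atTop_zero.comp
      (tendsto_atTop_add_const_right _ _ (tendsto_atTop_add_const_right _ _
        tendsto_natCast_atTop_atTop))
  simp only [h1]
  simpa using (h2.const_mul (Real.exp k)).const_sub 1

/-- The form of the modular operator: `‖S χ‖² = ⟨χ, Δ χ⟩` for `χ` in the domain of `S`. With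
`χₙ = (n + 1) (n + 1 + Δ)⁻¹ χ`, the vectors `S χₙ` form a Cauchy sequence with limit `S χ`, because
`S` is closed. -/
theorem exp_modularMeasure {M : VonNeumannAlgebra H} {Ω : H} (h : IsCyclicSeparating M Ω)
    {χ z : H} (hp : (χ, z) ∈ tomitaGraph M Ω) :
    Integrable Real.exp (modularMeasure M Ω χ) ∧
      ∫ k, Real.exp k ∂(modularMeasure M Ω χ) = ‖z‖ ^ 2 := by
  have := isFiniteMeasure_modularMeasure h χ
  set μ := modularMeasure M Ω χ with hμ
  have hl : ∀ n : ℕ, (0 : ℝ) < (n : ℝ) + 1 := fun n => by positivity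
  let R : ℕ → H := fun n => modularResolventAt M Ω ((n : ℝ) + 1) χ
  let c : ℕ → ℂ := fun n => (((n : ℝ) + 1 : ℝ) : ℂ)
  have hmem : ∀ n, (c n • R n, c n • (χ - c n • R n)) ∈ modularGraph M Ω := fun n => by
    have := Submodule.smul_mem _ (c n) (modularResolventAt_mem h (hl n) χ)
    rwa [Prod.smul_mk] at this
  choose y hy hq using hmem
  simp only at hy hq
  have hone : ⟪χ, χ⟫ = ((∫ _, (1 : ℝ) ∂μ : ℝ) : ℂ) := by
    rw [hμ, integral_one_modularMeasure h, inner_self_eq_norm_sq_to_K]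
    simp
  have hχR : ∀ n, ⟪χ, R n⟫ = ((∫ k, ((n : ℝ) + 1 + Real.exp k)⁻¹ ∂μ : ℝ) : ℂ) := fun n =>
    inner_modularResolventAt h (hl n) χ
  have hRχ : ∀ n, ⟪R n, χ⟫ = ((∫ k, ((n : ℝ) + 1 + Real.exp k)⁻¹ ∂μ : ℝ) : ℂ) := fun n => by
    rw [← inner_conj_symm, hχR, Complex.conj_ofReal]
  have hRR : ∀ n m, ⟪R n, R m⟫
      = ((∫ k, ((n : ℝ) + 1 + Real.exp k)⁻¹ * ((m : ℝ) + 1 + Real.exp k)⁻¹ ∂μ : ℝ) : ℂ) :=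
    fun n m => inner_modularResolventAt_modularResolventAt h (hl n) (hl m) χ
  have hi1 : ∀ n : ℕ, Integrable (fun k => ((n : ℝ) + 1 + Real.exp k)⁻¹) μ := fun n =>
    integrable_inv_add_exp (hl n)
  have hi2 : ∀ n m : ℕ,
      Integrable (fun k => ((n : ℝ) + 1 + Real.exp k)⁻¹ * ((m : ℝ) + 1 + Real.exp k)⁻¹) μ :=
    fun n m => integrable_inv_add_exp_mul (hl n) (hl m)
  have hc : ∀ n, conj (c n) = c n := fun n => Complex.conj_ofReal _
  have hey : ∀ (n : ℕ) k, Real.exp k * yosida n k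
      = ((n : ℝ) + 1) * (1 - ((n : ℝ) + 1) * ((n : ℝ) + 1 + Real.exp k)⁻¹) := fun n k => by
    have h : (0 : ℝ) < (n : ℝ) + 1 + Real.exp k := by positivity
    unfold yosida
    field_simp
    ring
  have hzy : ∀ n, ⟪z, y n⟫ = ((∫ k, Real.exp k * yosida n k ∂μ : ℝ) : ℂ) := fun n => by
    rw [hq n _ hp]
    simp only [hey]
    rw [integral_const_mul, integral_sub (integrable_const _) ((hi1 n).const_mul _),
      integral_const_mul, inner_smul_left, inner_sub_left, inner_smul_left, hRχ, hone, hc]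
    simp only [c]
    push_cast
    rfl
  have hyy : ∀ m n, ⟪y m, y n⟫ = ((∫ k, Real.exp k * (yosida m k * yosida n k) ∂μ : ℝ) : ℂ) :=
      fun m n => by
    have e : ∀ k, Real.exp k * (yosida m k * yosida n k)
        = ((n : ℝ) + 1) * (((m : ℝ) + 1) * (((m : ℝ) + 1 + Real.exp k)⁻¹
          - ((n : ℝ) + 1) * (((n : ℝ) + 1 + Real.exp k)⁻¹ * ((m : ℝ) + 1 + Real.exp k)⁻¹))) :=
        fun k => by
      rw [mul_left_comm, hey, yosida]
      ring
    rw [hq n _ (hy m)]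
    simp only [e]
    rw [integral_const_mul, integral_const_mul, integral_sub (hi1 m) ((hi2 n m).const_mul _),
      integral_const_mul, inner_smul_left, inner_smul_right, inner_sub_left, inner_smul_left,
      hχR, hRR, hc]
    simp only [c]
    push_cast
    rfl
  have hint1 : ∀ n, Integrable (fun k => Real.exp k * yosida n k) μ := fun n => by
    refine Integrable.of_bound (Real.measurable_exp.mul (measurable_yosida n)).aestronglyMeasurable
      ((n : ℝ) + 1) (Eventually.of_forall fun k => ?_)
    rw [Real.norm_of_nonneg (mul_nonneg (Real.exp_pos k).le (yosida_nonneg n k))]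
    exact exp_mul_yosida_le n k
  have hint2 : ∀ m n, Integrable (fun k => Real.exp k * (yosida m k * yosida n k)) μ := fun m n => by
    refine ((hint1 n).mul_bdd (c := 1) (f := fun k => Real.exp k * yosida n k)
      (measurable_yosida m).aestronglyMeasurable (Eventually.of_forall fun k => ?_)).congr
      (Eventually.of_forall fun k => ?_)
    · rw [Real.norm_of_nonneg (yosida_nonneg m k)]
      exact yosida_le_one m k
    · simp only
      ring
  have hnorm : ∀ n, ‖y n‖ ^ 2 = ∫ k, Real.exp k * (yosida n k * yosida n k) ∂μ := fun n => by
    have h2 := hyy n n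
    rw [inner_self_eq_norm_sq_to_K] at h2
    exact Complex.ofReal_injective (by simpa using h2)
  have hle : ∀ n, ‖y n‖ ^ 2 ≤ ∫ k, Real.exp k * yosida n k ∂μ := fun n => by
    rw [hnorm]
    refine integral_mono (hint2 n n) (hint1 n) fun k => ?_
    exact mul_le_mul_of_nonneg_left (mul_le_of_le_one_left (yosida_nonneg n k) (yosida_le_one n k))
      (Real.exp_pos k).le
  have hge : ∀ n, ∫ k, Real.exp k * yosida n k ∂μ ≤ ‖z‖ * ‖y n‖ := fun n => by
    have h2 := norm_inner_le_norm (𝕜 := ℂ) z (y n)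
    rw [hzy, Complex.norm_real] at h2
    exact (le_abs_self _).trans h2
  have hyz : ∀ n, ‖y n‖ ≤ ‖z‖ := fun n => by
    have h2 := (hle n).trans (hge n)
    by_contra! hlt
    nlinarith [norm_nonneg z, norm_nonneg (y n)]
  have hbound : ∀ n, ∫ k, Real.exp k * yosida n k ∂μ ≤ ‖z‖ ^ 2 := fun n =>
    (hge n).trans (by rw [sq]; exact mul_le_mul_of_nonneg_left (hyz n) (norm_nonneg z))
  have hexp : Integrable Real.exp μ := by
    refine ⟨Real.measurable_exp.aestronglyMeasurable, ?_⟩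
    rw [hasFiniteIntegral_iff_ofReal (Eventually.of_forall fun k => (Real.exp_pos k).le)]
    refine lt_of_le_of_lt ?_ (ENNReal.ofReal_lt_top (r := ‖z‖ ^ 2))
    have e : ∀ k, ENNReal.ofReal (Real.exp k)
        = liminf (fun n => ENNReal.ofReal (Real.exp k * yosida n k)) atTop := fun k => by
      refine (Tendsto.liminf_eq ?_).symm
      refine (ENNReal.continuous_ofReal.tendsto _).comp ?_
      simpa using (tendsto_yosida k).const_mul (Real.exp k)
    simp only [e]
    refine (lintegral_liminf_le (f := fun n k => ENNReal.ofReal (Real.exp k * yosida n k)) fun n =>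
      (Real.measurable_exp.mul (measurable_yosida n)).ennreal_ofReal).trans ?_
    refine liminf_le_of_frequently_le' (Frequently.of_forall fun n => ?_)
    rw [← ofReal_integral_eq_lintegral_ofReal (hint1 n)
      (Eventually.of_forall fun k => mul_nonneg (Real.exp_pos k).le (yosida_nonneg n k))]
    exact ENNReal.ofReal_le_ofReal (hbound n)
  refine ⟨hexp, ?_⟩
  have hlim2 : Tendsto (fun n : ℕ × ℕ => ∫ k, Real.exp k * (yosida n.1 k - yosida n.2 k) ^ 2 ∂μ)
      atTop (𝓝 0) := by
    rw [← integral_zero ℝ ℝ (μ := μ)]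
    refine tendsto_integral_filter_of_dominated_convergence Real.exp
      (Eventually.of_forall fun n => ?_) (Eventually.of_forall fun n => Eventually.of_forall fun k => ?_)
      hexp (Eventually.of_forall fun k => ?_)
    · exact (Real.measurable_exp.mul (((measurable_yosida _).sub
        (measurable_yosida _)).pow_const 2)).aestronglyMeasurable
    · rw [Real.norm_of_nonneg (mul_nonneg (Real.exp_pos k).le (sq_nonneg _))]
      refine mul_le_of_le_one_right (Real.exp_pos k).le ?_
      rw [sq_le_one_iff_abs_le_one, abs_le]
      constructor <;> linarith [yosida_nonneg n.1 k, yosida_nonneg n.2 k, yosida_le_one n.1 k,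
        yosida_le_one n.2 k]
    · have h3 : Tendsto (fun n : ℕ × ℕ => yosida n.1 k - yosida n.2 k) atTop (𝓝 (1 - 1)) := by
        rw [← prod_atTop_atTop_eq]
        exact ((tendsto_yosida k).comp tendsto_fst).sub ((tendsto_yosida k).comp tendsto_snd)
      simpa using (h3.pow 2).const_mul (Real.exp k)
  have hdist : ∀ n m, ‖y n - y m‖ ^ 2 = ∫ k, Real.exp k * (yosida n k - yosida m k) ^ 2 ∂μ :=
      fun n m => by
    have e : ∀ k, Real.exp k * (yosida n k - yosida m k) ^ 2
        = Real.exp k * (yosida n k * yosida n k) - 2 * (Real.exp k * (yosida n k * yosida m k))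
          + Real.exp k * (yosida m k * yosida m k) := fun k => by ring
    have hs : Integrable (fun k => Real.exp k * (yosida n k * yosida n k)
        - 2 * (Real.exp k * (yosida n k * yosida m k))) μ := (hint2 n n).sub ((hint2 n m).const_mul 2)
    simp only [e]
    rw [integral_add hs (hint2 m m),
      integral_sub (hint2 n n) ((hint2 n m).const_mul 2), integral_const_mul, ← hnorm, ← hnorm,
      norm_sub_sq (𝕜 := ℂ), hyy]
    simp
  have hcauchy : CauchySeq y := by
    rw [cauchySeq_iff_tendsto_dist_atTop_0]
    have e : ∀ n : ℕ × ℕ, dist (y n.1) (y n.2)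
        = √(∫ k, Real.exp k * (yosida n.1 k - yosida n.2 k) ^ 2 ∂μ) := fun n => by
      rw [← hdist, Real.sqrt_sq (norm_nonneg _), dist_eq_norm]
    simp only [e]
    rw [← Real.sqrt_zero]
    exact (Real.continuous_sqrt.tendsto _).comp hlim2
  obtain ⟨w, hw⟩ := cauchySeq_tendsto_of_complete hcauchy
  have hx : Tendsto (fun n => c n • R n) atTop (𝓝 χ) := by
    rw [tendsto_iff_norm_sub_tendsto_zero]
    have e : ∀ n, ‖c n • R n - χ‖ = √(∫ k, (1 - yosida n k) ^ 2 ∂μ) := fun n => by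
      have e1 : ∀ k, (1 - yosida n k) ^ 2 = (1 - 2 * (((n : ℝ) + 1) * ((n : ℝ) + 1 + Real.exp k)⁻¹))
          + ((n : ℝ) + 1) ^ 2 * (((n : ℝ) + 1 + Real.exp k)⁻¹ * ((n : ℝ) + 1 + Real.exp k)⁻¹) :=
        fun k => by
          unfold yosida
          ring
      have e2 : ‖c n • R n - χ‖ ^ 2 = ∫ k, (1 - yosida n k) ^ 2 ∂μ := by
        have hs : Integrable (fun k => 1 - 2 * (((n : ℝ) + 1) * ((n : ℝ) + 1 + Real.exp k)⁻¹)) μ :=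
          (integrable_const _).sub (((hi1 n).const_mul _).const_mul _)
        simp only [e1]
        rw [integral_add hs ((hi2 n n).const_mul _), integral_sub (integrable_const _)
          (((hi1 n).const_mul _).const_mul _), integral_const_mul, integral_const_mul,
          integral_const_mul]
        have e3 : ((‖c n • R n - χ‖ ^ 2 : ℝ) : ℂ) = ⟪c n • R n - χ, c n • R n - χ⟫ := by
          rw [inner_self_eq_norm_sq_to_K]
          simp
        apply Complex.ofReal_injective
        rw [e3]
        simp only [inner_sub_left, inner_sub_right, inner_smul_left, inner_smul_right, hc, hχR, hRχ,
          hRR, hone, c]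
        push_cast
        ring
      rw [← e2, Real.sqrt_sq (norm_nonneg _)]
    simp only [e]
    rw [← Real.sqrt_zero]
    refine (Real.continuous_sqrt.tendsto _).comp ?_
    rw [← integral_zero ℝ ℝ (μ := μ)]
    refine tendsto_integral_of_dominated_convergence (fun _ => 1)
      (fun n => ((measurable_const.sub (measurable_yosida n)).pow_const 2).aestronglyMeasurable)
      (integrable_const _) (fun n => Eventually.of_forall fun k => ?_)
      (Eventually.of_forall fun k => ?_)
    · rw [Real.norm_of_nonneg (sq_nonneg _), sq_le_one_iff_abs_le_one, abs_le]
      constructor <;> linarith [yosida_nonneg n k, yosida_le_one n k]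
    · simpa using ((tendsto_yosida k).const_sub 1).pow 2
  have hmemw : (χ, w) ∈ tomitaGraph M Ω :=
    isClosed_closure.mem_of_tendsto (hx.prodMk_nhds hw) (Eventually.of_forall hy)
  have hwz : w = z := by
    have h2 := tomitaGraph_snd_eq_zero h (tomitaGraph_sub hmemw hp) (sub_self χ)
    exact sub_eq_zero.1 h2
  have h3 : Tendsto (fun n => ‖y n‖ ^ 2) atTop (𝓝 (‖z‖ ^ 2)) := by
    rw [← hwz]
    exact hw.norm.pow 2
  simp only [hnorm] at h3
  refine tendsto_nhds_unique (tendsto_integral_of_dominated_convergence Real.exp (fun n =>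
    (hint2 n n).aestronglyMeasurable) hexp (fun n => Eventually.of_forall fun k => ?_)
      (Eventually.of_forall fun k => ?_)) h3
  · rw [Real.norm_of_nonneg (mul_nonneg (Real.exp_pos k).le
      (mul_nonneg (yosida_nonneg n k) (yosida_nonneg n k)))]
    exact mul_le_of_le_one_right (Real.exp_pos k).le
      (mul_le_one₀ (yosida_le_one n k) (yosida_nonneg n k) (yosida_le_one n k))
  · simpa using ((tendsto_yosida k).mul (tendsto_yosida k)).const_mul (Real.exp k)

end QuadraticForm

/-! ### The modular unitaries -/

section ModularUnitary

variable {H : Type u} [NormedAddCommGroup H] [InnerProductSpace ℂ H] [CompleteSpace H]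

/-- The character `k ↦ e^{itk}`. -/
noncomputable def expChar (t : ℝ) : ℝ →ᵇ ℂ :=
  BoundedContinuousFunction.ofNormedAddCommGroup
    (fun k => Complex.exp ((t * k : ℝ) * Complex.I)) (by fun_prop) 1
    (fun k => (Complex.norm_exp_ofReal_mul_I _).le)

theorem expChar_apply (t k : ℝ) : expChar t k = Complex.exp ((t * k : ℝ) * Complex.I) := rfl

theorem norm_expChar (t k : ℝ) : ‖expChar t k‖ = 1 := Complex.norm_exp_ofReal_mul_I _

variable {M : VonNeumannAlgebra H} {Ω : H}

theorem inner_modularUnitary (h : IsCyclicSeparating M Ω) (t : ℝ) (ψ : H) :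
    ⟪ψ, modularUnitary M Ω t ψ⟫ = ∫ k, expChar t k ∂(modularMeasure M Ω ψ) := by
  have hex : ∃ B : H →L[ℂ] H, ∀ ψ : H,
      ⟪ψ, B ψ⟫ = ∫ k : ℝ, Complex.exp ((t * k : ℝ) * Complex.I) ∂(modularMeasure M Ω ψ) := by
    obtain ⟨B, hB, -⟩ := (isInjectiveResolvent_modularResolvent h).exists_operator (expChar t)
    refine ⟨B, fun ψ => ?_⟩
    rw [hB, modularMeasure_eq]
    rfl
  have h2 : modularUnitary M Ω t = hex.choose := dif_pos hex
  rw [h2]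
  exact hex.choose_spec ψ

/-- An operator with the quadratic form of `G(log Δ)` multiplies spectral measures by `|G|²`. -/
theorem modularMeasure_apply (h : IsCyclicSeparating M Ω) {G : ℝ →ᵇ ℂ} {B : H →L[ℂ] H}
    (hB : ∀ ψ, ⟪ψ, B ψ⟫ = ∫ k, G k ∂(modularMeasure M Ω ψ)) (ψ : H) :
    modularMeasure M Ω (B ψ)
      = (modularMeasure M Ω ψ).withDensity (fun k => ENNReal.ofReal (‖G k‖ ^ 2)) := by
  obtain ⟨B', hB', hd⟩ := (isInjectiveResolvent_modularResolvent h).exists_operator G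
  have : B = B' := eq_of_forall_inner fun ψ => by rw [hB, hB', modularMeasure_eq]
  rw [this, modularMeasure_eq, modularMeasure_eq, hd]

theorem integral_modularMeasure_apply (h : IsCyclicSeparating M Ω) {G : ℝ →ᵇ ℂ} {B : H →L[ℂ] H}
    (hB : ∀ ψ, ⟪ψ, B ψ⟫ = ∫ k, G k ∂(modularMeasure M Ω ψ)) (ψ : H) (F : ℝ → ℝ) :
    ∫ k, F k ∂(modularMeasure M Ω (B ψ)) = ∫ k, F k * ‖G k‖ ^ 2 ∂(modularMeasure M Ω ψ) := by
  rw [modularMeasure_apply h hB, integral_withDensity_eq_integral_toReal_smul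
    (G.continuous.measurable.norm.pow_const 2).ennreal_ofReal
    (Eventually.of_forall fun s => ENNReal.ofReal_lt_top)]
  congr 1
  funext k
  rw [ENNReal.toReal_ofReal (by positivity), smul_eq_mul, mul_comm]

theorem norm_sq_apply (h : IsCyclicSeparating M Ω) {G : ℝ →ᵇ ℂ} {B : H →L[ℂ] H}
    (hB : ∀ ψ, ⟪ψ, B ψ⟫ = ∫ k, G k ∂(modularMeasure M Ω ψ)) (ψ : H) :
    ‖B ψ‖ ^ 2 = ∫ k, ‖G k‖ ^ 2 ∂(modularMeasure M Ω ψ) := by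
  rw [← integral_one_modularMeasure h, integral_modularMeasure_apply h hB]
  simp

/-- The spectral measure of `log Δ` at `Ω` is concentrated at `0`, as `Δ Ω = Ω`. -/
theorem modularMeasure_self (h : IsCyclicSeparating M Ω) :
    ∀ᵐ k ∂(modularMeasure M Ω Ω), k = 0 := by
  have := isFiniteMeasure_modularMeasure h Ω
  have hΩ : (Ω, Ω) ∈ tomitaGraph M Ω := by simpa using mem_tomitaGraph (one_mem M) Ω
  have hΔ : (Ω, Ω) ∈ modularGraph M Ω := by
    refine ⟨Ω, hΩ, fun q hq => ?_⟩
    refine closure_minimal (t := {q : H × H | ⟪q.2, Ω⟫ = ⟪Ω, q.1⟫}) ?_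
      (isClosed_eq (by fun_prop) (by fun_prop)) hq
    rintro _ ⟨a, ha, rfl⟩
    change ⟪(star a) Ω, Ω⟫ = ⟪Ω, a Ω⟫
    rw [ContinuousLinearMap.star_eq_adjoint, ContinuousLinearMap.adjoint_inner_left]
  have hhalf : modularResolventAt M Ω 1 Ω = (2⁻¹ : ℂ) • Ω := by
    have h1 := modularResolvent_eq h (modularResolventAt_mem h one_pos Ω)
    have h2 := Submodule.smul_mem _ (2⁻¹ : ℂ) hΔ
    rw [Prod.smul_mk] at h2
    have h3 := modularResolvent_eq h h2
    have e1 : modularResolventAt M Ω 1 Ω + (Ω - ((1 : ℝ) : ℂ) • modularResolventAt M Ω 1 Ω) = Ω := by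
      simp
    have e2 : (2⁻¹ : ℂ) • Ω + (2⁻¹ : ℂ) • Ω = Ω := by
      rw [← add_smul, ← two_mul, mul_inv_cancel₀ two_ne_zero, one_smul]
    rw [e1] at h1
    rw [e2] at h3
    rw [← h1, h3]
  have i1 := integral_one_modularMeasure h Ω
  obtain ⟨hint, i2⟩ := exp_modularMeasure h hΩ
  have i3 : ∫ k, (1 + Real.exp k)⁻¹ ∂(modularMeasure M Ω Ω) = ‖Ω‖ ^ 2 / 2 := by
    apply Complex.ofReal_injective
    rw [← inner_modularResolventAt h one_pos, hhalf, inner_smul_right, inner_self_eq_norm_sq_to_K]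
    push_cast
    rw [div_eq_inv_mul]
    rfl
  have hr := integrable_inv_add_exp (μ := modularMeasure M Ω Ω) one_pos
  have e : ∀ k : ℝ, (Real.exp k - 1) ^ 2 * (1 + Real.exp k)⁻¹
      = Real.exp k - 3 * 1 + 4 * (1 + Real.exp k)⁻¹ := fun k => by
    have : (0 : ℝ) < 1 + Real.exp k := by positivity
    field_simp
    ring
  have hi : Integrable (fun k => Real.exp k - 3 * 1) (modularMeasure M Ω Ω) :=
    hint.sub (integrable_const _)
  have hi2 : Integrable (fun k => (Real.exp k - 1) ^ 2 * (1 + Real.exp k)⁻¹)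
      (modularMeasure M Ω Ω) := by
    simp only [e]
    exact hi.add (hr.const_mul 4)
  have h0 : ∫ k, (Real.exp k - 1) ^ 2 * (1 + Real.exp k)⁻¹ ∂(modularMeasure M Ω Ω) = 0 := by
    simp only [e]
    rw [integral_add hi (hr.const_mul 4), integral_sub hint (integrable_const _),
      integral_const_mul, integral_const_mul, i1, i2, i3]
    ring
  have h1 := (integral_eq_zero_iff_of_nonneg (fun k => by positivity) hi2).1 h0
  filter_upwards [h1] with k hk
  have h2 : (0 : ℝ) < (1 + Real.exp k)⁻¹ := by positivity
  have h3 : (Real.exp k - 1) ^ 2 = 0 := by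
    rcases mul_eq_zero.1 hk with h3 | h3
    · exact h3
    · exact absurd h3 h2.ne'
  have h4 : Real.exp k = 1 := sub_eq_zero.1 (pow_eq_zero_iff two_ne_zero |>.1 h3)
  exact Real.exp_eq_one_iff k |>.1 h4

theorem modularUnitary_apply_self (h : IsCyclicSeparating M Ω) (t : ℝ) :
    modularUnitary M Ω t Ω = Ω := by
  have h1 : ⟪Ω, modularUnitary M Ω t Ω⟫ = ((‖Ω‖ ^ 2 : ℝ) : ℂ) := by
    rw [inner_modularUnitary h, ← integral_one_modularMeasure h, ← integral_complex_ofReal]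
    refine integral_congr_ae ?_
    filter_upwards [modularMeasure_self h] with k hk
    simp [expChar_apply, hk]
  have h2 : ‖modularUnitary M Ω t Ω‖ ^ 2 = ‖Ω‖ ^ 2 := by
    rw [norm_sq_apply h (inner_modularUnitary h t), ← integral_one_modularMeasure h]
    simp [norm_expChar]
  have h3 : ‖Ω - modularUnitary M Ω t Ω‖ ^ 2 = 0 := by
    rw [norm_sub_sq (𝕜 := ℂ), h1, h2]
    simp only [RCLike.re_to_complex, Complex.ofReal_re]
    ring
  exact (sub_eq_zero.1 (norm_eq_zero.1 (pow_eq_zero_iff two_ne_zero |>.1 h3))).symm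

theorem modularFlow_apply_self (h : IsCyclicSeparating M Ω) (t : ℝ) (a : H →L[ℂ] H) :
    modularFlow M Ω t a Ω = modularUnitary M Ω t (a Ω) := by
  unfold modularFlow
  rw [mul_apply_eq_comp, mul_apply_eq_comp, modularUnitary_apply_self h]

end ModularUnitary

/-! ### Comparison of resolvents for an inclusion of algebras -/

section Comparison

variable {H : Type u} [NormedAddCommGroup H] [InnerProductSpace ℂ H] [CompleteSpace H]
variable {M : VonNeumannAlgebra H} {Ω : H}

/-- The vector `ξ = (l + Δ)⁻¹ ψ` maximizes `2 Re ⟨ψ, χ⟩ - l ‖χ‖² - ‖S χ‖²`. -/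
theorem le_integral_inv_add_exp (h : IsCyclicSeparating M Ω) {l : ℝ} (hl : 0 < l) (ψ : H)
    {χ z : H} (hp : (χ, z) ∈ tomitaGraph M Ω) :
    2 * (⟪ψ, χ⟫).re - l * ‖χ‖ ^ 2 - ‖z‖ ^ 2 ≤ ∫ k, (l + Real.exp k)⁻¹ ∂(modularMeasure M Ω ψ) := by
  obtain ⟨y, hy, hq⟩ := modularResolventAt_mem h hl ψ
  have hA := inner_modularResolventAt h hl ψ
  set ξ := modularResolventAt M Ω l ψ
  set A := ∫ k, (l + Real.exp k)⁻¹ ∂(modularMeasure M Ω ψ)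
  have h1 : ‖y‖ ^ 2 = A - l * ‖ξ‖ ^ 2 := by
    have h2 := congrArg Complex.re (hq _ hy)
    simp only [inner_sub_left, inner_smul_left, Complex.conj_ofReal, Complex.sub_re,
      Complex.re_ofReal_mul] at h2
    have h3 : (⟪y, y⟫).re = ‖y‖ ^ 2 := inner_self_eq_norm_sq (𝕜 := ℂ) _
    have h4 : (⟪ξ, ξ⟫).re = ‖ξ‖ ^ 2 := inner_self_eq_norm_sq (𝕜 := ℂ) _
    rw [h3, h4, hA, Complex.ofReal_re] at h2
    exact h2
  have h2 : (⟪z, y⟫).re = (⟪ψ, χ⟫).re - l * (⟪ξ, χ⟫).re := by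
    have h2 := congrArg Complex.re (hq _ hp)
    simpa only [inner_sub_left, inner_smul_left, Complex.conj_ofReal, Complex.sub_re,
      Complex.re_ofReal_mul] using h2
  have h3 : ‖ξ - χ‖ ^ 2 = ‖ξ‖ ^ 2 - 2 * (⟪ξ, χ⟫).re + ‖χ‖ ^ 2 := norm_sub_sq (𝕜 := ℂ) _ _
  have h4 : ‖z - y‖ ^ 2 = ‖z‖ ^ 2 - 2 * (⟪z, y⟫).re + ‖y‖ ^ 2 := norm_sub_sq (𝕜 := ℂ) _ _
  have h5 : 0 ≤ l * ‖ξ - χ‖ ^ 2 + ‖z - y‖ ^ 2 := by positivity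
  rw [h3, h4, h1, h2] at h5
  linarith

theorem exists_eq_integral_inv_add_exp (h : IsCyclicSeparating M Ω) {l : ℝ} (hl : 0 < l) (ψ : H) :
    ∃ p ∈ tomitaGraph M Ω, 2 * (⟪ψ, p.1⟫).re - l * ‖p.1‖ ^ 2 - ‖p.2‖ ^ 2
      = ∫ k, (l + Real.exp k)⁻¹ ∂(modularMeasure M Ω ψ) := by
  obtain ⟨y, hy, hq⟩ := modularResolventAt_mem h hl ψ
  have hA := inner_modularResolventAt h hl ψ
  refine ⟨_, hy, ?_⟩
  have h2 := congrArg Complex.re (hq _ hy)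
  simp only [inner_sub_left, inner_smul_left, Complex.conj_ofReal, Complex.sub_re,
    Complex.re_ofReal_mul] at h2
  have h3 : (⟪y, y⟫).re = ‖y‖ ^ 2 := inner_self_eq_norm_sq (𝕜 := ℂ) _
  have h4 : (⟪modularResolventAt M Ω l ψ, modularResolventAt M Ω l ψ⟫).re
    = ‖modularResolventAt M Ω l ψ‖ ^ 2 := inner_self_eq_norm_sq (𝕜 := ℂ) _
  rw [h3, h4, hA, Complex.ofReal_re] at h2
  simp only [hA, Complex.ofReal_re]
  linarith

/-- The resolvent of the modular operator is monotone in the algebra. -/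
theorem integral_inv_add_exp_mono {N : VonNeumannAlgebra H} (hNM : N ≤ M)
    (hM : IsCyclicSeparating M Ω) (hN : IsCyclicSeparating N Ω) {l : ℝ} (hl : 0 < l) (ψ : H) :
    ∫ k, (l + Real.exp k)⁻¹ ∂(modularMeasure N Ω ψ)
      ≤ ∫ k, (l + Real.exp k)⁻¹ ∂(modularMeasure M Ω ψ) := by
  obtain ⟨p, hp, h⟩ := exists_eq_integral_inv_add_exp hN hl ψ
  rw [← h]
  exact le_integral_inv_add_exp hM hl ψ (tomitaGraph_mono hNM Ω hp)

/-- Trigonometric polynomials `∑ⱼ cⱼ e^{i tⱼ k}` with frequencies `|tⱼ| ≤ τ`. -/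
def trigSpace (τ : ℝ) : Submodule ℂ (ℝ → ℂ) :=
  Submodule.span ℂ {G | ∃ t : ℝ, |t| ≤ τ ∧ G = ⇑(expChar t)}

theorem expChar_mem_trigSpace {τ t : ℝ} (ht : |t| ≤ τ) : ⇑(expChar t) ∈ trigSpace τ :=
  Submodule.subset_span ⟨t, ht, rfl⟩

/-- If the modular flow of `M` keeps `U` in `N` for times up to `τ`, then trigonometric polynomials
of `log Δ_M` with frequencies up to `τ` map `U Ω` into `N Ω`. -/
theorem exists_apply_eq_of_mem_trigSpace {N : VonNeumannAlgebra H} (hM : IsCyclicSeparating M Ω)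
    {τ : ℝ} {U : H →L[ℂ] H} (hU : ∀ t : ℝ, |t| ≤ τ → modularFlow M Ω t U ∈ N) {G : ℝ → ℂ}
    (hG : G ∈ trigSpace τ) :
    ∃ (g : ℝ →ᵇ ℂ) (B a : H →L[ℂ] H), ⇑g = G ∧ a ∈ N ∧
      (∀ ψ, ⟪ψ, B ψ⟫ = ∫ k, g k ∂(modularMeasure M Ω ψ)) ∧ B (U Ω) = a Ω := by
  have hint : ∀ (g : ℝ →ᵇ ℂ) (ψ : H), Integrable g (modularMeasure M Ω ψ) := fun g ψ => by
    have := isFiniteMeasure_modularMeasure hM ψ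
    exact g.integrable _
  induction hG using Submodule.span_induction with
  | mem G hG =>
    obtain ⟨t, ht, rfl⟩ := hG
    exact ⟨expChar t, modularUnitary M Ω t, modularFlow M Ω t U, rfl, hU t ht,
      inner_modularUnitary hM t, (modularFlow_apply_self hM t U).symm⟩
  | zero => exact ⟨0, 0, 0, rfl, zero_mem N, fun ψ => by simp, by simp⟩
  | add G G' _ _ ih ih' =>
    obtain ⟨g, B, a, rfl, ha, hB, hBa⟩ := ih
    obtain ⟨g', B', a', rfl, ha', hB', hBa'⟩ := ih'
    refine ⟨g + g', B + B', a + a', rfl, add_mem ha ha', fun ψ => ?_, ?_⟩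
    · simp only [add_apply, inner_add_right, hB, hB', BoundedContinuousFunction.add_apply]
      rw [integral_add (hint g ψ) (hint g' ψ)]
    · simp only [add_apply, hBa, hBa']
  | smul c G _ ih =>
    obtain ⟨g, B, a, rfl, ha, hB, hBa⟩ := ih
    refine ⟨c • g, c • B, c • a, rfl, N.toStarSubalgebra.smul_mem ha c, fun ψ => ?_, ?_⟩
    · simp only [smul_apply, inner_smul_right, hB, BoundedContinuousFunction.smul_apply,
        smul_eq_mul]
      rw [integral_const_mul]
    · simp only [smul_apply, hBa]

/-- The difference of the resolvents at `U Ω` is at most the squared distance of `(l + eᵏ)⁻¹` to a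
trigonometric polynomial, because the latter provides a trial vector in the domain of `S_N`. -/
theorem integral_inv_add_exp_sub_le_of_mem {N : VonNeumannAlgebra H} (hNM : N ≤ M)
    (hM : IsCyclicSeparating M Ω) (hN : IsCyclicSeparating N Ω) {τ : ℝ} {U : H →L[ℂ] H}
    (hUM : U ∈ M) (hU : ∀ t : ℝ, |t| ≤ τ → modularFlow M Ω t U ∈ N) {l : ℝ} (hl : 0 < l)
    {G : ℝ → ℂ} (hG : G ∈ trigSpace τ) :
    ∫ k, (l + Real.exp k)⁻¹ ∂(modularMeasure M Ω (U Ω))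
        - ∫ k, (l + Real.exp k)⁻¹ ∂(modularMeasure N Ω (U Ω))
      ≤ ∫ k, (l + Real.exp k) * ‖((l + Real.exp k)⁻¹ : ℝ) - G k‖ ^ 2
          ∂(modularMeasure M Ω (U Ω)) := by
  obtain ⟨g, B, a, rfl, ha, hB, hBa⟩ := exists_apply_eq_of_mem_trigSpace hM hU hG
  have hfin := isFiniteMeasure_modularMeasure hM (U Ω)
  have hp : (a Ω, (star a) Ω) ∈ tomitaGraph N Ω := mem_tomitaGraph ha Ω
  have h1 := le_integral_inv_add_exp hN hl (U Ω) hp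
  have h2 := (exp_modularMeasure hM (tomitaGraph_mono hNM Ω hp)).2
  have hexp := (exp_modularMeasure hM (mem_tomitaGraph hUM Ω)).1
  rw [← hBa, integral_modularMeasure_apply hM hB] at h2
  rw [← hBa, norm_sq_apply hM hB, ← h2, hB] at h1
  set μ := modularMeasure M Ω (U Ω)
  have hgi : Integrable g μ := g.integrable _
  have hg2 : Integrable (fun k => ‖g k‖ ^ 2) μ := by
    refine Integrable.of_bound (g.continuous.norm.pow 2).aestronglyMeasurable (‖g‖ ^ 2)
      (Eventually.of_forall fun k => ?_)
    rw [Real.norm_of_nonneg (by positivity)]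
    exact pow_le_pow_left₀ (norm_nonneg _) (g.norm_coe_le_norm k) 2
  have hge : Integrable (fun k => Real.exp k * ‖g k‖ ^ 2) μ := by
    refine hexp.mul_bdd (c := ‖g‖ ^ 2) (g.continuous.norm.pow 2).aestronglyMeasurable
      (Eventually.of_forall fun k => ?_)
    rw [Real.norm_of_nonneg (by positivity)]
    exact pow_le_pow_left₀ (norm_nonneg _) (g.norm_coe_le_norm k) 2
  have hre : Integrable (fun k => (g k).re) μ := hgi.re
  have hr : Integrable (fun k => (l + Real.exp k)⁻¹) μ := integrable_inv_add_exp hl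
  have e : ∀ k, (l + Real.exp k) * ‖((l + Real.exp k)⁻¹ : ℝ) - g k‖ ^ 2
      = (l + Real.exp k)⁻¹ - 2 * (g k).re + (l * ‖g k‖ ^ 2 + Real.exp k * ‖g k‖ ^ 2) := fun k => by
    have hpos : (0 : ℝ) < l + Real.exp k := by positivity
    have h3 : ‖((l + Real.exp k)⁻¹ : ℝ) - g k‖ ^ 2
        = ((l + Real.exp k)⁻¹) ^ 2 - 2 * ((l + Real.exp k)⁻¹ * (g k).re) + ‖g k‖ ^ 2 := by
      rw [← Complex.normSq_eq_norm_sq, ← Complex.normSq_eq_norm_sq, Complex.normSq_apply,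
        Complex.normSq_apply]
      simp only [Complex.sub_re, Complex.sub_im, Complex.ofReal_re, Complex.ofReal_im]
      ring
    rw [h3]
    field_simp
  have hs1 : Integrable (fun k => (l + Real.exp k)⁻¹ - 2 * (g k).re) μ := hr.sub (hre.const_mul 2)
  have hs2 : Integrable (fun k => l * ‖g k‖ ^ 2 + Real.exp k * ‖g k‖ ^ 2) μ :=
    (hg2.const_mul l).add hge
  simp only [e]
  rw [integral_add hs1 hs2, integral_sub hr (hre.const_mul 2),
    integral_add (hg2.const_mul l) hge, integral_const_mul, integral_const_mul]
  have h5 : (∫ k, g k ∂μ).re = ∫ k, (g k).re ∂μ := (integral_re hgi).symm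
  rw [h5] at h1
  linarith

/-- Extension of the bound to bounded pointwise limits of trigonometric polynomials. -/
theorem integral_inv_add_exp_sub_le {N : VonNeumannAlgebra H} (hNM : N ≤ M)
    (hM : IsCyclicSeparating M Ω) (hN : IsCyclicSeparating N Ω) {τ : ℝ} {U : H →L[ℂ] H}
    (hUM : U ∈ M) (hU : ∀ t : ℝ, |t| ≤ τ → modularFlow M Ω t U ∈ N) {l : ℝ} (hl : 0 < l)
    {G : ℕ → ℝ → ℂ} (hG : ∀ n, G n ∈ trigSpace τ) (hGc : ∀ n, Continuous (G n)) {C : ℝ}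
    (hC : ∀ n k, ‖G n k‖ ≤ C) {g : ℝ → ℂ} (hg : ∀ k, Tendsto (fun n => G n k) atTop (𝓝 (g k))) :
    ∫ k, (l + Real.exp k)⁻¹ ∂(modularMeasure M Ω (U Ω))
        - ∫ k, (l + Real.exp k)⁻¹ ∂(modularMeasure N Ω (U Ω))
      ≤ ∫ k, (l + Real.exp k) * ‖((l + Real.exp k)⁻¹ : ℝ) - g k‖ ^ 2
          ∂(modularMeasure M Ω (U Ω)) := by
  have hfin := isFiniteMeasure_modularMeasure hM (U Ω)
  have hexp := (exp_modularMeasure hM (mem_tomitaGraph hUM Ω)).1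
  refine ge_of_tendsto' (tendsto_integral_of_dominated_convergence
    (fun k => (l + Real.exp k) * (l⁻¹ + C) ^ 2) (fun n => ?_)
    (((integrable_const l).add hexp).mul_const _) (fun n => Eventually.of_forall fun k => ?_)
    (Eventually.of_forall fun k => ?_))
    fun n => integral_inv_add_exp_sub_le_of_mem hNM hM hN hUM hU hl (hG n)
  · have h1 : Measurable (G n) := (hGc n).measurable
    exact Measurable.aestronglyMeasurable (by fun_prop)
  · have hpos : (0 : ℝ) < l + Real.exp k := by positivity
    rw [Real.norm_of_nonneg (by positivity)]
    refine mul_le_mul_of_nonneg_left (pow_le_pow_left₀ (norm_nonneg _) ?_ 2) hpos.le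
    refine (norm_sub_le _ _).trans (add_le_add ?_ (hC n k))
    rw [Complex.norm_real, Real.norm_of_nonneg (by positivity)]
    exact inv_add_exp_le hl k
  · exact (((hg k).const_sub _).norm.pow 2).const_mul _

end Comparison

/-! ### Partial fractions of the Fermi function -/

section FermiFunction

/-- The poles of `1 / (1 + eˣ)` are at `± i fermiPole j`. -/
noncomputable def fermiPole (j : ℕ) : ℝ := (2 * j + 1) * Real.pi

theorem fermiPole_pos (j : ℕ) : 0 < fermiPole j := by
  unfold fermiPole
  positivity

theorem one_le_fermiPole (j : ℕ) : 1 ≤ fermiPole j := by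
  unfold fermiPole
  nlinarith [Real.pi_gt_three, (Nat.cast_nonneg j : (0 : ℝ) ≤ j)]

open Complex in
theorem ofReal_mul_I_mem_integerComplement {y : ℝ} (hy : y ≠ 0) :
    (y : ℂ) * I ∈ Complex.integerComplement := by
  rw [mem_integerComplement_iff]
  rintro ⟨n, hn⟩
  have := congrArg Complex.im hn
  simp at this
  exact hy this.symm

open Complex in
/-- Partial fractions of the Fermi function, from those of the cotangent at `i x / (2 π)` and
`i x / π`. -/
theorem hasSum_fermi (x : ℝ) :
    HasSum (fun j : ℕ => 2 * x / (x ^ 2 + fermiPole j ^ 2)) (1 / 2 - (1 + Real.exp x)⁻¹) := by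
  rcases eq_or_ne x 0 with rfl | hx
  · norm_num
  have hpi := Real.pi_pos
  have hpi' : (Real.pi : ℂ) ≠ 0 := by exact_mod_cast hpi.ne'
  have hx' : (x : ℂ) ≠ 0 := by exact_mod_cast hx
  let z : ℂ := ((x / (2 * Real.pi) : ℝ) : ℂ) * I
  let w : ℂ := ((x / Real.pi : ℝ) : ℂ) * I
  have hwz : w = 2 * z := by
    simp only [w, z]
    push_cast
    field_simp
  have hz : z ∈ Complex.integerComplement := ofReal_mul_I_mem_integerComplement (by positivity)
  have hw : w ∈ Complex.integerComplement := ofReal_mul_I_mem_integerComplement (by positivity)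
  have h1 : HasSum (cotTerm z) (Real.pi * cot (Real.pi * z) - 1 / z) := by
    rw [cot_series_rep' hz]
    exact (summable_cotTerm hz).hasSum
  have h2 : HasSum (cotTerm w) (Real.pi * cot (Real.pi * w) - 1 / w) := by
    rw [cot_series_rep' hw]
    exact (summable_cotTerm hw).hasSum
  have hodd : ∀ j, 2 * cotTerm w (2 * j + 1) = cotTerm z j := fun j => by
    have e1 : w - ((2 * j + 1 : ℕ) + 1) = 2 * (z - (j + 1)) := by
      rw [hwz]; push_cast; ring
    have e2 : w + ((2 * j + 1 : ℕ) + 1) = 2 * (z + (j + 1)) := by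
      rw [hwz]; push_cast; ring
    rw [cotTerm, cotTerm, e1, e2, one_div, one_div, mul_inv, mul_inv, ← mul_add, ← mul_assoc,
      mul_inv_cancel₀ two_ne_zero, one_mul, one_div, one_div]
  have hs : Summable fun j : ℕ => 2 * cotTerm w (2 * j) :=
    ((summable_cotTerm hw).comp_injective (i := fun j : ℕ => 2 * j)
      (fun a b h => by simpa using h)).mul_left 2
  have h3 : HasSum (fun j : ℕ => 2 * cotTerm w (2 * j))
      (2 * (Real.pi * cot (Real.pi * w) - 1 / w) - (Real.pi * cot (Real.pi * z) - 1 / z)) := by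
    have h4 := HasSum.even_add_odd (f := fun j => 2 * cotTerm w j) hs.hasSum
      (by simpa only [hodd] using h1)
    rw [← h4.unique (h2.mul_left 2), add_sub_cancel_right]
    exact hs.hasSum
  have hterm : ∀ j : ℕ, 2 * cotTerm w (2 * j)
      = -(2 * Real.pi * I) * ((2 * x / (x ^ 2 + fermiPole j ^ 2) : ℝ) : ℂ) := fun j => by
    have e1 : w - ((2 * j : ℕ) + 1) ≠ 0 := fun h => by
      have := congrArg Complex.im h
      simp [w] at this
      exact hx this
    have e2 : w + ((2 * j : ℕ) + 1) ≠ 0 := fun h => by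
      have := congrArg Complex.im h
      simp [w] at this
      exact hx this
    have e3 : ((x ^ 2 + fermiPole j ^ 2 : ℝ) : ℂ) ≠ 0 := by
      have : 0 < x ^ 2 + fermiPole j ^ 2 := by have := fermiPole_pos j; positivity
      exact_mod_cast this.ne'
    have e4 : (w - ((2 * j : ℕ) + 1)) * (w + ((2 * j : ℕ) + 1)) * (Real.pi : ℂ) ^ 2
        = -((x ^ 2 + fermiPole j ^ 2 : ℝ) : ℂ) := by
      simp only [w, fermiPole]
      push_cast
      field_simp
      ring_nf
      simp only [I_sq]
      ring
    have e5 : w * (Real.pi : ℂ) = x * I := by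
      simp only [w]
      push_cast
      field_simp
    rw [cotTerm, ofReal_div]
    rw [div_add_div _ _ e1 e2, mul_div_assoc', mul_div_assoc', div_eq_div_iff (mul_ne_zero e1 e2) e3]
    have e6 : ((x ^ 2 + fermiPole j ^ 2 : ℝ) : ℂ)
      = -((w - ((2 * j : ℕ) + 1)) * (w + ((2 * j : ℕ) + 1)) * (Real.pi : ℂ) ^ 2) := by
      rw [e4, neg_neg]
    rw [e6]
    push_cast
    linear_combination (-4 * (w - (2 * j + 1)) * (w + (2 * j + 1)) * Real.pi) * e5
  have hval : 2 * (Real.pi * cot (Real.pi * w) - 1 / w) - (Real.pi * cot (Real.pi * z) - 1 / z)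
      = -(2 * Real.pi * I) * ((1 / 2 - (1 + Real.exp x)⁻¹ : ℝ) : ℂ) := by
    have e1 : 2 * I * (Real.pi * z) = ((-x : ℝ) : ℂ) := by
      simp only [z]
      push_cast
      field_simp
      ring_nf
      simp only [I_sq]
    have e2 : 2 * I * (Real.pi * w) = ((-x : ℝ) : ℂ) + ((-x : ℝ) : ℂ) := by
      rw [hwz]
      linear_combination 2 * e1
    have hz0 : z ≠ 0 := integerComplement.ne_zero hz
    rw [cot_eq_exp_ratio, cot_eq_exp_ratio, e1, e2, Complex.exp_add, ← Complex.ofReal_exp, hwz]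
    have hE : Real.exp x = (Real.exp (-x))⁻¹ := by rw [Real.exp_neg, inv_inv]
    rw [hE]
    have hEpos := Real.exp_pos (-x)
    have hE1 : Real.exp (-x) ≠ 1 := fun h => hx (by simpa using (Real.exp_eq_one_iff _).1 h)
    set E := Real.exp (-x)
    have f1 : (E : ℂ) ≠ 0 := by exact_mod_cast hEpos.ne'
    have f2 : (1 : ℂ) - E ≠ 0 := by
      rw [sub_ne_zero]; exact_mod_cast hE1.symm
    have f3 : (1 : ℂ) + E ≠ 0 := by
      have : (0 : ℝ) < 1 + E := by positivity
      exact_mod_cast this.ne'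
    have f4 : (1 : ℂ) - E * E ≠ 0 := by
      rw [show (1 : ℂ) - E * E = (1 - E) * (1 + E) by ring]
      exact mul_ne_zero f2 f3
    have f5 : (E : ℂ) + 1 ≠ 0 := by rwa [add_comm]
    have f6 : (1 : ℂ) - E * E = (1 - E) * (1 + E) := by ring
    have f7 : (1 : ℝ) / 2 - (1 + E⁻¹)⁻¹ = (1 - E) / (2 * (1 + E)) := by
      have : (0 : ℝ) < 1 + E := by positivity
      field_simp
      ring
    rw [f6, f7]
    push_cast
    have hI := I_ne_zero
    field_simp
    ring_nf
    simp only [I_sq]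
    ring
  have h5 : HasSum (fun j : ℕ => -(2 * Real.pi * I) * ((2 * x / (x ^ 2 + fermiPole j ^ 2) : ℝ) : ℂ))
      (-(2 * Real.pi * I) * ((1 / 2 - (1 + Real.exp x)⁻¹ : ℝ) : ℂ)) := by
    rw [← hval]
    simpa only [hterm] using h3
  have h6 : -(2 * Real.pi * I) ≠ 0 := by simp [hpi.ne']
  exact_mod_cast (hasSum_mul_left_iff h6).1 h5

theorem abs_sum_fermi_sub_le (N : ℕ) (x : ℝ) :
    |(1 / 2 - (1 + Real.exp x)⁻¹) - ∑ j ∈ Finset.range N, 2 * x / (x ^ 2 + fermiPole j ^ 2)|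
      ≤ 1 / 2 := by
  have hpos : 0 < (1 + Real.exp x)⁻¹ := by positivity
  have hlt : (1 + Real.exp x)⁻¹ < 1 := inv_lt_one_of_one_lt₀ (by linarith [Real.exp_pos x])
  have hs := hasSum_fermi x
  rcases le_total 0 x with hx | hx
  · have h0 : ∀ j, 0 ≤ 2 * x / (x ^ 2 + fermiPole j ^ 2) := fun j => by positivity
    have h1 := sum_le_hasSum (Finset.range N) (fun j _ => h0 j) hs
    have h2 := Finset.sum_nonneg (s := Finset.range N) fun j _ => h0 j
    rw [abs_le]
    constructor <;> linarith
  · have h0 : ∀ j, 0 ≤ -(2 * x / (x ^ 2 + fermiPole j ^ 2)) := fun j => by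
      rw [← neg_div]
      exact div_nonneg (by linarith) (by positivity)
    have h1 := sum_le_hasSum (Finset.range N) (fun j _ => h0 j) hs.neg
    have h2 := Finset.sum_nonneg (s := Finset.range N) fun j _ => h0 j
    rw [Finset.sum_neg_distrib] at h1 h2
    rw [abs_le]
    constructor <;> linarith

end FermiFunction

/-! ### Band-limited approximation of the Fermi function -/

section BandLimitedApproximation

/-- The band-limited approximation `1/2 - 2 ∑ⱼ ∫₀^τ e^{-aⱼ t} sin (t x) dt`, `aⱼ = fermiPole j`, of
the Fermi function, with the integrals evaluated. -/
noncomputable def fermiApprox (τ : ℝ) (N : ℕ) (x : ℝ) : ℝ :=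
  1 / 2 - ∑ j ∈ Finset.range N, 2 * ((1 - Complex.exp (-((fermiPole j : ℂ) - x * Complex.I) * τ))
    / ((fermiPole j : ℂ) - x * Complex.I)).im

/-- The approximation of `fermiApprox` in which the integrals are replaced by Riemann sums. -/
noncomputable def fermiRiemann (τ : ℝ) (N n : ℕ) (x : ℝ) : ℝ :=
  1 / 2 - ∑ j ∈ Finset.range N, 2 * (τ / n * ∑ m ∈ Finset.range n,
    Real.exp (-(fermiPole j) * (m * (τ / n))) * Real.sin (m * (τ / n) * x))

theorem le_norm_sub_mul_I (a x : ℝ) : a ≤ ‖(a : ℂ) - x * Complex.I‖ := by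
  have h := Complex.abs_re_le_norm ((a : ℂ) - x * Complex.I)
  simp only [Complex.sub_re, Complex.ofReal_re, Complex.mul_I_re, Complex.ofReal_im, neg_zero,
    sub_zero] at h
  exact (le_abs_self a).trans h

theorem norm_exp_neg_mul (a x τ : ℝ) :
    ‖Complex.exp (-((a : ℂ) - x * Complex.I) * τ)‖ = Real.exp (-(a * τ)) := by
  rw [Complex.norm_exp]
  congr 1
  simp

theorem sum_exp_neg_fermiPole_le {τ : ℝ} (hτ : 1 ≤ τ) (N : ℕ) :
    ∑ j ∈ Finset.range N, Real.exp (-(fermiPole j * τ)) ≤ 2 * Real.exp (-(Real.pi * τ)) := by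
  have hr : Real.exp (-(2 * Real.pi * τ)) ≤ 1 / 2 := by
    have h1 : 1 ≤ 2 * Real.pi * τ := by nlinarith [Real.pi_gt_three]
    have h2 : Real.exp (-(2 * Real.pi * τ)) ≤ Real.exp (-1) := Real.exp_le_exp.2 (by linarith)
    have h3 := Real.exp_neg_one_lt_half
    linarith
  have e : ∀ j : ℕ, Real.exp (-(fermiPole j * τ))
      = Real.exp (-(Real.pi * τ)) * Real.exp (-(2 * Real.pi * τ)) ^ j := fun j => by
    rw [← Real.exp_nat_mul, ← Real.exp_add]
    congr 1
    unfold fermiPole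
    ring
  simp only [e]
  rw [← Finset.mul_sum, mul_comm]
  refine mul_le_mul_of_nonneg_right ?_ (Real.exp_pos _).le
  exact (Finset.sum_le_sum fun j _ => pow_le_pow_left₀ (Real.exp_pos _).le hr j).trans
    (sum_geometric_two_le N)

/-- The error of the band-limited approximation is the remainder of the partial fraction series plus
the contributions of `t > τ`, which are exponentially small. -/
theorem abs_fermi_sub_fermiApprox_le {τ : ℝ} (hτ : 1 ≤ τ) (N : ℕ) (x : ℝ) :
    |(1 + Real.exp x)⁻¹ - fermiApprox τ N x|
      ≤ |(1 / 2 - (1 + Real.exp x)⁻¹)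
          - ∑ j ∈ Finset.range N, 2 * x / (x ^ 2 + fermiPole j ^ 2)|
        + 4 * Real.exp (-(Real.pi * τ)) := by
  let w : ℕ → ℂ := fun j => (fermiPole j : ℂ) - x * Complex.I
  have hw : ∀ j, 1 ≤ ‖w j‖ := fun j => (one_le_fermiPole j).trans (le_norm_sub_mul_I _ _)
  let δ : ℕ → ℝ := fun j => (Complex.exp (-(w j) * τ) / w j).im
  have hδ : ∀ j, |δ j| ≤ Real.exp (-(fermiPole j * τ)) := fun j => by
    refine (Complex.abs_im_le_norm _).trans ?_
    rw [norm_div, norm_exp_neg_mul]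
    exact div_le_self (Real.exp_pos _).le (hw j)
  have hsplit : ∀ j, 2 * ((1 - Complex.exp (-((fermiPole j : ℂ) - x * Complex.I) * τ))
      / ((fermiPole j : ℂ) - x * Complex.I)).im
        = 2 * x / (x ^ 2 + fermiPole j ^ 2) - 2 * δ j := fun j => by
    have h1 : (1 / w j).im = x / (x ^ 2 + fermiPole j ^ 2) := by
      rw [one_div, Complex.inv_im, Complex.normSq_apply]
      simp only [w, Complex.sub_im, Complex.sub_re, Complex.ofReal_re, Complex.ofReal_im,
        Complex.mul_I_im, Complex.mul_I_re]
      ring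
    rw [sub_div, Complex.sub_im]
    change 2 * ((1 / w j).im - δ j) = _
    rw [h1]
    ring
  have h2 : (1 + Real.exp x)⁻¹ - fermiApprox τ N x
      = -((1 / 2 - (1 + Real.exp x)⁻¹)
          - ∑ j ∈ Finset.range N, 2 * x / (x ^ 2 + fermiPole j ^ 2))
        + -(2 * ∑ j ∈ Finset.range N, δ j) := by
    unfold fermiApprox
    simp only [hsplit, Finset.sum_sub_distrib, Finset.mul_sum]
    ring
  rw [h2]
  refine (abs_add_le _ _).trans ?_
  rw [abs_neg, abs_neg, abs_mul, abs_two]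
  have h3 : |∑ j ∈ Finset.range N, δ j| ≤ 2 * Real.exp (-(Real.pi * τ)) :=
    (Finset.abs_sum_le_sum_abs _ _).trans
      ((Finset.sum_le_sum fun j _ => hδ j).trans (sum_exp_neg_fermiPole_le hτ N))
  linarith

theorem tendsto_riemannSum {a : ℝ} (ha : 0 < a) {τ : ℝ} (hτ : 0 < τ) (x : ℝ) :
    Tendsto (fun n : ℕ => τ / n * ∑ m ∈ Finset.range n,
      Real.exp (-a * (m * (τ / n))) * Real.sin (m * (τ / n) * x)) atTop
      (𝓝 ((1 - Complex.exp (-((a : ℂ) - x * Complex.I) * τ)) / ((a : ℂ) - x * Complex.I)).im) := by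
  set w : ℂ := (a : ℂ) - x * Complex.I with hwdef
  have hw : w ≠ 0 := norm_pos_iff.1 (ha.trans_le (le_norm_sub_mul_I a x))
  -- the Riemann sums are the imaginary parts of geometric sums with ratio `exp uₙ`
  let u : ℕ → ℂ := fun n => -w * ((τ / n : ℝ) : ℂ)
  have hu : Tendsto u atTop (𝓝 0) := by
    have h1 : Tendsto (fun n : ℕ => ((τ / n : ℝ) : ℂ)) atTop (𝓝 ((0 : ℝ) : ℂ)) :=
      (Complex.continuous_ofReal.tendsto _).comp (tendsto_const_div_atTop_nhds_zero_nat τ)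
    simpa [u] using h1.const_mul (-w)
  have hu0 : ∀ᶠ n in atTop, u n ≠ 0 := by
    filter_upwards [eventually_gt_atTop 0] with n hn
    have : (0 : ℝ) < τ / n := div_pos hτ (by exact_mod_cast hn)
    exact mul_ne_zero (neg_ne_zero.2 hw) (by exact_mod_cast this.ne')
  have hslope : Tendsto (fun n => (Complex.exp (u n) - 1) / u n) atTop (𝓝 1) := by
    have h1 := (Complex.hasDerivAt_exp 0).tendsto_slope
    rw [Complex.exp_zero] at h1
    have h2 : Tendsto u atTop (𝓝[≠] 0) := tendsto_nhdsWithin_iff.2 ⟨hu, hu0⟩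
    refine (h1.comp h2).congr fun n => ?_
    simp [slope_def_field]
  have hlim : Tendsto (fun n => ((1 - Complex.exp (-w * τ)) / w) * ((Complex.exp (u n) - 1) / u n)⁻¹)
      atTop (𝓝 ((1 - Complex.exp (-w * τ)) / w)) := by
    have := (hslope.inv₀ one_ne_zero).const_mul ((1 - Complex.exp (-w * τ)) / w)
    simpa using this
  refine ((Complex.continuous_im.tendsto _).comp hlim).congr' ?_
  filter_upwards [hu0, eventually_gt_atTop 0] with n hn0 hn
  have hn' : (n : ℝ) ≠ 0 := by exact_mod_cast hn.ne'
  have hpos : (0 : ℝ) < τ / n := div_pos hτ (by exact_mod_cast hn)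
  have hq : Complex.exp (u n) ≠ 1 := fun h => by
    have h1 := congrArg norm h
    rw [norm_exp_neg_mul, norm_one, Real.exp_eq_one_iff] at h1
    have := mul_pos ha hpos
    linarith
  have hpow : Complex.exp (u n) ^ n = Complex.exp (-w * τ) := by
    rw [← Complex.exp_nat_mul]
    congr 1
    simp only [u]
    push_cast
    have : (n : ℂ) ≠ 0 := by exact_mod_cast hn.ne'
    field_simp
  have hgeom : ((1 - Complex.exp (-w * τ)) / w) * ((Complex.exp (u n) - 1) / u n)⁻¹
      = ((τ / n : ℝ) : ℂ) * ∑ m ∈ Finset.range n, Complex.exp (u n) ^ m := by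
    rw [geom_sum_eq hq, hpow]
    have h1 : Complex.exp (u n) - 1 ≠ 0 := sub_ne_zero.2 hq
    have h2 : u n = -w * ((τ / n : ℝ) : ℂ) := rfl
    rw [inv_div, div_mul_div_comm, mul_div_assoc', div_eq_div_iff (mul_ne_zero hw h1) h1]
    generalize Complex.exp (u n) = q at *
    rw [h2]
    ring
  rw [Function.comp_apply, hgeom, Complex.im_ofReal_mul, Complex.im_sum]
  congr 1
  refine Finset.sum_congr rfl fun m _ => ?_
  rw [← Complex.exp_nat_mul, Complex.exp_im]
  have h3 : (m : ℂ) * u n = ((-a * (m * (τ / n)) : ℝ) : ℂ) + ((m * (τ / n) * x : ℝ) : ℂ) * Complex.I := by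
    simp only [u, hwdef]
    push_cast
    ring
  rw [h3]
  simp

theorem tendsto_fermiRiemann {τ : ℝ} (hτ : 0 < τ) (N : ℕ) (x : ℝ) :
    Tendsto (fun n => fermiRiemann τ N n x) atTop (𝓝 (fermiApprox τ N x)) :=
  (tendsto_finsetSum _ fun j _ =>
    (tendsto_riemannSum (fermiPole_pos j) hτ x).const_mul 2).const_sub _

theorem abs_fermiRiemann_le {τ : ℝ} (hτ : 0 < τ) (N n : ℕ) (x : ℝ) :
    |fermiRiemann τ N n x| ≤ 1 / 2 + N * (2 * τ) := by
  unfold fermiRiemann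
  refine (abs_sub _ _).trans (add_le_add (by norm_num) ?_)
  refine (Finset.abs_sum_le_sum_abs _ _).trans ?_
  have h1 : ∀ j ∈ Finset.range N, |2 * (τ / n * ∑ m ∈ Finset.range n,
      Real.exp (-(fermiPole j) * (m * (τ / n))) * Real.sin (m * (τ / n) * x))| ≤ 2 * τ := by
    intro j _
    have h2 : |∑ m ∈ Finset.range n,
        Real.exp (-(fermiPole j) * (m * (τ / n))) * Real.sin (m * (τ / n) * x)| ≤ n := by
      refine (Finset.abs_sum_le_sum_abs _ _).trans ?_
      have h3 : ∀ m ∈ Finset.range n,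
          |Real.exp (-(fermiPole j) * (m * (τ / n))) * Real.sin (m * (τ / n) * x)| ≤ 1 := by
        intro m _
        rw [abs_mul, Real.abs_exp]
        have hp := fermiPole_pos j
        refine mul_le_one₀ ?_ (abs_nonneg _) (Real.abs_sin_le_one _)
        rw [Real.exp_le_one_iff, neg_mul, neg_nonpos]
        positivity
      simpa using Finset.sum_le_card_nsmul _ _ _ h3
    rw [abs_mul, abs_mul, abs_two, abs_of_nonneg (by positivity : 0 ≤ τ / n)]
    refine mul_le_mul_of_nonneg_left ?_ zero_le_two
    refine (mul_le_mul_of_nonneg_left h2 (by positivity)).trans ?_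
    rcases Nat.eq_zero_or_pos n with rfl | hn
    · simpa using hτ.le
    · rw [div_mul_cancel₀ _ (by exact_mod_cast hn.ne')]
  simpa using Finset.sum_le_card_nsmul _ _ _ h1

theorem continuous_fermiRiemann (τ : ℝ) (N n : ℕ) : Continuous (fermiRiemann τ N n) := by
  unfold fermiRiemann
  fun_prop

theorem one_mem_trigSpace {τ : ℝ} (hτ : 0 ≤ τ) : (fun _ => 1 : ℝ → ℂ) ∈ trigSpace τ := by
  have h := expChar_mem_trigSpace (τ := τ) (t := 0) (by simpa using hτ)
  convert h using 1
  funext k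
  simp [expChar_apply]

theorem sin_mem_trigSpace {τ t : ℝ} (ht : |t| ≤ τ) (r : ℝ) :
    (fun k => ((Real.sin (t * (k - r)) : ℝ) : ℂ)) ∈ trigSpace τ := by
  have h1 := Submodule.smul_mem _ (Complex.exp (((t * r : ℝ) : ℂ) * Complex.I) * Complex.I / 2)
    (expChar_mem_trigSpace (τ := τ) (t := -t) (by rwa [abs_neg]))
  have h2 := Submodule.smul_mem _ (Complex.exp (((-(t * r) : ℝ) : ℂ) * Complex.I) * Complex.I / 2)
    (expChar_mem_trigSpace ht)
  convert Submodule.sub_mem _ h1 h2 using 1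
  funext k
  simp only [Pi.sub_apply, Pi.smul_apply, smul_eq_mul, expChar_apply]
  have e : ∀ a b : ℂ, Complex.exp a * Complex.I / 2 * Complex.exp b
      = Complex.exp (a + b) * Complex.I / 2 := fun a b => by
    rw [Complex.exp_add]
    ring
  rw [e, e, Complex.ofReal_sin, Complex.sin]
  have e1 : ((t * r : ℝ) : ℂ) * Complex.I + ((-t * k : ℝ) : ℂ) * Complex.I
      = -((t * (k - r) : ℝ) : ℂ) * Complex.I := by push_cast; ring
  have e2 : ((-(t * r) : ℝ) : ℂ) * Complex.I + ((t * k : ℝ) : ℂ) * Complex.I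
      = ((t * (k - r) : ℝ) : ℂ) * Complex.I := by push_cast; ring
  rw [e1, e2]
  ring

theorem fermiRiemann_mem_trigSpace {τ : ℝ} (hτ : 0 < τ) (N n : ℕ) (r : ℝ) :
    (fun k => ((fermiRiemann τ N n (k - r) : ℝ) : ℂ)) ∈ trigSpace τ := by
  have h1 : (fun k => ((fermiRiemann τ N n (k - r) : ℝ) : ℂ))
      = (1 / 2 : ℂ) • (fun _ => 1 : ℝ → ℂ) - ∑ j ∈ Finset.range N, ∑ m ∈ Finset.range n,
        ((2 * (τ / n * Real.exp (-(fermiPole j) * (m * (τ / n)))) : ℝ) : ℂ) •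
          fun k : ℝ => ((Real.sin (m * (τ / n) * (k - r)) : ℝ) : ℂ) := by
    funext k
    simp only [fermiRiemann, Pi.sub_apply, Pi.smul_apply, Finset.sum_apply, smul_eq_mul,
      Complex.ofReal_sub, Complex.ofReal_sum, Complex.ofReal_mul, Finset.mul_sum]
    push_cast
    simp only [mul_one, mul_assoc]
  rw [h1]
  refine Submodule.sub_mem _ (Submodule.smul_mem _ _ (one_mem_trigSpace hτ.le))
    (Submodule.sum_mem _ fun j _ => Submodule.sum_mem _ fun m hm =>
      Submodule.smul_mem _ _ (sin_mem_trigSpace ?_ r))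
  have hm' : (m : ℝ) ≤ n := by exact_mod_cast (Finset.mem_range.1 hm).le
  rw [abs_of_nonneg (by positivity), mul_div_assoc']
  exact div_le_of_le_mul₀ (by positivity) hτ.le (by rw [mul_comm]; exact mul_le_mul_of_nonneg_left hm' hτ.le)

end BandLimitedApproximation

/-! ### Bounds on the difference of the resolvents -/

section ResolventBounds

variable {H : Type u} [NormedAddCommGroup H] [InnerProductSpace ℂ H] [CompleteSpace H]
variable {M N : VonNeumannAlgebra H} {Ω : H}

theorem inv_add_exp_eq {l : ℝ} (hl : 0 < l) (k : ℝ) :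
    (l + Real.exp k)⁻¹ = l⁻¹ * (1 + Real.exp (k - Real.log l))⁻¹ := by
  rw [Real.exp_sub, Real.exp_log hl, ← mul_inv]
  congr 1
  field_simp

/-- For intermediate `l`, the resolvents at `U Ω` differ by an amount of order `e^{-2πτ}`. -/
theorem integral_inv_add_exp_sub_le_exp (hNM : N ≤ M)
    (hM : IsCyclicSeparating M Ω) (hN : IsCyclicSeparating N Ω) {τ : ℝ} (hτ : 1 ≤ τ)
    {U : H →L[ℂ] H} (hUM : U ∈ M) (hU : ∀ t : ℝ, |t| ≤ τ → modularFlow M Ω t U ∈ N)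
    {l : ℝ} (hl : 0 < l) :
    ∫ k, (l + Real.exp k)⁻¹ ∂(modularMeasure M Ω (U Ω))
        - ∫ k, (l + Real.exp k)⁻¹ ∂(modularMeasure N Ω (U Ω))
      ≤ (4 * Real.exp (-(Real.pi * τ))) ^ 2 * (l⁻¹ ^ 2
        * ∫ k, (l + Real.exp k) ∂(modularMeasure M Ω (U Ω))) := by
  have hfin := isFiniteMeasure_modularMeasure hM (U Ω)
  have hexp := (exp_modularMeasure hM (mem_tomitaGraph hUM Ω)).1
  have hτ0 : 0 < τ := by linarith
  set μ := modularMeasure M Ω (U Ω)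
  set ε := 4 * Real.exp (-(Real.pi * τ)) with hε
  have hε0 : 0 ≤ ε := by positivity
  set r := Real.log l
  let ρ : ℕ → ℝ → ℝ := fun n k => |(1 / 2 - (1 + Real.exp (k - r))⁻¹)
    - ∑ j ∈ Finset.range n, 2 * (k - r) / ((k - r) ^ 2 + fermiPole j ^ 2)|
  have hρ : ∀ k, Tendsto (fun n => ρ n k) atTop (𝓝 0) := fun k => by
    have := ((hasSum_fermi (k - r)).tendsto_sum_nat.const_sub
      (1 / 2 - (1 + Real.exp (k - r))⁻¹)).abs
    rwa [sub_self, abs_zero] at this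
  have hρm : ∀ n, Measurable (ρ n) := fun n => by fun_prop
  have hρ1 : ∀ n k, ρ n k ≤ 1 / 2 := fun n k => abs_sum_fermi_sub_le n (k - r)
  have hρ0 : ∀ n k, 0 ≤ ρ n k := fun n k => abs_nonneg _
  have hdom : ∀ n k, (l + Real.exp k) * (l⁻¹ * (ρ n k + ε)) ^ 2
      ≤ (l + Real.exp k) * (l⁻¹ * (1 / 2 + ε)) ^ 2 := fun n k => by
    have := hρ0 n k
    have := hρ1 n k
    gcongr
  have hdomi : Integrable (fun k => (l + Real.exp k) * (l⁻¹ * (1 / 2 + ε)) ^ 2) μ :=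
    ((integrable_const l).add hexp).mul_const _
  have hmeas : ∀ n, AEStronglyMeasurable
      (fun k => (l + Real.exp k) * (l⁻¹ * (ρ n k + ε)) ^ 2) μ := fun n => by
    have := hρm n
    exact Measurable.aestronglyMeasurable (by fun_prop)
  have hnn : ∀ n k, 0 ≤ (l + Real.exp k) * (l⁻¹ * (ρ n k + ε)) ^ 2 := fun n k => by positivity
  have hstep : ∀ n : ℕ, ∫ k, (l + Real.exp k)⁻¹ ∂μ - ∫ k, (l + Real.exp k)⁻¹ ∂(modularMeasure N Ω (U Ω))
      ≤ ∫ k, (l + Real.exp k) * (l⁻¹ * (ρ n k + ε)) ^ 2 ∂μ := fun n => by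
    refine (integral_inv_add_exp_sub_le hNM hM hN hUM hU hl
      (G := fun m k => (l⁻¹ : ℂ) * ((fermiRiemann τ n m (k - r) : ℝ) : ℂ))
      (g := fun k => (l⁻¹ : ℂ) * ((fermiApprox τ n (k - r) : ℝ) : ℂ))
      (C := l⁻¹ * (1 / 2 + n * (2 * τ)))
      (fun m => Submodule.smul_mem _ (l⁻¹ : ℂ) (fermiRiemann_mem_trigSpace hτ0 n m r))
      (fun m => ?_) (fun m k => ?_) (fun k => ?_)).trans ?_
    · have := continuous_fermiRiemann τ n m
      fun_prop
    · rw [norm_mul, norm_inv, Complex.norm_real, Complex.norm_real, Real.norm_of_nonneg hl.le]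
      exact mul_le_mul_of_nonneg_left (abs_fermiRiemann_le hτ0 n m _) (by positivity)
    · exact ((Complex.continuous_ofReal.tendsto _).comp
        (tendsto_fermiRiemann hτ0 n (k - r))).const_mul _
    · refine integral_mono_of_nonneg (Eventually.of_forall fun k => ?_)
        (hdomi.mono' (hmeas n) (Eventually.of_forall fun k => ?_))
        (Eventually.of_forall fun k => ?_)
      · simp only [Pi.zero_apply]
        positivity
      · rw [Real.norm_of_nonneg (hnn n k)]
        exact hdom n k
      · simp only
        have h1 : ‖(((l + Real.exp k)⁻¹ : ℝ) : ℂ) - (l⁻¹ : ℂ) * ((fermiApprox τ n (k - r) : ℝ) : ℂ)‖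
            = l⁻¹ * |(1 + Real.exp (k - r))⁻¹ - fermiApprox τ n (k - r)| := by
          rw [inv_add_exp_eq hl, ← Complex.ofReal_inv, ← Complex.ofReal_mul, ← Complex.ofReal_sub,
            Complex.norm_real, ← mul_sub, norm_mul, Real.norm_of_nonneg (by positivity)]
          rfl
        rw [h1]
        have h2 := abs_fermi_sub_fermiApprox_le hτ n (k - r)
        gcongr
  have hlim : Tendsto (fun n => ∫ k, (l + Real.exp k) * (l⁻¹ * (ρ n k + ε)) ^ 2 ∂μ) atTop
      (𝓝 (∫ k, (l + Real.exp k) * (l⁻¹ * (0 + ε)) ^ 2 ∂μ)) := by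
    refine tendsto_integral_of_dominated_convergence _ hmeas hdomi
      (fun n => Eventually.of_forall fun k => ?_) (Eventually.of_forall fun k => ?_)
    · rw [Real.norm_of_nonneg (hnn n k)]
      exact hdom n k
    · exact ((((hρ k).add_const ε).const_mul l⁻¹).pow 2).const_mul _
  refine (ge_of_tendsto' hlim hstep).trans (le_of_eq ?_)
  rw [integral_mul_const]
  ring

/-- For large `l`, the constant `l⁻¹` is a good enough trial function. -/
theorem integral_inv_add_exp_sub_le_of_large (hNM : N ≤ M)
    (hM : IsCyclicSeparating M Ω) (hN : IsCyclicSeparating N Ω) {τ : ℝ} (hτ : 0 ≤ τ)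
    {U : H →L[ℂ] H} (hUM : U ∈ M) (hU : ∀ t : ℝ, |t| ≤ τ → modularFlow M Ω t U ∈ N)
    {l : ℝ} (hl : 0 < l) :
    ∫ k, (l + Real.exp k)⁻¹ ∂(modularMeasure M Ω (U Ω))
        - ∫ k, (l + Real.exp k)⁻¹ ∂(modularMeasure N Ω (U Ω))
      ≤ l⁻¹ ^ 2 * ∫ k, Real.exp k ∂(modularMeasure M Ω (U Ω)) := by
  have hexp := (exp_modularMeasure hM (mem_tomitaGraph hUM Ω)).1
  refine (integral_inv_add_exp_sub_le_of_mem hNM hM hN hUM hU hl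
    (Submodule.smul_mem _ (l⁻¹ : ℂ) (one_mem_trigSpace hτ))).trans ?_
  rw [← integral_const_mul]
  refine integral_mono_of_nonneg (Eventually.of_forall fun k => ?_) (hexp.const_mul _)
    (Eventually.of_forall fun k => ?_)
  · simp only [Pi.zero_apply]
    positivity
  · simp only [Pi.smul_apply, smul_eq_mul, mul_one]
    rw [← Complex.ofReal_inv, ← Complex.ofReal_sub, Complex.norm_real, Real.norm_eq_abs, sq_abs]
    have hk := Real.exp_pos k
    have h1 : (l + Real.exp k) * ((l + Real.exp k)⁻¹ - l⁻¹) ^ 2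
        = l⁻¹ ^ 2 * (Real.exp k * (Real.exp k / (l + Real.exp k))) := by
      field_simp
      ring
    rw [h1]
    refine mul_le_mul_of_nonneg_left (mul_le_of_le_one_right hk.le ?_) (by positivity)
    exact (div_le_one (by positivity)).2 (by linarith)

end ResolventBounds

/-! ### The logarithm as an integral over resolvents -/

section LogarithmFormula

theorem hasDerivAt_log_sub_log {l k : ℝ} (hl : 0 ≤ l) :
    HasDerivAt (fun l => Real.log (1 + l) - Real.log (l + Real.exp k))
      ((1 + l)⁻¹ - (l + Real.exp k)⁻¹) l := by
  have hk := Real.exp_pos k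
  have h1 : HasDerivAt (fun l : ℝ => 1 + l) 1 l := (hasDerivAt_id l).const_add 1
  have h2 : HasDerivAt (fun l : ℝ => l + Real.exp k) 1 l := (hasDerivAt_id l).add_const _
  have h3 := (h1.log (by positivity)).sub (h2.log (by positivity))
  simp only [one_div] at h3
  exact h3

theorem tendsto_log_sub_log (k : ℝ) :
    Tendsto (fun l => Real.log (1 + l) - Real.log (l + Real.exp k)) atTop (𝓝 0) := by
  have hk := Real.exp_pos k
  have h1 : Tendsto (fun l : ℝ => (l + Real.exp k)⁻¹) atTop (𝓝 0) :=
    tendsto_inv_atTop_zero.comp (tendsto_atTop_add_const_right _ _ tendsto_id)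
  have h2 : Tendsto (fun l : ℝ => 1 + (1 - Real.exp k) * (l + Real.exp k)⁻¹) atTop (𝓝 1) := by
    simpa using (h1.const_mul (1 - Real.exp k)).const_add 1
  have h3 := (Real.continuousAt_log one_ne_zero).tendsto.comp h2
  rw [Real.log_one] at h3
  refine h3.congr' ?_
  filter_upwards [eventually_gt_atTop 0] with l hl
  rw [Function.comp_apply, ← Real.log_div (by positivity) (by positivity)]
  congr 1
  field_simp
  ring

theorem integrableOn_inv_sub_inv (k : ℝ) :
    IntegrableOn (fun l : ℝ => (1 + l)⁻¹ - (l + Real.exp k)⁻¹) (Ioi 0) := by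
  have hk := Real.exp_pos k
  rcases le_total 0 k with h | h
  · refine integrableOn_Ioi_deriv_of_nonneg' (fun l hl => hasDerivAt_log_sub_log hl)
      (fun l hl => sub_nonneg.2 (inv_anti₀ ?_ ?_)) (tendsto_log_sub_log k)
    · linarith [mem_Ioi.1 hl]
    · linarith [Real.one_le_exp h]
  · refine integrableOn_Ioi_deriv_of_nonpos' (fun l hl => hasDerivAt_log_sub_log hl)
      (fun l hl => sub_nonpos.2 (inv_anti₀ ?_ ?_)) (tendsto_log_sub_log k)
    · linarith [mem_Ioi.1 hl]
    · linarith [Real.exp_le_one_iff.2 h]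

theorem integral_inv_sub_inv (k : ℝ) :
    ∫ l in Ioi (0 : ℝ), ((1 + l)⁻¹ - (l + Real.exp k)⁻¹) = k := by
  rw [integral_Ioi_of_hasDerivAt_of_tendsto' (fun l hl => hasDerivAt_log_sub_log hl)
    (integrableOn_inv_sub_inv k) (tendsto_log_sub_log k)]
  simp

theorem integral_norm_inv_sub_inv (k : ℝ) :
    ∫ l in Ioi (0 : ℝ), ‖(1 + l)⁻¹ - (l + Real.exp k)⁻¹‖ = |k| := by
  have hk := Real.exp_pos k
  rcases le_total 0 k with h | h
  · rw [abs_of_nonneg h, ← integral_inv_sub_inv k]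
    refine (setIntegral_congr_fun measurableSet_Ioi fun l hl => ?_)
    simp only [integral_inv_sub_inv]
    refine Real.norm_of_nonneg (sub_nonneg.2 (inv_anti₀ ?_ ?_))
    · linarith [mem_Ioi.1 hl]
    · linarith [Real.one_le_exp h]
  · rw [abs_of_nonpos h, ← integral_inv_sub_inv k, ← integral_neg]
    refine (setIntegral_congr_fun measurableSet_Ioi fun l hl => ?_)
    simp only [integral_inv_sub_inv]
    refine Real.norm_of_nonpos (sub_nonpos.2 (inv_anti₀ ?_ ?_))
    · linarith [mem_Ioi.1 hl]
    · linarith [Real.exp_le_one_iff.2 h]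

variable {μ : Measure ℝ}

/-- The logarithm as an integral over resolvents, for a probability measure. -/
theorem integral_eq_integral_resolvent [IsFiniteMeasure μ] (h1 : ∫ _, (1 : ℝ) ∂μ = 1)
    (hk : Integrable (fun k => k) μ) :
    IntegrableOn (fun l : ℝ => (1 + l)⁻¹ - ∫ k, (l + Real.exp k)⁻¹ ∂μ) (Ioi 0) ∧
      ∫ l in Ioi (0 : ℝ), ((1 + l)⁻¹ - ∫ k, (l + Real.exp k)⁻¹ ∂μ) = ∫ k, k ∂μ := by
  have hint : Integrable (fun p : ℝ × ℝ => (1 + p.1)⁻¹ - (p.1 + Real.exp p.2)⁻¹)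
      ((volume.restrict (Ioi 0)).prod μ) := by
    rw [integrable_prod_iff' (Measurable.aestronglyMeasurable (by fun_prop))]
    refine ⟨Eventually.of_forall fun k => integrableOn_inv_sub_inv k, ?_⟩
    simp only [integral_norm_inv_sub_inv]
    exact hk.abs
  have e : ∀ l ∈ Ioi (0 : ℝ), ∫ k, ((1 + l)⁻¹ - (l + Real.exp k)⁻¹) ∂μ
      = (1 + l)⁻¹ - ∫ k, (l + Real.exp k)⁻¹ ∂μ := fun l hl => by
    have h2 : ∫ _, (1 + l)⁻¹ ∂μ = (1 + l)⁻¹ := by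
      rw [show (fun _ : ℝ => (1 + l)⁻¹) = fun _ => (1 + l)⁻¹ * 1 by simp, integral_const_mul, h1,
        mul_one]
    rw [integral_sub (integrable_const _) (integrable_inv_add_exp hl), h2]
  constructor
  · exact (integrableOn_congr_fun e measurableSet_Ioi).1 hint.integral_prod_left
  · rw [← setIntegral_congr_fun measurableSet_Ioi e, integral_integral_swap hint]
    simp only [integral_inv_sub_inv]

theorem lintegral_inv_add_exp {δ : ℝ} (hδ : 0 ≤ δ) (k : ℝ) :
    ∫⁻ l in Ioc 0 δ, ENNReal.ofReal ((l + Real.exp k)⁻¹)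
      = ENNReal.ofReal (Real.log (1 + δ * Real.exp (-k))) := by
  have hk := Real.exp_pos k
  have hc : ContinuousOn (fun l : ℝ => (l + Real.exp k)⁻¹) (uIcc 0 δ) := by
    rw [uIcc_of_le hδ]
    exact ContinuousOn.inv₀ (by fun_prop) fun l hl => by linarith [hl.1]
  have h1 : ∫ l in (0 : ℝ)..δ, (l + Real.exp k)⁻¹ = Real.log (1 + δ * Real.exp (-k)) := by
    have hd : ∀ l ∈ uIcc 0 δ, HasDerivAt (fun l => Real.log (l + Real.exp k)) ((l + Real.exp k)⁻¹) l := by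
      intro l hl
      rw [uIcc_of_le hδ] at hl
      have h2 : HasDerivAt (fun l : ℝ => l + Real.exp k) 1 l := (hasDerivAt_id l).add_const _
      simpa [one_div] using h2.log (by linarith [hl.1])
    rw [intervalIntegral.integral_eq_sub_of_hasDerivAt hd hc.intervalIntegrable,
      ← Real.log_div (by positivity) (by positivity), Real.exp_neg]
    congr 1
    field_simp
    ring
  rw [← h1, intervalIntegral.integral_of_le hδ, ofReal_integral_eq_lintegral_ofReal
    ((intervalIntegrable_iff_integrableOn_Ioc_of_le hδ).1 hc.intervalIntegrable)]
  filter_upwards [ae_restrict_mem measurableSet_Ioc] with l hl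
  have := hl.1
  simp only [Pi.zero_apply]
  positivity

theorem lintegral_log_one_add [IsFiniteMeasure μ] {δ : ℝ} (hδ : 0 ≤ δ) :
    ∫⁻ k, ENNReal.ofReal (Real.log (1 + δ * Real.exp (-k))) ∂μ
      = ∫⁻ l in Ioc 0 δ, ENNReal.ofReal (∫ k, (l + Real.exp k)⁻¹ ∂μ) := by
  simp only [← lintegral_inv_add_exp hδ]
  rw [lintegral_lintegral_swap (Measurable.aemeasurable (by fun_prop))]
  refine setLIntegral_congr_fun measurableSet_Ioc fun l hl => ?_
  have := hl.1
  exact (ofReal_integral_eq_lintegral_ofReal (integrable_inv_add_exp hl.1)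
    (Eventually.of_forall fun k => by positivity)).symm

theorem integrable_log_one_add [IsFiniteMeasure μ] (hk : Integrable (fun k => k) μ) {δ : ℝ}
    (hδ : 0 ≤ δ) (hδ1 : δ ≤ 1) : Integrable (fun k => Real.log (1 + δ * Real.exp (-k))) μ := by
  refine Integrable.mono' ((integrable_const (1 : ℝ)).add hk.abs)
    (Measurable.aestronglyMeasurable (by fun_prop)) (Eventually.of_forall fun k => ?_)
  have h0 : 0 ≤ δ * Real.exp (-k) := by positivity
  rw [Real.norm_of_nonneg (Real.log_nonneg (by linarith))]
  have h1 : 1 + δ * Real.exp (-k) ≤ Real.exp (1 + |k|) := by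
    have h2 : δ * Real.exp (-k) ≤ Real.exp |k| :=
      (mul_le_of_le_one_left (Real.exp_pos _).le hδ1).trans (Real.exp_le_exp.2 (neg_le_abs k))
    have h3 : 1 ≤ Real.exp |k| := Real.one_le_exp (abs_nonneg k)
    have h4 : 2 ≤ Real.exp 1 := by linarith [Real.add_one_le_exp 1]
    rw [Real.exp_add]
    nlinarith
  calc Real.log (1 + δ * Real.exp (-k)) ≤ Real.log (Real.exp (1 + |k|)) :=
        Real.log_le_log (by linarith) h1
    _ = 1 + |k| := Real.log_exp _

end LogarithmFormula

/-! ### Estimate of the difference of the expectation values -/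

section Estimate

variable {H : Type u} [NormedAddCommGroup H] [InnerProductSpace ℂ H] [CompleteSpace H]
variable {M N : VonNeumannAlgebra H} {Ω : H}

theorem norm_apply_of_mem_unitary {U : H →L[ℂ] H} (hU : U ∈ unitary (H →L[ℂ] H)) (x : H) :
    ‖U x‖ = ‖x‖ := by
  have h : (star U * U) x = x := by rw [(Unitary.mem_iff.1 hU).1]; rfl
  rw [ContinuousLinearMap.star_eq_adjoint, mul_apply_eq_comp] at h
  have h2 : ⟪U x, U x⟫ = ⟪x, x⟫ := by
    rw [← ContinuousLinearMap.adjoint_inner_right, h]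
  rw [inner_self_eq_norm_sq_to_K, inner_self_eq_norm_sq_to_K] at h2
  have h3 : ‖U x‖ ^ 2 = ‖x‖ ^ 2 := by exact_mod_cast h2
  exact (pow_left_inj₀ (norm_nonneg _) (norm_nonneg _) two_ne_zero).1 h3

/-- Both `⟨UΩ, UΩ⟩` and `⟨UΩ, Δ UΩ⟩ = ‖U* Ω‖²` equal `1`. -/
theorem modularMeasure_unitary (h : IsCyclicSeparating M Ω) (hΩ : ‖Ω‖ = 1) {U : H →L[ℂ] H}
    (hUM : U ∈ M) (hU : U ∈ unitary (H →L[ℂ] H)) :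
    ∫ _, (1 : ℝ) ∂(modularMeasure M Ω (U Ω)) = 1 ∧
      Integrable Real.exp (modularMeasure M Ω (U Ω)) ∧
      ∫ k, Real.exp k ∂(modularMeasure M Ω (U Ω)) = 1 := by
  obtain ⟨h1, h2⟩ := exp_modularMeasure h (mem_tomitaGraph hUM Ω)
  refine ⟨?_, h1, ?_⟩
  · rw [integral_one_modularMeasure h, norm_apply_of_mem_unitary hU, hΩ, one_pow]
  · rw [h2, norm_apply_of_mem_unitary (Unitary.star_mem hU), hΩ, one_pow]


theorem neg_le_log_one_add_exp_neg (k : ℝ) : -k ≤ Real.log (1 + Real.exp (-k)) := by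
  rw [Real.le_log_iff_exp_le (by positivity)]
  linarith

/-- Integrability of `log Δ` passes from the larger to the smaller algebra: `log (1 + e⁻ᵏ)` is an
integral of resolvents, which are monotone in the algebra. -/
theorem integrable_modularMeasure_of_le (hNM : N ≤ M)
    (hM : IsCyclicSeparating M Ω) (hN : IsCyclicSeparating N Ω) {U : H →L[ℂ] H} (hUN : U ∈ N)
    (hk : Integrable (fun k => k) (modularMeasure M Ω (U Ω))) :
    Integrable (fun k => k) (modularMeasure N Ω (U Ω)) := by
  have := isFiniteMeasure_modularMeasure hM (U Ω)
  have := isFiniteMeasure_modularMeasure hN (U Ω)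
  have hexp := (exp_modularMeasure hN (mem_tomitaGraph hUN Ω)).1
  have h1 := integrable_log_one_add hk zero_le_one le_rfl
  have hnn : ∀ k : ℝ, 0 ≤ Real.log (1 + 1 * Real.exp (-k)) := fun k =>
    Real.log_nonneg (by linarith [Real.exp_pos (-k)])
  have h2 : Integrable (fun k => Real.log (1 + 1 * Real.exp (-k))) (modularMeasure N Ω (U Ω)) := by
    refine ⟨Measurable.aestronglyMeasurable (by fun_prop), ?_⟩
    have h3 := h1.2
    rw [hasFiniteIntegral_iff_ofReal (Eventually.of_forall hnn),
      lintegral_log_one_add zero_le_one] at h3 ⊢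
    refine lt_of_le_of_lt (setLIntegral_mono' measurableSet_Ioc fun l hl => ?_) h3
    exact ENNReal.ofReal_le_ofReal (integral_inv_add_exp_mono hNM hM hN hl.1 (U Ω))
  refine Integrable.mono' (h2.add hexp) measurable_id.aestronglyMeasurable
    (Eventually.of_forall fun k => ?_)
  have h3 := neg_le_log_one_add_exp_neg k
  have h4 := Real.add_one_le_exp k
  have h5 := hnn k
  have h6 := Real.exp_pos k
  simp only [one_mul, Pi.add_apply] at h5 ⊢
  rw [Real.norm_eq_abs, abs_le]
  constructor <;> linarith

theorem integral_inv_add_inv_sq {S : ℝ} (hS : 0 ≤ S) :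
    IntegrableOn (fun l : ℝ => l⁻¹ ^ 2 * (l + 1)) (Ioc (Real.exp (-S)) (Real.exp S)) ∧
      ∫ l in Ioc (Real.exp (-S)) (Real.exp S), l⁻¹ ^ 2 * (l + 1)
        ≤ 2 * S + Real.exp S := by
  have h1 := Real.exp_pos (-S)
  have h2 := Real.exp_pos S
  have hle : Real.exp (-S) ≤ Real.exp S := Real.exp_le_exp.2 (by linarith)
  have hpos : ∀ l ∈ uIcc (Real.exp (-S)) (Real.exp S), 0 < l := fun l hl => by
    rw [uIcc_of_le hle] at hl
    linarith [hl.1]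
  have hc : ContinuousOn (fun l : ℝ => l⁻¹ ^ 2 * (l + 1)) (uIcc (Real.exp (-S)) (Real.exp S)) :=
    ((continuousOn_id.inv₀ fun l hl => (hpos l hl).ne').pow 2).mul (by fun_prop)
  have hd : ∀ l ∈ uIcc (Real.exp (-S)) (Real.exp S),
      HasDerivAt (fun l => Real.log l - l⁻¹) (l⁻¹ ^ 2 * (l + 1)) l := fun l hl => by
    have hl' := (hpos l hl).ne'
    have h3 : HasDerivAt (fun l => Real.log l - l⁻¹) (l⁻¹ - -(l ^ 2)⁻¹) l :=
      (Real.hasDerivAt_log hl').sub (hasDerivAt_inv hl')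
    have e : l⁻¹ ^ 2 * (l + 1) = l⁻¹ - -(l ^ 2)⁻¹ := by
      field_simp
      ring
    rwa [e]
  refine ⟨(intervalIntegrable_iff_integrableOn_Ioc_of_le hle).1 hc.intervalIntegrable, ?_⟩
  rw [← intervalIntegral.integral_of_le hle,
    intervalIntegral.integral_eq_sub_of_hasDerivAt hd hc.intervalIntegrable, Real.log_exp,
    Real.log_exp, Real.exp_neg, inv_inv]
  have : 0 < (Real.exp S)⁻¹ := inv_pos.2 h2
  linarith

/-- The basic estimate: the difference of the expectation values is the integral over `l > 0` of
the difference of the resolvents. Up to `e^{-πτ}` the resolvent of `M` itself is used as a bound,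
beyond `e^{πτ}` the constant trial function, and in between the band-limited one. -/
theorem abs_integral_sub_integral_le (hNM : N ≤ M) (hΩ : ‖Ω‖ = 1)
    (hM : IsCyclicSeparating M Ω) (hN : IsCyclicSeparating N Ω) {τ : ℝ} (hτ : 1 ≤ τ)
    {U : H →L[ℂ] H} (hUN : U ∈ N) (hUu : U ∈ unitary (H →L[ℂ] H))
    (hU : ∀ t : ℝ, |t| ≤ τ → modularFlow M Ω t U ∈ N)
    (hk : Integrable (fun k => k) (modularMeasure M Ω (U Ω))) :
    |∫ k, k ∂(modularMeasure M Ω (U Ω)) - ∫ k, k ∂(modularMeasure N Ω (U Ω))|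
      ≤ ∫ k, Real.log (1 + Real.exp (-(Real.pi * τ)) * Real.exp (-k)) ∂(modularMeasure M Ω (U Ω))
        + 49 * Real.exp (-(Real.pi * τ)) := by
  have hfM := isFiniteMeasure_modularMeasure hM (U Ω)
  have hfN := isFiniteMeasure_modularMeasure hN (U Ω)
  have hkN := integrable_modularMeasure_of_le hNM hM hN hUN hk
  obtain ⟨hM1, hMe, hMe1⟩ := modularMeasure_unitary hM hΩ (hNM hUN) hUu
  obtain ⟨hN1, -, -⟩ := modularMeasure_unitary hN hΩ hUN hUu
  obtain ⟨iM, eM⟩ := integral_eq_integral_resolvent hM1 hk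
  obtain ⟨iN, eN⟩ := integral_eq_integral_resolvent hN1 hkN
  have hmono := fun l (hl : 0 < l) => integral_inv_add_exp_mono hNM hM hN hl (U Ω)
  have hmid := fun l (hl : 0 < l) =>
    integral_inv_add_exp_sub_le_exp hNM hM hN hτ (hNM hUN) hU hl
  have hlarge := fun l (hl : 0 < l) =>
    integral_inv_add_exp_sub_le_of_large hNM hM hN (by linarith : 0 ≤ τ) (hNM hUN) hU hl
  have haN : ∀ l, 0 < l → 0 ≤ ∫ k, (l + Real.exp k)⁻¹ ∂(modularMeasure N Ω (U Ω)) := fun l hl =>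
    integral_nonneg fun k => by positivity
  set μ := modularMeasure M Ω (U Ω)
  set ν := modularMeasure N Ω (U Ω)
  set S := Real.pi * τ with hS
  have hS0 : 0 ≤ S := by positivity
  have hδ := Real.exp_pos (-S)
  have hδ1 : Real.exp (-S) ≤ 1 := Real.exp_le_one_iff.2 (by linarith)
  have hδS : Real.exp (-S) ≤ Real.exp S := Real.exp_le_exp.2 (by linarith)
  let D : ℝ → ℝ := fun l => ∫ k, (l + Real.exp k)⁻¹ ∂μ - ∫ k, (l + Real.exp k)⁻¹ ∂ν
  have hDeq : ∀ l, D l = ((1 + l)⁻¹ - ∫ k, (l + Real.exp k)⁻¹ ∂ν)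
      - ((1 + l)⁻¹ - ∫ k, (l + Real.exp k)⁻¹ ∂μ) := fun l => by ring
  have hDi : IntegrableOn D (Ioi 0) :=
    (iN.sub iM).congr (Eventually.of_forall fun l => (hDeq l).symm)
  have hD0 : ∀ l, 0 < l → 0 ≤ D l := fun l hl => sub_nonneg.2 (hmono l hl)
  have hDint : ∫ l in Ioi (0 : ℝ), D l = ∫ k, k ∂ν - ∫ k, k ∂μ := by
    rw [← eM, ← eN, ← integral_sub iN iM]
    exact integral_congr_ae (Eventually.of_forall hDeq)
  have hsplit : ∫ l in Ioi (0 : ℝ), D l = (∫ l in Ioc 0 (Real.exp (-S)), D l)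
      + ((∫ l in Ioc (Real.exp (-S)) (Real.exp S), D l) + ∫ l in Ioi (Real.exp S), D l) := by
    have s1 : Ioc (Real.exp (-S)) (Real.exp S) ⊆ Ioi 0 := fun l hl => hδ.trans hl.1
    have s2 : Ioi (Real.exp S) ⊆ Ioi 0 := fun l hl => (Real.exp_pos S).trans hl
    have s3 : Ioi (Real.exp (-S)) ⊆ Ioi 0 := fun l hl => hδ.trans hl
    rw [← setIntegral_union (Ioc_disjoint_Ioi le_rfl) measurableSet_Ioi (hDi.mono_set s1)
      (hDi.mono_set s2), Ioc_union_Ioi_eq_Ioi hδS, ← setIntegral_union (Ioc_disjoint_Ioi le_rfl)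
      measurableSet_Ioi (hDi.mono_set fun l hl => hl.1) (hDi.mono_set s3),
      Ioc_union_Ioi_eq_Ioi hδ.le]
  have hsmall : ∫ l in Ioc 0 (Real.exp (-S)), D l
      ≤ ∫ k, Real.log (1 + Real.exp (-S) * Real.exp (-k)) ∂μ := by
    have hlog : ∀ k : ℝ, 0 ≤ Real.log (1 + Real.exp (-S) * Real.exp (-k)) := fun k =>
      Real.log_nonneg (by have := Real.exp_pos (-k); nlinarith)
    refine (ENNReal.ofReal_le_ofReal_iff (integral_nonneg hlog)).1 ?_
    rw [ofReal_integral_eq_lintegral_ofReal (integrable_log_one_add hk hδ.le hδ1)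
      (Eventually.of_forall hlog), lintegral_log_one_add hδ.le,
      ofReal_integral_eq_lintegral_ofReal (hDi.mono_set fun l hl => hl.1)]
    · exact setLIntegral_mono' measurableSet_Ioc fun l hl =>
        ENNReal.ofReal_le_ofReal (sub_le_self _ (haN l hl.1))
    · filter_upwards [ae_restrict_mem measurableSet_Ioc] with l hl using hD0 l hl.1
  have hmiddle : ∫ l in Ioc (Real.exp (-S)) (Real.exp S), D l
      ≤ (4 * Real.exp (-S)) ^ 2 * (2 * S + Real.exp S) := by
    obtain ⟨j1, j2⟩ := integral_inv_add_inv_sq hS0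
    refine le_trans ?_ (mul_le_mul_of_nonneg_left j2 (by positivity))
    rw [← integral_const_mul]
    refine setIntegral_mono_on (hDi.mono_set fun l hl => hδ.trans hl.1) (j1.const_mul _)
      measurableSet_Ioc fun l hl => ?_
    have h1 := hmid l (hδ.trans hl.1)
    have h2 : ∫ k, (l + Real.exp k) ∂μ = l + 1 := by
      rw [integral_add (integrable_const _) hMe, hMe1,
        show (fun _ : ℝ => l) = fun _ => l * 1 by simp, integral_const_mul, hM1, mul_one]
    rw [h2] at h1
    exact h1
  have hbig : ∫ l in Ioi (Real.exp S), D l ≤ Real.exp (-S) := by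
    have h1 : ∀ l ∈ Ioi (Real.exp S), l ^ (-2 : ℝ) = l⁻¹ ^ 2 := fun l hl => by
      have : 0 < l := (Real.exp_pos S).trans hl
      rw [Real.rpow_neg this.le, inv_pow]
      norm_num
    have h2 := integrableOn_Ioi_rpow_of_lt (a := -2) (by norm_num) (Real.exp_pos S)
    have h3 := integral_Ioi_rpow_of_lt (a := -2) (by norm_num) (Real.exp_pos S)
    have h4 : ∫ l in Ioi (Real.exp S), l ^ (-2 : ℝ) = Real.exp (-S) := by
      rw [h3, Real.exp_neg]
      norm_num
      rw [Real.rpow_neg_one]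
    rw [← h4]
    refine setIntegral_mono_on (hDi.mono_set fun l hl => (Real.exp_pos S).trans hl) h2
      measurableSet_Ioi fun l hl => ?_
    have h5 := hlarge l ((Real.exp_pos S).trans hl)
    rw [hMe1, mul_one] at h5
    rw [h1 l hl]
    exact h5
  have hDnn : 0 ≤ ∫ l in Ioi (0 : ℝ), D l :=
    setIntegral_nonneg measurableSet_Ioi fun l hl => hD0 l hl
  rw [abs_sub_comm, ← hDint, abs_of_nonneg hDnn, hsplit]
  have hSe : S * Real.exp (-S) ≤ 1 := by
    have h1 := Real.add_one_le_exp S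
    rw [Real.exp_neg, ← div_eq_mul_inv, div_le_one (Real.exp_pos S)]
    linarith
  have hee : Real.exp S * Real.exp (-S) = 1 := by rw [← Real.exp_add, add_neg_cancel, Real.exp_zero]
  have hfin : (4 * Real.exp (-S)) ^ 2 * (2 * S + Real.exp S) ≤ 48 * Real.exp (-S) := by
    have e : (4 * Real.exp (-S)) ^ 2 * (2 * S + Real.exp S)
        = (32 * (S * Real.exp (-S)) + 16 * (Real.exp S * Real.exp (-S))) * Real.exp (-S) := by ring
    rw [e, hee]
    exact mul_le_mul_of_nonneg_right (by linarith) hδ.le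
  linarith

/-- The estimate in terms of a weight `w` that dominates `log (1 + e^{-πτ-k})` up to a factor. -/
theorem modularExpectation_bound (hNM : N ≤ M) (hΩ : ‖Ω‖ = 1)
    (hM : IsCyclicSeparating M Ω) (hN : IsCyclicSeparating N Ω) {τ : ℝ} (hτ : 1 ≤ τ)
    {U : H →L[ℂ] H} (hUN : U ∈ N) (hUu : U ∈ unitary (H →L[ℂ] H))
    (hU : ∀ t : ℝ, |t| ≤ τ → modularFlow M Ω t U ∈ N) {w : ℝ → ℝ} {c : ℝ}
    (hw : ∀ k, 1 ≤ w k) (hlog : ∀ k, Real.log (1 + Real.exp (-(Real.pi * τ) - k)) ≤ c * w k)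
    (hc : Real.exp (-(Real.pi * τ)) ≤ c) (hwi : HasModularExpectation M Ω w (U Ω)) :
    HasModularExpectation M Ω (fun k => k) (U Ω) ∧ HasModularExpectation N Ω (fun k => k) (U Ω) ∧
      |modularExpectation M Ω (fun k => k) (U Ω) - modularExpectation N Ω (fun k => k) (U Ω)|
        ≤ 50 * c * modularExpectation M Ω w (U Ω) := by
  have hfM := isFiniteMeasure_modularMeasure hM (U Ω)
  obtain ⟨hM1, hMe, -⟩ := modularMeasure_unitary hM hΩ (hNM hUN) hUu
  unfold HasModularExpectation modularExpectation at *
  have hlog' : ∀ k : ℝ, Real.log (1 + Real.exp (-(Real.pi * τ)) * Real.exp (-k)) ≤ c * w k := fun k => by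
    rw [← Real.exp_add, ← sub_eq_add_neg]
    exact hlog k
  have hc0 : 0 < c := (Real.exp_pos _).trans_le hc
  have hk : Integrable (fun k => k) (modularMeasure M Ω (U Ω)) := by
    refine Integrable.mono' (((integrable_const (Real.pi * τ)).add (hwi.const_mul c)).add hMe)
      measurable_id.aestronglyMeasurable (Eventually.of_forall fun k => ?_)
    have h1 : -(Real.pi * τ) - k ≤ Real.log (1 + Real.exp (-(Real.pi * τ) - k)) := by
      rw [Real.le_log_iff_exp_le (by positivity)]
      linarith
    have h2 := hlog k
    have h3 := Real.add_one_le_exp k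
    have h4 := Real.exp_pos k
    have h5 : 0 ≤ c * w k := mul_nonneg hc0.le (by linarith [hw k])
    have h6 : 0 ≤ Real.pi * τ := by positivity
    simp only [Pi.add_apply]
    rw [Real.norm_eq_abs, abs_le]
    constructor <;> linarith
  refine ⟨hk, integrable_modularMeasure_of_le hNM hM hN hUN hk,
    (abs_integral_sub_integral_le hNM hΩ hM hN hτ hUN hUu hU hk).trans ?_⟩
  have h1 : ∫ k, Real.log (1 + Real.exp (-(Real.pi * τ)) * Real.exp (-k)) ∂(modularMeasure M Ω (U Ω))
      ≤ c * ∫ k, w k ∂(modularMeasure M Ω (U Ω)) := by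
    rw [← integral_const_mul]
    refine integral_mono (integrable_log_one_add hk (Real.exp_pos _).le ?_) (hwi.const_mul c) hlog'
    exact Real.exp_le_one_iff.2 (neg_nonpos.2 (by positivity))
  have h2 : 1 ≤ ∫ k, w k ∂(modularMeasure M Ω (U Ω)) := by
    rw [← hM1]
    exact integral_mono (integrable_const _) hwi hw
  nlinarith

end Estimate

/-! ### Comparison of weights -/

section Weights

theorem rpow_le_mul_exp {p x : ℝ} (hp : 0 < p) (hx : 0 ≤ x) : x ^ p ≤ p ^ p * Real.exp x := by
  have h1 : x / p ≤ Real.exp (x / p) := by linarith [Real.add_one_le_exp (x / p)]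
  have h2 := Real.rpow_le_rpow (by positivity) h1 hp.le
  rw [Real.div_rpow hx hp.le, ← Real.exp_mul, div_mul_cancel₀ _ hp.ne',
    div_le_iff₀ (by positivity)] at h2
  linarith

theorem log_one_add_exp_le_exp (x : ℝ) : Real.log (1 + Real.exp x) ≤ Real.exp x := by
  have := Real.log_le_sub_one_of_pos (show 0 < 1 + Real.exp x by positivity)
  linarith

theorem log_one_add_exp_le_one_add {x : ℝ} (hx : 0 ≤ x) : Real.log (1 + Real.exp x) ≤ 1 + x := by
  rw [Real.log_le_iff_le_exp (by positivity), Real.exp_add]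
  have h1 := Real.one_le_exp hx
  have h2 := Real.add_one_le_exp 1
  nlinarith

theorem log_one_add_exp_mono {x y : ℝ} (h : x ≤ y) :
    Real.log (1 + Real.exp x) ≤ Real.log (1 + Real.exp y) :=
  Real.log_le_log (by positivity) (by linarith [Real.exp_le_exp.2 h])

theorem exp_neg_le_mul_rpow {n τ : ℝ} (hn : 1 < n) (hτ : 0 < τ) :
    Real.exp (-τ) ≤ (n - 1) ^ (n - 1) * τ ^ (1 - n) := by
  have h := rpow_le_mul_exp (sub_pos.2 hn) hτ.le
  rw [show 1 - n = -(n - 1) by ring, Real.rpow_neg hτ.le, Real.exp_neg, ← div_eq_mul_inv,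
    le_div_iff₀ (Real.rpow_pos_of_pos hτ _), inv_mul_le_iff₀ (Real.exp_pos _), mul_comm]
  exact h

/-- Comparison with the polynomial weight: for `m ≤ τ` the left side is exponentially small,
for larger `m` it is at most `1 + m`. -/
theorem log_one_add_exp_le_rpow {n τ m : ℝ} (hn : 1 < n) (hτ : 1 ≤ τ) (hm : 0 ≤ m) :
    Real.log (1 + Real.exp (m - Real.pi * τ))
      ≤ ((n - 1) ^ (n - 1) + 1) * τ ^ (1 - n) * (1 + m) ^ n := by
  have hp : 0 < n - 1 := by linarith
  have hτ0 : 0 < τ := by linarith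
  have hpi := Real.pi_gt_three
  have hw : 1 ≤ (1 + m) ^ n := Real.one_le_rpow (by linarith) (by linarith)
  have hrate : 0 < τ ^ (1 - n) := Real.rpow_pos_of_pos hτ0 _
  have hpp : 0 < (n - 1) ^ (n - 1) := Real.rpow_pos_of_pos hp _
  rcases le_total m τ with h | h
  · have h1 : Real.exp (m - Real.pi * τ) ≤ Real.exp (-τ) := Real.exp_le_exp.2 (by nlinarith)
    have h2 := exp_neg_le_mul_rpow hn hτ0
    refine (log_one_add_exp_le_exp _).trans (h1.trans (h2.trans ?_))
    have h3 : (n - 1) ^ (n - 1) * τ ^ (1 - n) ≤ ((n - 1) ^ (n - 1) + 1) * τ ^ (1 - n) := by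
      nlinarith
    exact h3.trans (le_mul_of_one_le_right (by positivity) hw)
  · have h1 : Real.log (1 + Real.exp (m - Real.pi * τ)) ≤ 1 + m :=
      (log_one_add_exp_mono (by nlinarith)).trans (log_one_add_exp_le_one_add hm)
    have h2 : 1 + m = (1 + m) ^ (1 - n) * (1 + m) ^ n := by
      rw [← Real.rpow_add (by linarith), sub_add_cancel, Real.rpow_one]
    have h3 : (1 + m) ^ (1 - n) ≤ τ ^ (1 - n) :=
      Real.rpow_le_rpow_of_nonpos hτ0 (by linarith) (by linarith)
    refine h1.trans (h2.le.trans ?_)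
    have h4 : τ ^ (1 - n) ≤ ((n - 1) ^ (n - 1) + 1) * τ ^ (1 - n) :=
      le_mul_of_one_le_left hrate.le (by linarith)
    exact mul_le_mul_of_nonneg_right (h3.trans h4) (zero_le_one.trans hw)

/-- `S ↦ S - S ^ α` is almost increasing, with defect at most `1`. -/
theorem sub_le_one_add_rpow_sub_rpow {α m S : ℝ} (hα1 : α ≤ 1) (hm : 0 ≤ m)
    (hmS : m ≤ S) (hS : 1 ≤ S) : m - S ≤ 1 + m ^ α - S ^ α := by
  rcases le_total m 1 with h | h
  · have h1 : S ^ α ≤ S := by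
      simpa using Real.rpow_le_rpow_of_exponent_le hS hα1
    have h2 : 0 ≤ m ^ α := Real.rpow_nonneg hm _
    linarith
  · have hm0 : 0 < m := by linarith
    have hr : 1 ≤ S / m := (one_le_div hm0).2 hmS
    have h1 : (S / m) ^ α ≤ S / m := by
      simpa using Real.rpow_le_rpow_of_exponent_le hr hα1
    have h2 : m ^ α ≤ m := by
      simpa using Real.rpow_le_rpow_of_exponent_le h hα1
    have h3 : S ^ α = m ^ α * (S / m) ^ α := by
      rw [← Real.mul_rpow hm0.le (by positivity), mul_div_cancel₀ _ hm0.ne']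
    have h4 : S = m * (S / m) := by rw [mul_div_cancel₀ _ hm0.ne']
    have h5 : 0 ≤ m ^ α := Real.rpow_nonneg hm _
    have h6 : S ^ α - m ^ α ≤ S - m := by
      calc S ^ α - m ^ α = m ^ α * ((S / m) ^ α - 1) := by rw [h3]; ring
        _ ≤ m ^ α * (S / m - 1) := mul_le_mul_of_nonneg_left (by linarith) h5
        _ ≤ m * (S / m - 1) := mul_le_mul_of_nonneg_right h2 (by linarith)
        _ = S - m := by rw [mul_sub, ← h4, mul_one]
    linarith

/-- With `p = 1 / α`, `v = S ^ α` and `y = m ^ α - S ^ α`, this is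
`(v + y) ^ p - v ^ p ≤ p y (v + y) ^ (p - 1) ≤ p v ^ (p - 1) (1 + y) ^ p`. -/
theorem sub_le_mul_exp_rpow_sub_rpow {α m S : ℝ} (hα : 0 < α) (hα1 : α ≤ 1) (hS : 1 ≤ S)
    (hSm : S ≤ m) :
    m - S ≤ 3 * (1 / α) * (1 / α) ^ (1 / α) * S ^ (1 - α) * Real.exp (m ^ α - S ^ α) := by
  set p := 1 / α with hpdef
  have hp1 : 1 ≤ p := (one_le_div hα).2 hα1
  have hp0 : 0 < p := by linarith
  have hS0 : 0 < S := by linarith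
  have hm0 : 0 < m := by linarith
  have hαp : α * p = 1 := by rw [hpdef, mul_one_div_cancel hα.ne']
  set u := m ^ α
  set v := S ^ α
  have hv1 : 1 ≤ v := Real.one_le_rpow hS hα.le
  have hvu : v ≤ u := Real.rpow_le_rpow hS0.le hSm hα.le
  have hu0 : 0 < u := by linarith
  have hum : u ^ p = m := by rw [← Real.rpow_mul hm0.le, hαp, Real.rpow_one]
  have hvS : v ^ p = S := by rw [← Real.rpow_mul hS0.le, hαp, Real.rpow_one]
  have hy : 0 ≤ u - v := by linarith
  have h1 : m - S ≤ p * (u - v) * u ^ (p - 1) := by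
    have h2 := one_add_mul_self_le_rpow_one_add (s := -((u - v) / u)) (by
      rw [neg_le_neg_iff, div_le_one hu0]
      linarith) hp1
    have h3 : 1 + -((u - v) / u) = v / u := by
      field_simp
      ring
    rw [h3, Real.div_rpow (by linarith) hu0.le, hvS, hum, le_div_iff₀ hm0] at h2
    have h4 : u ^ (p - 1) = m / u := by rw [Real.rpow_sub_one hu0.ne', hum]
    rw [h4]
    have h5 : (1 + p * -((u - v) / u)) * m = m - p * (u - v) * (m / u) := by
      field_simp
      ring
    linarith
  have h2 : u ^ (p - 1) ≤ S ^ (1 - α) * (1 + (u - v)) ^ (p - 1) := by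
    have h3 : v ^ (p - 1) = S ^ (1 - α) := by
      rw [← Real.rpow_mul hS0.le, mul_sub, hαp, mul_one]
    rw [← h3, ← Real.mul_rpow (by linarith) (by linarith)]
    exact Real.rpow_le_rpow hu0.le (by nlinarith) (by linarith)
  have h3 : (u - v) * (1 + (u - v)) ^ (p - 1) ≤ 3 * p ^ p * Real.exp (u - v) := by
    have h4 : (u - v) * (1 + (u - v)) ^ (p - 1) ≤ (1 + (u - v)) ^ p := by
      rw [Real.rpow_sub_one (by linarith), mul_div_assoc']
      rw [div_le_iff₀ (by linarith)]
      have := Real.rpow_nonneg (show 0 ≤ 1 + (u - v) by linarith) p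
      nlinarith
    refine h4.trans ((rpow_le_mul_exp hp0 (by linarith)).trans ?_)
    have h5 : Real.exp 1 ≤ 3 := Real.exp_one_lt_three.le
    rw [Real.exp_add]
    have h6 : 0 < p ^ p * Real.exp (u - v) := by positivity
    nlinarith
  have hSr : 0 < S ^ (1 - α) := Real.rpow_pos_of_pos hS0 _
  calc m - S ≤ p * (u - v) * u ^ (p - 1) := h1
    _ ≤ p * (u - v) * (S ^ (1 - α) * (1 + (u - v)) ^ (p - 1)) :=
        mul_le_mul_of_nonneg_left h2 (by positivity)
    _ = p * S ^ (1 - α) * ((u - v) * (1 + (u - v)) ^ (p - 1)) := by ring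
    _ ≤ p * S ^ (1 - α) * (3 * p ^ p * Real.exp (u - v)) :=
        mul_le_mul_of_nonneg_left h3 (by positivity)
    _ = 3 * p * p ^ p * S ^ (1 - α) * Real.exp (u - v) := by ring

/-- Comparison with the stretched exponential weight. -/
theorem log_one_add_exp_le_exp_rpow {α τ m : ℝ} (hα : 0 < α) (hα1 : α ≤ 1) (hτ : 1 ≤ τ)
    (hm : 0 ≤ m) :
    Real.log (1 + Real.exp (m - Real.pi * τ))
      ≤ (12 * (1 / α) * (1 / α) ^ (1 / α) + 3)
        * (τ ^ (1 - α) * Real.exp (-(Real.pi * τ) ^ α)) * Real.exp (m ^ α) := by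
  have hpi := Real.pi_gt_three
  have hS : 1 ≤ Real.pi * τ := by nlinarith
  have hτr : 1 ≤ τ ^ (1 - α) := Real.one_le_rpow hτ (by linarith)
  set K := (1 / α) * (1 / α) ^ (1 / α) with hK
  have hK0 : 0 < K := by positivity
  have hSτ : (Real.pi * τ) ^ (1 - α) ≤ 4 * τ ^ (1 - α) := by
    rw [Real.mul_rpow Real.pi_pos.le (by linarith)]
    refine mul_le_mul_of_nonneg_right ?_ (by linarith)
    have h1 : Real.pi ^ (1 - α) ≤ Real.pi ^ (1 : ℝ) :=
      Real.rpow_le_rpow_of_exponent_le (by linarith) (by linarith)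
    rw [Real.rpow_one] at h1
    exact h1.trans Real.pi_le_four
  set S := Real.pi * τ
  have hcoef : (12 * (1 / α) * (1 / α) ^ (1 / α) + 3)
        * (τ ^ (1 - α) * Real.exp (-S ^ α)) * Real.exp (m ^ α)
      = (12 * K + 3) * τ ^ (1 - α) * Real.exp (m ^ α - S ^ α) := by
    rw [sub_eq_add_neg (m ^ α), Real.exp_add, hK]
    ring
  rw [hcoef]
  have hE := Real.exp_pos (m ^ α - S ^ α)
  set E := Real.exp (m ^ α - S ^ α) with hEdef
  rcases le_total m S with h | h
  · have h1 : Real.exp (m - S) ≤ 3 * E := by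
      refine (Real.exp_le_exp.2 (sub_le_one_add_rpow_sub_rpow hα1 hm h hS)).trans ?_
      rw [add_sub_assoc, Real.exp_add]
      exact mul_le_mul_of_nonneg_right Real.exp_one_lt_three.le hE.le
    refine (log_one_add_exp_le_exp _).trans (h1.trans (mul_le_mul_of_nonneg_right ?_ hE.le))
    nlinarith
  · have h1 := sub_le_mul_exp_rpow_sub_rpow hα hα1 hS h
    have h2 : 1 ≤ E := Real.one_le_exp (sub_nonneg.2 (Real.rpow_le_rpow (by linarith) h hα.le))
    have h3 : 3 * (1 / α) * (1 / α) ^ (1 / α) * S ^ (1 - α) * Real.exp (m ^ α - S ^ α)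
        ≤ 12 * K * τ ^ (1 - α) * E := by
      have h4 : 3 * (1 / α) * (1 / α) ^ (1 / α) * S ^ (1 - α) * Real.exp (m ^ α - S ^ α)
          = 3 * K * S ^ (1 - α) * E := by rw [hK]; ring
      rw [h4]
      refine mul_le_mul_of_nonneg_right ?_ hE.le
      nlinarith
    refine (log_one_add_exp_le_one_add (sub_nonneg.2 h)).trans ?_
    have h5 : 1 ≤ 3 * τ ^ (1 - α) * E := by nlinarith
    linarith

end Weights

end Modular

theorem proposition1 :
    (∀ n : ℝ, 1 < n → ∃ C τ₀ : ℝ, 0 < C ∧ 0 < τ₀ ∧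
      ∀ (H : Type u) [NormedAddCommGroup H] [InnerProductSpace ℂ H] [CompleteSpace H]
        (M₁ M₂ : VonNeumannAlgebra H) (Ω : H),
        M₂ ≤ M₁ → ‖Ω‖ = 1 →
        Modular.IsCyclicSeparating M₁ Ω → Modular.IsCyclicSeparating M₂ Ω →
        ∀ τ : ℝ, τ₀ ≤ τ → ∀ U ∈ M₂, U ∈ unitary (H →L[ℂ] H) →
          (∀ t : ℝ, |t| ≤ τ → Modular.modularFlow M₁ Ω t U ∈ M₂) →
          Modular.HasModularExpectation M₁ Ω (fun k => (1 + max (-k) 0) ^ n) (U Ω) →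
            Modular.HasModularExpectation M₁ Ω (fun k => k) (U Ω) ∧
            Modular.HasModularExpectation M₂ Ω (fun k => k) (U Ω) ∧
            |Modular.modularExpectation M₁ Ω (fun k => k) (U Ω)
                - Modular.modularExpectation M₂ Ω (fun k => k) (U Ω)|
              ≤ C * τ ^ (1 - n) *
                Modular.modularExpectation M₁ Ω (fun k => (1 + max (-k) 0) ^ n) (U Ω)) ∧
    (∀ α : ℝ, 0 < α → α ≤ 1 → ∃ C τ₀ : ℝ, 0 < C ∧ 0 < τ₀ ∧
      ∀ (H : Type u) [NormedAddCommGroup H] [InnerProductSpace ℂ H] [CompleteSpace H]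
        (M₁ M₂ : VonNeumannAlgebra H) (Ω : H),
        M₂ ≤ M₁ → ‖Ω‖ = 1 →
        Modular.IsCyclicSeparating M₁ Ω → Modular.IsCyclicSeparating M₂ Ω →
        ∀ τ : ℝ, τ₀ ≤ τ → ∀ U ∈ M₂, U ∈ unitary (H →L[ℂ] H) →
          (∀ t : ℝ, |t| ≤ τ → Modular.modularFlow M₁ Ω t U ∈ M₂) →
          Modular.HasModularExpectation M₁ Ω (fun k => Real.exp ((max (-k) 0) ^ α)) (U Ω) →
            Modular.HasModularExpectation M₁ Ω (fun k => k) (U Ω) ∧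
            Modular.HasModularExpectation M₂ Ω (fun k => k) (U Ω) ∧
            |Modular.modularExpectation M₁ Ω (fun k => k) (U Ω)
                - Modular.modularExpectation M₂ Ω (fun k => k) (U Ω)|
              ≤ C * (τ ^ (1 - α) * Real.exp (-(Real.pi * τ) ^ α)) *
                Modular.modularExpectation M₁ Ω (fun k => Real.exp ((max (-k) 0) ^ α)) (U Ω)) := by
  have hneg : ∀ τ k : ℝ, Real.log (1 + Real.exp (-(Real.pi * τ) - k))
      ≤ Real.log (1 + Real.exp (max (-k) 0 - Real.pi * τ)) := fun τ k =>
    Modular.log_one_add_exp_mono (by linarith [le_max_left (-k) 0])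
  have hpi := Real.pi_gt_three
  constructor
  · intro n hn
    have hp : 0 < (n - 1) ^ (n - 1) := Real.rpow_pos_of_pos (sub_pos.2 hn) _
    refine ⟨50 * ((n - 1) ^ (n - 1) + 1), 1, by positivity, one_pos, ?_⟩
    intro H _ _ _ M₁ M₂ Ω hle hΩ h₁ h₂ τ hτ U hU hUu hflow hw
    have hτ0 : 0 < τ := by linarith
    have hr : 0 < τ ^ (1 - n) := Real.rpow_pos_of_pos hτ0 _
    have h := Modular.modularExpectation_bound (c := ((n - 1) ^ (n - 1) + 1) * τ ^ (1 - n)) hle hΩ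
      h₁ h₂ hτ hU hUu hflow
      (fun k => Real.one_le_rpow (by linarith [le_max_right (-k) 0]) (by linarith))
      (fun k => (hneg τ k).trans (Modular.log_one_add_exp_le_rpow hn hτ (le_max_right _ _)))
      (by
        have h1 : Real.exp (-(Real.pi * τ)) ≤ Real.exp (-τ) := Real.exp_le_exp.2 (by nlinarith)
        refine h1.trans ((Modular.exp_neg_le_mul_rpow hn hτ0).trans ?_)
        exact mul_le_mul_of_nonneg_right (by linarith) hr.le) hw
    rwa [← mul_assoc 50] at h
  · intro α hα hα1
    have hp : 0 < (1 / α) ^ (1 / α) := by positivity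
    refine ⟨50 * (12 * (1 / α) * (1 / α) ^ (1 / α) + 3), 1, by positivity, one_pos, ?_⟩
    intro H _ _ _ M₁ M₂ Ω hle hΩ h₁ h₂ τ hτ U hU hUu hflow hw
    have h := Modular.modularExpectation_bound (c := (12 * (1 / α) * (1 / α) ^ (1 / α) + 3)
      * (τ ^ (1 - α) * Real.exp (-(Real.pi * τ) ^ α))) hle hΩ h₁ h₂ hτ hU hUu hflow
      (fun k => Real.one_le_exp (Real.rpow_nonneg (le_max_right _ _) _))
      (fun k => (hneg τ k).trans
        (Modular.log_one_add_exp_le_exp_rpow hα hα1 hτ (le_max_right _ _)))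
      (by
        have hS : 1 ≤ Real.pi * τ := by nlinarith
        have h1 : (Real.pi * τ) ^ α ≤ Real.pi * τ := by
          simpa using Real.rpow_le_rpow_of_exponent_le hS hα1
        have h2 : Real.exp (-(Real.pi * τ)) ≤ Real.exp (-(Real.pi * τ) ^ α) :=
          Real.exp_le_exp.2 (neg_le_neg h1)
        have h3 : 1 ≤ τ ^ (1 - α) := Real.one_le_rpow hτ (by linarith)
        have h4 : 1 ≤ 12 * (1 / α) * (1 / α) ^ (1 / α) + 3 := by
          have : 0 < 12 * (1 / α) * (1 / α) ^ (1 / α) := by positivity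
          linarith
        have h5 := Real.exp_pos (-(Real.pi * τ) ^ α)
        exact h2.trans ((le_mul_of_one_le_left h5.le h3).trans
          (le_mul_of_one_le_left (by positivity) h4))) hw
    rwa [← mul_assoc 50] at h
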